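/- **Setting.** Let $d\ge 1$, let $\Omega\subset\mathbb R^d$ be a bounded open set with smooth boundary and outward unit normal $\nu$, let $\underline\theta<\overline\theta$, $k>0$, $N\in\mathbb N$. Let $c_0:\mathbb R^d\to[1,\infty)$ be measurable and bounded on $\Omega$, and let $u_0(\mathbf x,\theta)\in\mathbb C$ be of class $C^3$ on $U\times[\underline\theta,\overline\theta]$ for some open neighbourhood $U$ of $\overline\Omega$, without zeros on $\overline\Omega\times[\underline\theta,\overline\theta]$. Put $\theta_0=(\underline\theta+\overline\theta)/2$ and let $(\Psi_n)_{n\ge1}$ be the orthonormal sequence obtained by the Gram–Schmidt procedure in $L^2(\underline\theta,\overline\theta)$ from $\phi_n(\theta)=(\theta-\theta_0)^{n-1}e^{\theta-\theta_0}$. For $1\le m,n\le N$ let $s_{mn}=\int_{\underline\theta}^{\overline\theta}\Psi_m\Psi_n'\,d\theta$ and, for $\mathbf x\in\Omega$, $$a_{mn}(\mathbf x)=\int_{\underline\theta}^{\overline\theta}\Big[\partial_\theta\Big(\frac{\Delta u_0}{u_0}+k^2c_0\Big)\Psi_n+\Big(\frac{\Delta u_0}{u_0}+k^2c_0\Big)\Psi_n'\Big]\Psi_m\,d\theta,$$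 $$\mathbf b_{mn}(\mathbf x)=2\int_{\underline\theta}^{\overline\theta}\Big[\frac{\nabla u_0}{u_0}\Psi_n'+\partial_\theta\Big(\frac{\nabla u_0}{u_0}\Big)\Psi_n\Big]\Psi_m\,d\theta,$$ where $\Delta,\nabla$ act in $\mathbf x$, and let $S=(s_{mn})$, $A=(a_{mn})$, $\mathbf B=(\mathbf b_{mn})$. All Sobolev functions are complex valued, and boundary values are understood in the sense of traces (as elements of $L^2(\partial\Omega)^N$). For boundary data $F^\delta,G^\delta:\partial\Omega\to\mathbb C^N$ and $\epsilon>0$ let $$H=\{V\in H^2(\Omega)^N:\ V|_{\partial\Omega}=F^\delta,\ \partial_\nu V|_{\partial\Omega}=G^\delta\},$$ $$J(W)=\int_\Omega|\Delta W+S^{-1}AW+S^{-1}\mathbf B\cdot\nabla W|^2\,d\mathbf x+\epsilon\|W\|^2_{H^2(\Omega)^N}.$$ **Theorem.** (i) For all $F^\delta,G^\delta$ such that $H\neq\emptyset$ and every $\epsilon>0$, the functional $J$ has a unique minimizer in $H$. (ii) There is a constant $C>0$, depending only on $d,\Omega,N,\underline\theta,\overline\theta,k,c_0,u_0$, such that the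 following holds for all $\delta>0$, $\epsilon>0$ and all boundary data $F^*,G^*,F^\delta,G^\delta$ with $H\ne\emptyset$. Suppose that the noise level is $\delta$, i.e. there is $\mathcal E\in H^2(\Omega)^N$ with $\mathcal E|_{\partial\Omega}=F^\delta-F^*$, $\partial_\nu\mathcal E|_{\partial\Omega}=G^\delta-G^*$ and $\|\mathcal E\|_{H^2(\Omega)^N}\le\delta$, and let $W^*\in H^2(\Omega)^N$ be a (true) solution of $\Delta W^*+S^{-1}AW^*+S^{-1}\mathbf B\cdot\nabla W^*=0$ in $\Omega$, $W^*|_{\partial\Omega}=F^*$, $\partial_\nu W^*|_{\partial\Omega}=G^*$. Then the minimizer $W_{\min}$ of $J$ in $H$ satisfies $$\|W_{\min}-W^*\|^2_{H^1(\Omega)^N}\le C\big(\delta^2+\epsilon\|W^*\|^2_{H^2(\Omega)^N}\big).$$ -/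

import Mathlib

open MeasureTheory Filter Topology Set
open scoped ContDiff ENNReal Laplacian

noncomputable section

namespace QuasiReversibility

/-- The space `ℝ^d` with its Euclidean norm. -/
abbrev E (d : ℕ) : Type := EuclideanSpace ℝ (Fin d)

/-- The `i`-th vector of the standard basis of `ℝ^d`. -/
def e {d : ℕ} (i : Fin d) : E d := EuclideanSpace.single i (1 : ℝ)

/-- The classical partial derivative `∂v/∂x_i`. -/
def pd {d : ℕ} (i : Fin d) (v : E d → ℂ) (x : E d) : ℂ := fderiv ℝ v x (e i)

/-! ### The domain, its boundary and its outer normal -/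

/-- `ρ` is a smooth defining function of `Ω` in the open set `U`: it has no critical point in `U`,
and `Ω ∩ U = {ρ < 0} ∩ U`. -/
structure IsDefiningFunctionOn {d : ℕ} (Ω U : Set (E d)) (ρ : E d → ℝ) : Prop where
  isOpen : IsOpen U
  smooth : ContDiff ℝ ∞ ρ
  gradient_ne_zero : ∀ x ∈ U, gradient ρ x ≠ 0
  mem_iff : ∀ x ∈ U, (x ∈ Ω ↔ ρ x < 0)

/-- `Ω` has a smooth boundary: near each boundary point it has a smooth defining function. -/
def HasSmoothBoundary {d : ℕ} (Ω : Set (E d)) : Prop :=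
  ∀ p ∈ frontier Ω, ∃ (U : Set (E d)) (ρ : E d → ℝ), p ∈ U ∧ IsDefiningFunctionOn Ω U ρ

/-- `n` is the outward unit normal vector of `Ω` at the boundary point `p`: it is `∇ρ(p) / |∇ρ(p)|`
for a defining function `ρ` near `p` (it does not depend on `ρ`). -/
def IsOuterUnitNormal {d : ℕ} (Ω : Set (E d)) (p n : E d) : Prop :=
  ∃ (U : Set (E d)) (ρ : E d → ℝ), p ∈ U ∧ IsDefiningFunctionOn Ω U ρ ∧
    n = ‖gradient ρ p‖⁻¹ • gradient ρ p

/-- The surface measure on `∂Ω`, the `(d-1)`-dimensional Hausdorff measure. (Its normalization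
plays no role below: it only enters through convergence in `L²(∂Ω)`.) -/
def surfaceMeasure {d : ℕ} (Ω : Set (E d)) : Measure (E d) :=
  (Measure.hausdorffMeasure ((d : ℝ) - 1)).restrict (frontier Ω)

/-! ### Weak derivatives and Sobolev spaces -/

/-- The space `L²(Ω)` of complex valued functions. -/
abbrev L2 {d : ℕ} (Ω : Set (E d)) : Type := Lp ℂ 2 (volume.restrict Ω)

/-- `v` is the weak partial derivative `∂u/∂x_i` in `Ω`. -/
def HasWeakPartial {d : ℕ} (Ω : Set (E d)) (i : Fin d) (u v : L2 Ω) : Prop :=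
  ∀ φ : E d → ℝ, ContDiff ℝ ∞ φ → HasCompactSupport φ → tsupport φ ⊆ Ω →
    ∫ x in Ω, fderiv ℝ φ x (e i) • u x = - ∫ x in Ω, φ x • v x

open Classical in
/-- The weak partial derivative `∂u/∂x_i` as an element of `L²(Ω)` (it is unique for open `Ω`); the
value is `0` if there is none. -/
def weakPartial {d : ℕ} (Ω : Set (E d)) (i : Fin d) (u : L2 Ω) : L2 Ω :=
  if h : ∃ v : L2 Ω, HasWeakPartial Ω i u v then h.choose else 0

/-- `u ∈ H¹(Ω)`. -/
def MemH1 {d : ℕ} (Ω : Set (E d)) (u : L2 Ω) : Prop :=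
  ∀ i, ∃ v : L2 Ω, HasWeakPartial Ω i u v

/-- `u ∈ H²(Ω)`. -/
def MemH2 {d : ℕ} (Ω : Set (E d)) (u : L2 Ω) : Prop :=
  MemH1 Ω u ∧ ∀ i, MemH1 Ω (weakPartial Ω i u)

/-- The squared norm of `H¹(Ω)^N`. -/
def normSqH1 {d N : ℕ} (Ω : Set (E d)) (W : Fin N → L2 Ω) : ℝ :=
  ∑ n, (‖W n‖ ^ 2 + ∑ i, ‖weakPartial Ω i (W n)‖ ^ 2)

/-- The squared norm of `H²(Ω)^N`. -/
def normSqH2 {d N : ℕ} (Ω : Set (E d)) (W : Fin N → L2 Ω) : ℝ :=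
  normSqH1 Ω W + ∑ n, ∑ i, ∑ j, ‖weakPartial Ω j (weakPartial Ω i (W n))‖ ^ 2

/-! ### Traces

The trace maps `u ↦ u|_{∂Ω}` and `u ↦ ∂_ν u|_{∂Ω}` are the continuous extensions to `H¹(Ω)` and to
`H²(Ω)` of the restriction and of the normal derivative of functions that are smooth up to the
boundary. -/

/-- The smooth functions `v n` converge to `u` in `H¹(Ω)`. -/
def TendstoH1 {d : ℕ} (Ω : Set (E d)) (v : ℕ → E d → ℂ) (u : L2 Ω) : Prop :=
  Tendsto (fun n => eLpNorm (fun x => v n x - u x) 2 (volume.restrict Ω)) atTop (𝓝 0) ∧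
  ∀ i, Tendsto (fun n => eLpNorm (fun x => pd i (v n) x - weakPartial Ω i u x) 2
    (volume.restrict Ω)) atTop (𝓝 0)

/-- The smooth functions `v n` converge to `u` in `H²(Ω)`. -/
def TendstoH2 {d : ℕ} (Ω : Set (E d)) (v : ℕ → E d → ℂ) (u : L2 Ω) : Prop :=
  TendstoH1 Ω v u ∧ ∀ i, TendstoH1 Ω (fun n => pd i (v n)) (weakPartial Ω i u)

/-- `u|_{∂Ω} = g` in the sense of traces. -/
def HasTrace {d : ℕ} (Ω : Set (E d)) (u : L2 Ω) (g : E d → ℂ) : Prop :=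
  MemLp g 2 (surfaceMeasure Ω) ∧
  ∃ v : ℕ → E d → ℂ, (∀ n, ContDiff ℝ ∞ (v n)) ∧ TendstoH1 Ω v u ∧
    Tendsto (fun n => eLpNorm (fun x => v n x - g x) 2 (surfaceMeasure Ω)) atTop (𝓝 0)

/-- `∂_ν u|_{∂Ω} = g` in the sense of traces. -/
def HasNormalTrace {d : ℕ} (Ω : Set (E d)) (ν : E d → E d) (u : L2 Ω) (g : E d → ℂ) : Prop :=
  MemLp g 2 (surfaceMeasure Ω) ∧
  ∃ v : ℕ → E d → ℂ, (∀ n, ContDiff ℝ ∞ (v n)) ∧ TendstoH2 Ω v u ∧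
    Tendsto (fun n => eLpNorm (fun x => fderiv ℝ (v n) x (ν x) - g x) 2 (surfaceMeasure Ω))
      atTop (𝓝 0)

/-- The set of all `V ∈ H²(Ω)^N` with `V|_{∂Ω} = F` and `∂_ν V|_{∂Ω} = G`. -/
def admissible {d N : ℕ} (Ω : Set (E d)) (ν : E d → E d) (F G : E d → Fin N → ℂ) :
    Set (Fin N → L2 Ω) :=
  {V | ∀ n, MemH2 Ω (V n) ∧ HasTrace Ω (V n) (fun x => F x n) ∧
    HasNormalTrace Ω ν (V n) (fun x => G x n)}

/-! ### The basis of `L²(a, b)` (indices start at `0`) -/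

/-- `φ_{n+1}(θ) = (θ - θ₀)^n exp(θ - θ₀)`, where `θ₀ = (a + b) / 2`. -/
def phi (a b : ℝ) (n : ℕ) (θ : ℝ) : ℝ := (θ - (a + b) / 2) ^ n * Real.exp (θ - (a + b) / 2)

/-- Gram-Schmidt orthogonalization of the functions `phi a b n` in `L²(a, b)`. -/
def psiOrth (a b : ℝ) (n : ℕ) : ℝ → ℝ := fun θ =>
  phi a b n θ - ∑ j : Fin n,
    ((∫ t in a..b, phi a b n t * psiOrth a b j t) / ∫ t in a..b, psiOrth a b j t ^ 2) *
      psiOrth a b j θ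
termination_by n
decreasing_by all_goals exact j.2

/-- The orthonormal basis `Ψ_{n+1}`. -/
def Psi (a b : ℝ) (n : ℕ) (θ : ℝ) : ℝ :=
  psiOrth a b n θ / Real.sqrt (∫ t in a..b, psiOrth a b n t ^ 2)

/-! ### The coefficients of the elliptic system -/

/-- The matrix `S = (s_{mn})`, `s_{mn} = ∫ Ψ_m Ψ_n'`. -/
def matS (N : ℕ) (a b : ℝ) : Matrix (Fin N) (Fin N) ℂ := fun m n =>
  ((∫ θ in a..b, Psi a b m θ * deriv (Psi a b n) θ : ℝ) : ℂ)

/-- `Δu₀ / u₀ + k² c₀`. -/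
def potential {d : ℕ} (k : ℝ) (c₀ : E d → ℝ) (u₀ : E d → ℝ → ℂ) (x : E d) (θ : ℝ) : ℂ :=
  (Δ (fun y => u₀ y θ)) x / u₀ x θ + ((k ^ 2 * c₀ x : ℝ) : ℂ)

/-- The `i`-th component of `∇u₀ / u₀`. -/
def drift {d : ℕ} (u₀ : E d → ℝ → ℂ) (i : Fin d) (x : E d) (θ : ℝ) : ℂ :=
  pd i (fun y => u₀ y θ) x / u₀ x θ

/-- The matrix `A(x) = (a_{mn}(x))`. -/
def matA {d : ℕ} (N : ℕ) (a b k : ℝ) (c₀ : E d → ℝ) (u₀ : E d → ℝ → ℂ) (x : E d) :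
    Matrix (Fin N) (Fin N) ℂ := fun m n =>
  ∫ θ in a..b, (deriv (potential k c₀ u₀ x) θ * ((Psi a b n θ : ℝ) : ℂ) +
    potential k c₀ u₀ x θ * ((deriv (Psi a b n) θ : ℝ) : ℂ)) * ((Psi a b m θ : ℝ) : ℂ)

/-- The `i`-th component of the matrix of vectors `B(x) = (b_{mn}(x))`. -/
def matB {d : ℕ} (N : ℕ) (a b : ℝ) (u₀ : E d → ℝ → ℂ) (i : Fin d) (x : E d) :
    Matrix (Fin N) (Fin N) ℂ := fun m n =>
  2 * ∫ θ in a..b, (drift u₀ i x θ * ((deriv (Psi a b n) θ : ℝ) : ℂ) +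
    deriv (drift u₀ i x) θ * ((Psi a b n θ : ℝ) : ℂ)) * ((Psi a b m θ : ℝ) : ℂ)

/-- `ΔW + S⁻¹ A W + S⁻¹ B · ∇W`, for `W ∈ H²(Ω)^N`. -/
def residual {d N : ℕ} (Ω : Set (E d)) (a b k : ℝ) (c₀ : E d → ℝ) (u₀ : E d → ℝ → ℂ)
    (W : Fin N → L2 Ω) (x : E d) : Fin N → ℂ :=
  (fun n => ∑ i, weakPartial Ω i (weakPartial Ω i (W n)) x)
  + ((matS N a b)⁻¹ * matA N a b k c₀ u₀ x).mulVec (fun n => W n x)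
  + ∑ i, ((matS N a b)⁻¹ * matB N a b u₀ i x).mulVec (fun n => weakPartial Ω i (W n) x)

/-- The quasi-reversibility functional
`J(W) = ∫_Ω |ΔW + S⁻¹ A W + S⁻¹ B · ∇W|² dx + ε ‖W‖²_{H²(Ω)^N}`. -/
def J {d N : ℕ} (Ω : Set (E d)) (a b k : ℝ) (c₀ : E d → ℝ) (u₀ : E d → ℝ → ℂ) (ε : ℝ)
    (W : Fin N → L2 Ω) : ℝ :=
  (∫ x in Ω, ∑ n, ‖residual Ω a b k c₀ u₀ W x n‖ ^ 2) + ε * normSqH2 Ω W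

/-- `W ∈ H²(Ω)^N` solves the over-determined problem `ΔW + S⁻¹ A W + S⁻¹ B · ∇W = 0` in `Ω`,
`W = F` and `∂_ν W = G` on `∂Ω`. -/
def IsSolution {d N : ℕ} (Ω : Set (E d)) (ν : E d → E d) (a b k : ℝ) (c₀ : E d → ℝ)
    (u₀ : E d → ℝ → ℂ) (F G : E d → Fin N → ℂ) (W : Fin N → L2 Ω) : Prop :=
  W ∈ admissible Ω ν F G ∧ ∀ᵐ x ∂(volume.restrict Ω), residual Ω a b k c₀ u₀ W x = 0

/-- The noisy data `(Fδ, Gδ)` of the exact data `(F, G)` have noise level `δ`: the difference is the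
boundary data of a function in `H²(Ω)^N` of norm at most `δ`. -/
def HasNoiseLevel {d N : ℕ} (Ω : Set (E d)) (ν : E d → E d) (F G Fδ Gδ : E d → Fin N → ℂ)
    (δ : ℝ) : Prop :=
  ∃ R ∈ admissible Ω ν (Fδ - F) (Gδ - G), Real.sqrt (normSqH2 Ω R) ≤ δ

end QuasiReversibility

end

noncomputable section

namespace QuasiReversibility

/-! ### Weak derivatives -/

/-! Write `L W = ΔW + S⁻¹AW + S⁻¹B·∇W` (`ellipticOp`).

Existence and uniqueness are the projection theorem. `J(W) = ‖jet W‖²`, where `jet` collects `L W`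
and `√ε` times all derivatives of `W` of order at most two in one Hilbert space. The admissible set
is convex, and its image under `jet` is closed: weak derivatives pass to `L²` limits, and traces
pass to limits in the Sobolev norms (`admissible_of_tendsto`). The minimizer corresponds to the
point of the image nearest to the origin; it is unique by the parallelogram law and the injectivity
of `jet`.

For the error estimate, let `R` be the noise function. Then `W* + R` is a competitor, so `J(Wmin) ≤
J(W* + R)`; as `L W* = 0` and `L : H² → L²` is bounded, this controls `L Wmin` when `ε ≤ 1`. The
difference `V = Wmin - (W* + R)` has zero Cauchy data, and the stability estimate `‖V‖²_{H¹} ≤ C ‖L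
V‖²_{L²}` (`exists_normSqH1_le_ellipticOp`) concludes. For `ε ≥ 1` the penalty term suffices.

Stability comes from a Carleman estimate for the Laplacian with weight `exp(l (x_k + R)²)`. The
weight is carried by a multiplication operator, which commutes with the bounded coefficients, so for
`l` large the lower order terms are absorbed. Only measurability and boundedness of `S⁻¹A` and
`S⁻¹B` are used. For real smooth functions of compact support the estimate follows by conjugating
with the square root of the weight and splitting the operator into its symmetric and antisymmetric
parts (`carleman_conjugated`).

To reach `H²` functions with zero Cauchy data, one extends by zero and mollifies: the extension has
its weak gradient and weak Laplacian in `L²` of the whole space, without boundary terms. This needs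
only an inequality in place of the divergence theorem: `|∫_Ω div X| ≤ C ‖ν·X‖` with the norm of
`L²(∂Ω)` (`enorm_integral_div_le`). Locally, `X` is a tangential field, whose divergence has
integral zero, plus a field along one coordinate axis transversal to `∂Ω`. The latter is integrated
along lines, and the result is bounded by the surface measure since coordinate projections are
Lipschitz. -/

theorem memLp_of_hasCompactSupport {d : ℕ} (Ω : Set (E d)) {φ : E d → ℝ} (hφ : Continuous φ)
    (hc : HasCompactSupport φ) : MemLp (fun x => (φ x : ℂ)) 2 (volume.restrict Ω) :=
  ((Complex.continuous_ofReal.comp hφ).memLp_of_hasCompactSupport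
    (hc.comp_left (g := fun t : ℝ => (t : ℂ)) Complex.ofReal_zero)).restrict Ω

/-- The pairing `u ↦ ∫_Ω φ u` with a square integrable real function. -/
def pairing {d : ℕ} {Ω : Set (E d)} {φ : E d → ℝ}
    (hφ : MemLp (fun x => (φ x : ℂ)) 2 (volume.restrict Ω)) : L2 Ω →L[ℂ] ℂ :=
  innerSL ℂ hφ.toLp

theorem pairing_apply {d : ℕ} {Ω : Set (E d)} {φ : E d → ℝ}
    (hφ : MemLp (fun x => (φ x : ℂ)) 2 (volume.restrict Ω)) (u : L2 Ω) :
    pairing hφ u = ∫ x in Ω, φ x • u x := by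
  rw [pairing, innerSL_apply_apply, L2.inner_def]
  refine integral_congr_ae ?_
  filter_upwards [hφ.coeFn_toLp] with x hx
  rw [hx]
  simp [mul_comm]

/-- Both sides are continuous linear functionals of the `L²` classes, so in this form stability
under linear combinations and limits is immediate. -/
theorem hasWeakPartial_iff {d : ℕ} {Ω : Set (E d)} {i : Fin d} {u v : L2 Ω} :
    HasWeakPartial Ω i u v ↔ ∀ (φ : E d → ℝ) (h1 : ContDiff ℝ ∞ φ) (h2 : HasCompactSupport φ),
      tsupport φ ⊆ Ω →
      pairing (memLp_of_hasCompactSupport Ω ((h1.continuous_fderiv (by simp)).clm_apply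
        continuous_const) (h2.fderiv_apply (𝕜 := ℝ) (e i))) u =
      - pairing (memLp_of_hasCompactSupport Ω h1.continuous h2) v := by
  simp only [pairing_apply]
  rfl

theorem HasWeakPartial.add {d : ℕ} {Ω : Set (E d)} {i : Fin d} {u v u' v' : L2 Ω}
    (h : HasWeakPartial Ω i u v) (h' : HasWeakPartial Ω i u' v') :
    HasWeakPartial Ω i (u + u') (v + v') := by
  rw [hasWeakPartial_iff] at *
  intro φ h1 h2 h3
  rw [map_add, map_add, h φ h1 h2 h3, h' φ h1 h2 h3, neg_add]

theorem HasWeakPartial.smul {d : ℕ} {Ω : Set (E d)} {i : Fin d} {u v : L2 Ω} (c : ℝ)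
    (h : HasWeakPartial Ω i u v) : HasWeakPartial Ω i (c • u) (c • v) := by
  rw [hasWeakPartial_iff] at *
  intro φ h1 h2 h3
  rw [ContinuousLinearMap.map_smul_of_tower, ContinuousLinearMap.map_smul_of_tower, h φ h1 h2 h3, smul_neg]

theorem HasWeakPartial.of_tendsto {d : ℕ} {Ω : Set (E d)} {i : Fin d} {u v : ℕ → L2 Ω}
    {u' v' : L2 Ω} (h : ∀ n, HasWeakPartial Ω i (u n) (v n)) (hu : Tendsto u atTop (𝓝 u'))
    (hv : Tendsto v atTop (𝓝 v')) : HasWeakPartial Ω i u' v' := by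
  simp only [hasWeakPartial_iff] at *
  intro φ h1 h2 h3
  refine tendsto_nhds_unique (((pairing _).continuous.tendsto _).comp hu) ?_
  refine ((((pairing (memLp_of_hasCompactSupport Ω h1.continuous h2)).continuous.tendsto _).comp
    hv).neg).congr fun n => ?_
  exact (h n φ h1 h2 h3).symm

/-- The fundamental lemma of the calculus of variations. It turns the chosen `weakPartial` into an
operation that is linear on `H¹`. -/
theorem HasWeakPartial.unique {d : ℕ} {Ω : Set (E d)} (hΩ : IsOpen Ω) {i : Fin d} {u v w : L2 Ω}
    (hv : HasWeakPartial Ω i u v) (hw : HasWeakPartial Ω i u w) : v = w := by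
  have key : ∀ᵐ x ∂(volume : Measure (E d)), x ∈ Ω → (v - w : L2 Ω) x = 0 := by
    refine hΩ.ae_eq_zero_of_integral_contDiff_smul_eq_zero ?_ ?_
    · exact locallyIntegrableOn_of_locallyIntegrable_restrict
        ((Lp.memLp (v - w)).locallyIntegrable (by norm_num))
    · intro φ h1 h2 h3
      have hs : (∫ x, φ x • (v - w : L2 Ω) x) = ∫ x in Ω, φ x • (v - w : L2 Ω) x := by
        rw [setIntegral_eq_integral_of_forall_compl_eq_zero]
        intro x hx
        rw [image_eq_zero_of_notMem_tsupport fun hx' => hx (h3 hx'), zero_smul]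
      rw [hs, ← pairing_apply (memLp_of_hasCompactSupport Ω h1.continuous h2), map_sub, sub_eq_zero]
      rw [hasWeakPartial_iff] at hv hw
      have := (hv φ h1 h2 h3).symm.trans (hw φ h1 h2 h3)
      exact neg_injective this
  rw [← sub_eq_zero]
  refine Lp.ext ?_
  have := (ae_restrict_iff' hΩ.measurableSet).2 key
  filter_upwards [this, Lp.coeFn_zero ℂ 2 (volume.restrict Ω)] with x hx h0
  rw [hx, h0, Pi.zero_apply]

theorem weakPartial_spec {d : ℕ} {Ω : Set (E d)} {u : L2 Ω} (h : MemH1 Ω u) (i : Fin d) :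
    HasWeakPartial Ω i u (weakPartial Ω i u) := by
  rw [weakPartial, dif_pos (h i)]
  exact (h i).choose_spec

theorem HasWeakPartial.weakPartial_eq {d : ℕ} {Ω : Set (E d)} (hΩ : IsOpen Ω) {i : Fin d}
    {u v : L2 Ω} (h : HasWeakPartial Ω i u v) : weakPartial Ω i u = v := by
  rw [weakPartial, dif_pos ⟨v, h⟩]
  exact (Exists.choose_spec (⟨v, h⟩ : ∃ v, HasWeakPartial Ω i u v)).unique hΩ h

section Linear

variable {d : ℕ} {Ω : Set (E d)} {u v : L2 Ω}

theorem MemH1.add (hu : MemH1 Ω u) (hv : MemH1 Ω v) : MemH1 Ω (u + v) := fun i =>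
  ⟨_, (weakPartial_spec hu i).add (weakPartial_spec hv i)⟩

theorem MemH1.smul (c : ℝ) (hu : MemH1 Ω u) : MemH1 Ω (c • u) := fun i =>
  ⟨_, (weakPartial_spec hu i).smul c⟩

theorem weakPartial_add (hΩ : IsOpen Ω) (hu : MemH1 Ω u) (hv : MemH1 Ω v) (i : Fin d) :
    weakPartial Ω i (u + v) = weakPartial Ω i u + weakPartial Ω i v :=
  ((weakPartial_spec hu i).add (weakPartial_spec hv i)).weakPartial_eq hΩ

theorem weakPartial_smul (hΩ : IsOpen Ω) (c : ℝ) (hu : MemH1 Ω u) (i : Fin d) :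
    weakPartial Ω i (c • u) = c • weakPartial Ω i u :=
  ((weakPartial_spec hu i).smul c).weakPartial_eq hΩ

theorem MemH2.add (hΩ : IsOpen Ω) (hu : MemH2 Ω u) (hv : MemH2 Ω v) : MemH2 Ω (u + v) :=
  ⟨hu.1.add hv.1, fun i => by rw [weakPartial_add hΩ hu.1 hv.1]; exact (hu.2 i).add (hv.2 i)⟩

theorem MemH2.smul (hΩ : IsOpen Ω) (c : ℝ) (hu : MemH2 Ω u) : MemH2 Ω (c • u) :=
  ⟨hu.1.smul c, fun i => by rw [weakPartial_smul hΩ c hu.1]; exact (hu.2 i).smul c⟩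

theorem weakPartial_weakPartial_add (hΩ : IsOpen Ω) (hu : MemH2 Ω u) (hv : MemH2 Ω v)
    (i j : Fin d) : weakPartial Ω j (weakPartial Ω i (u + v)) =
      weakPartial Ω j (weakPartial Ω i u) + weakPartial Ω j (weakPartial Ω i v) := by
  rw [weakPartial_add hΩ hu.1 hv.1, weakPartial_add hΩ (hu.2 i) (hv.2 i)]

theorem weakPartial_weakPartial_smul (hΩ : IsOpen Ω) (c : ℝ) (hu : MemH2 Ω u)
    (i j : Fin d) : weakPartial Ω j (weakPartial Ω i (c • u)) =
      c • weakPartial Ω j (weakPartial Ω i u) := by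
  rw [weakPartial_smul hΩ c hu.1, weakPartial_smul hΩ c (hu.2 i)]

end Linear

/-! ### Traces -/

/-- `v` approximates `u` up to `ε` in `H¹(Ω)`. -/
def ApproxH1 {d : ℕ} (Ω : Set (E d)) (v : E d → ℂ) (u : L2 Ω) (ε : ℝ≥0∞) : Prop :=
  eLpNorm (fun x => v x - u x) 2 (volume.restrict Ω) ≤ ε ∧
  ∀ i, eLpNorm (fun x => pd i v x - weakPartial Ω i u x) 2 (volume.restrict Ω) ≤ ε

/-- `v` approximates `u` up to `ε` in `H²(Ω)`. -/
def ApproxH2 {d : ℕ} (Ω : Set (E d)) (v : E d → ℂ) (u : L2 Ω) (ε : ℝ≥0∞) : Prop :=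
  ApproxH1 Ω v u ε ∧ ∀ i, ApproxH1 Ω (pd i v) (weakPartial Ω i u) ε

theorem tendstoH1_iff {d : ℕ} {Ω : Set (E d)} {v : ℕ → E d → ℂ} {u : L2 Ω} :
    TendstoH1 Ω v u ↔ ∀ ε > 0, ∀ᶠ n in atTop, ApproxH1 Ω (v n) u ε := by
  simp only [TendstoH1, ENNReal.tendsto_nhds_zero, ApproxH1, eventually_and, eventually_all]
  exact ⟨fun h ε hε => ⟨h.1 ε hε, fun i => h.2 i ε hε⟩,
    fun h => ⟨fun ε hε => (h ε hε).1, fun i ε hε => (h ε hε).2 i⟩⟩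

theorem tendstoH2_iff {d : ℕ} {Ω : Set (E d)} {v : ℕ → E d → ℂ} {u : L2 Ω} :
    TendstoH2 Ω v u ↔ ∀ ε > 0, ∀ᶠ n in atTop, ApproxH2 Ω (v n) u ε := by
  simp only [TendstoH2, tendstoH1_iff, ApproxH2, eventually_and, eventually_all]
  exact ⟨fun h ε hε => ⟨h.1 ε hε, fun i => h.2 i ε hε⟩,
    fun h => ⟨fun ε hε => (h ε hε).1, fun i ε hε => (h ε hε).2 i⟩⟩

/-- Since the conditions weaken as the tolerance grows, one object per tolerance `1/(n+1)` already
makes a convergent sequence. Sums and limits of traces can then be treated with a single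
approximant, without diagonal sequences. -/
theorem exists_seq_iff_forall_exists {α : Type*} (P : α → Prop) (Q R : α → ℝ≥0∞ → Prop)
    (hQ : ∀ a ε ε', ε ≤ ε' → Q a ε → Q a ε') (hR : ∀ a ε ε', ε ≤ ε' → R a ε → R a ε') :
    (∃ v : ℕ → α, (∀ n, P (v n)) ∧ (∀ ε > 0, ∀ᶠ n in atTop, Q (v n) ε) ∧
      (∀ ε > 0, ∀ᶠ n in atTop, R (v n) ε)) ↔ ∀ ε > 0, ∃ a, P a ∧ Q a ε ∧ R a ε := by
  constructor
  · rintro ⟨v, hP, hQ, hR⟩ ε hε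
    obtain ⟨n, h⟩ := ((hQ ε hε).and (hR ε hε)).exists
    exact ⟨v n, hP n, h⟩
  · intro h
    choose v hP h1 h2 using fun n : ℕ => h ((n : ℝ≥0∞) + 1)⁻¹ (by simp)
    have key : ∀ ε > (0 : ℝ≥0∞), ∀ᶠ n : ℕ in atTop, ((n : ℝ≥0∞) + 1)⁻¹ ≤ ε := by
      intro ε hε
      have := (tendsto_add_atTop_iff_nat 1).2 ENNReal.tendsto_inv_nat_nhds_zero
      filter_upwards [ENNReal.tendsto_nhds_zero.1 this ε hε] with n hn
      simpa using hn
    exact ⟨v, hP, fun ε hε => (key ε hε).mono fun n hn => hQ _ _ _ hn (h1 n),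
      fun ε hε => (key ε hε).mono fun n hn => hR _ _ _ hn (h2 n)⟩

theorem ApproxH1.mono {d : ℕ} {Ω : Set (E d)} {v : E d → ℂ} {u : L2 Ω} {ε ε' : ℝ≥0∞}
    (h : ApproxH1 Ω v u ε) (hε : ε ≤ ε') : ApproxH1 Ω v u ε' :=
  ⟨h.1.trans hε, fun i => (h.2 i).trans hε⟩

theorem ApproxH2.mono {d : ℕ} {Ω : Set (E d)} {v : E d → ℂ} {u : L2 Ω} {ε ε' : ℝ≥0∞}
    (h : ApproxH2 Ω v u ε) (hε : ε ≤ ε') : ApproxH2 Ω v u ε' :=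
  ⟨h.1.mono hε, fun i => (h.2 i).mono hε⟩

theorem hasTrace_iff {d : ℕ} {Ω : Set (E d)} {u : L2 Ω} {g : E d → ℂ} :
    HasTrace Ω u g ↔ MemLp g 2 (surfaceMeasure Ω) ∧ ∀ ε > 0, ∃ v : E d → ℂ, ContDiff ℝ ∞ v ∧
      ApproxH1 Ω v u ε ∧ eLpNorm (fun x => v x - g x) 2 (surfaceMeasure Ω) ≤ ε := by
  rw [HasTrace, ← exists_seq_iff_forall_exists (fun v : E d → ℂ => ContDiff ℝ ∞ v)
    (fun v ε => ApproxH1 Ω v u ε)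
    (fun v ε => eLpNorm (fun x => v x - g x) 2 (surfaceMeasure Ω) ≤ ε)
    (fun a ε ε' h1 h2 => h2.mono h1) (fun a ε ε' h1 h2 => h2.trans h1)]
  simp only [tendstoH1_iff, ENNReal.tendsto_nhds_zero]

theorem hasNormalTrace_iff {d : ℕ} {Ω : Set (E d)} {ν : E d → E d} {u : L2 Ω} {g : E d → ℂ} :
    HasNormalTrace Ω ν u g ↔ MemLp g 2 (surfaceMeasure Ω) ∧ ∀ ε > 0, ∃ v : E d → ℂ,
      ContDiff ℝ ∞ v ∧ ApproxH2 Ω v u ε ∧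
      eLpNorm (fun x => fderiv ℝ v x (ν x) - g x) 2 (surfaceMeasure Ω) ≤ ε := by
  rw [HasNormalTrace, ← exists_seq_iff_forall_exists (fun v : E d → ℂ => ContDiff ℝ ∞ v)
    (fun v ε => ApproxH2 Ω v u ε)
    (fun v ε => eLpNorm (fun x => fderiv ℝ v x (ν x) - g x) 2 (surfaceMeasure Ω) ≤ ε)
    (fun a ε ε' h1 h2 => h2.mono h1) (fun a ε ε' h1 h2 => h2.trans h1)]
  simp only [tendstoH2_iff, ENNReal.tendsto_nhds_zero]

theorem contDiff_pd {d : ℕ} {v : E d → ℂ} (hv : ContDiff ℝ ∞ v) (i : Fin d) :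
    ContDiff ℝ ∞ (pd i v) :=
  (hv.fderiv_right (m := ∞) (by simp)).clm_apply contDiff_const

theorem pd_add {d : ℕ} {v w : E d → ℂ} (hv : ContDiff ℝ ∞ v) (hw : ContDiff ℝ ∞ w) (i : Fin d) :
    pd i (v + w) = pd i v + pd i w := by
  ext x
  simp only [pd, Pi.add_apply]
  rw [fderiv_add (hv.differentiable (by simp) x) (hw.differentiable (by simp) x)]
  rfl

theorem pd_smul {d : ℕ} {v : E d → ℂ} (c : ℝ) (hv : ContDiff ℝ ∞ v) (i : Fin d) :
    pd i (c • v) = c • pd i v := by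
  ext x
  simp only [pd, Pi.smul_apply]
  rw [fderiv_const_smul (hv.differentiable (by simp) x)]
  rfl

theorem eLpNorm_add_sub_add_le {d : ℕ} {μ : Measure (E d)} {v w f g h : E d → ℂ} {ε ε' : ℝ≥0∞}
    (hv : AEStronglyMeasurable v μ) (hw : AEStronglyMeasurable w μ)
    (hf : AEStronglyMeasurable f μ) (hg : AEStronglyMeasurable g μ) (hh : h =ᵐ[μ] f + g)
    (h1 : eLpNorm (fun x => v x - f x) 2 μ ≤ ε) (h2 : eLpNorm (fun x => w x - g x) 2 μ ≤ ε') :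
    eLpNorm (fun x => (v + w) x - h x) 2 μ ≤ ε + ε' := by
  have : (fun x => (v + w) x - h x) =ᵐ[μ] (fun x => v x - f x) + fun x => w x - g x := by
    filter_upwards [hh] with x hx
    simp only [hx, Pi.add_apply]
    ring
  rw [eLpNorm_congr_ae this]
  exact (eLpNorm_add_le (hv.sub hf) (hw.sub hg) (by norm_num)).trans (add_le_add h1 h2)

theorem eLpNorm_smul_sub_le {d : ℕ} {μ : Measure (E d)} {v f h : E d → ℂ} {ε : ℝ≥0∞} (c : ℝ)
    (hh : h =ᵐ[μ] c • f) (h1 : eLpNorm (fun x => v x - f x) 2 μ ≤ ε) :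
    eLpNorm (fun x => (c • v) x - h x) 2 μ ≤ ‖c‖ₑ * ε := by
  have : (fun x => (c • v) x - h x) =ᵐ[μ] c • (fun x => v x - f x) := by
    filter_upwards [hh] with x hx
    simp only [hx, Pi.smul_apply, smul_sub]
  rw [eLpNorm_congr_ae this]
  exact (eLpNorm_const_smul_le).trans (by gcongr)

section Approx

variable {d : ℕ} {Ω : Set (E d)} {v w : E d → ℂ} {u u' : L2 Ω} {ε ε' : ℝ≥0∞}

theorem ApproxH1.add (hΩ : IsOpen Ω) (hv : ContDiff ℝ ∞ v) (hw : ContDiff ℝ ∞ w)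
    (hu : MemH1 Ω u) (hu' : MemH1 Ω u') (h : ApproxH1 Ω v u ε) (h' : ApproxH1 Ω w u' ε') :
    ApproxH1 Ω (v + w) (u + u') (ε + ε') := by
  refine ⟨eLpNorm_add_sub_add_le hv.continuous.aestronglyMeasurable
    hw.continuous.aestronglyMeasurable (Lp.aestronglyMeasurable u) (Lp.aestronglyMeasurable u')
    (Lp.coeFn_add _ _) h.1 h'.1, fun i => ?_⟩
  rw [pd_add hv hw, weakPartial_add hΩ hu hu']
  exact eLpNorm_add_sub_add_le (contDiff_pd hv i).continuous.aestronglyMeasurable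
    (contDiff_pd hw i).continuous.aestronglyMeasurable (Lp.aestronglyMeasurable _)
    (Lp.aestronglyMeasurable _) (Lp.coeFn_add _ _) (h.2 i) (h'.2 i)

theorem ApproxH2.add (hΩ : IsOpen Ω) (hv : ContDiff ℝ ∞ v) (hw : ContDiff ℝ ∞ w)
    (hu : MemH2 Ω u) (hu' : MemH2 Ω u') (h : ApproxH2 Ω v u ε) (h' : ApproxH2 Ω w u' ε') :
    ApproxH2 Ω (v + w) (u + u') (ε + ε') := by
  refine ⟨h.1.add hΩ hv hw hu.1 hu'.1 h'.1, fun i => ?_⟩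
  rw [pd_add hv hw, weakPartial_add hΩ hu.1 hu'.1]
  exact (h.2 i).add hΩ (contDiff_pd hv i) (contDiff_pd hw i) (hu.2 i) (hu'.2 i) (h'.2 i)

theorem ApproxH1.smul (hΩ : IsOpen Ω) (c : ℝ) (hv : ContDiff ℝ ∞ v) (hu : MemH1 Ω u)
    (h : ApproxH1 Ω v u ε) : ApproxH1 Ω (c • v) (c • u) (‖c‖ₑ * ε) := by
  refine ⟨eLpNorm_smul_sub_le c (Lp.coeFn_smul _ _) h.1, fun i => ?_⟩
  rw [pd_smul c hv, weakPartial_smul hΩ c hu]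
  exact eLpNorm_smul_sub_le c (Lp.coeFn_smul _ _) (h.2 i)

theorem ApproxH2.smul (hΩ : IsOpen Ω) (c : ℝ) (hv : ContDiff ℝ ∞ v) (hu : MemH2 Ω u)
    (h : ApproxH2 Ω v u ε) : ApproxH2 Ω (c • v) (c • u) (‖c‖ₑ * ε) := by
  refine ⟨h.1.smul hΩ c hv hu.1, fun i => ?_⟩
  rw [pd_smul c hv, weakPartial_smul hΩ c hu.1]
  exact (h.2 i).smul hΩ c (contDiff_pd hv i) (hu.2 i)

theorem eLpNorm_sub_le_of_norm_sub_le {f g : L2 Ω} (hv : ContDiff ℝ ∞ v)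
    (h : eLpNorm (fun x => v x - f x) 2 (volume.restrict Ω) ≤ ε) (h' : ‖f - g‖ₑ ≤ ε') :
    eLpNorm (fun x => v x - g x) 2 (volume.restrict Ω) ≤ ε + ε' := by
  have : (fun x => v x - g x) =ᵐ[volume.restrict Ω]
      (fun x => v x - f x) + (f - g : L2 Ω) := by
    filter_upwards [Lp.coeFn_sub f g] with x hx
    simp only [Pi.add_apply, hx, Pi.sub_apply]
    ring
  rw [eLpNorm_congr_ae this]
  refine (eLpNorm_add_le (hv.continuous.aestronglyMeasurable.sub (Lp.aestronglyMeasurable f))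
    (Lp.aestronglyMeasurable _) (by norm_num)).trans (add_le_add h ?_)
  rwa [Lp.enorm_def] at h'

theorem ApproxH1.of_norm_sub_le (hv : ContDiff ℝ ∞ v) (h : ApproxH1 Ω v u ε)
    (h0 : ‖u - u'‖ₑ ≤ ε') (h1 : ∀ i, ‖weakPartial Ω i u - weakPartial Ω i u'‖ₑ ≤ ε') :
    ApproxH1 Ω v u' (ε + ε') :=
  ⟨eLpNorm_sub_le_of_norm_sub_le hv h.1 h0, fun i =>
    eLpNorm_sub_le_of_norm_sub_le (contDiff_pd hv i) (h.2 i) (h1 i)⟩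

theorem ApproxH2.of_norm_sub_le (hv : ContDiff ℝ ∞ v) (h : ApproxH2 Ω v u ε)
    (h0 : ‖u - u'‖ₑ ≤ ε') (h1 : ∀ i, ‖weakPartial Ω i u - weakPartial Ω i u'‖ₑ ≤ ε')
    (h2 : ∀ i j, ‖weakPartial Ω j (weakPartial Ω i u) -
      weakPartial Ω j (weakPartial Ω i u')‖ₑ ≤ ε') :
    ApproxH2 Ω v u' (ε + ε') :=
  ⟨h.1.of_norm_sub_le hv h0 h1, fun i =>
    (h.2 i).of_norm_sub_le (contDiff_pd hv i) (h1 i) (h2 i)⟩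

end Approx

theorem exists_pos_add_le {ε : ℝ≥0∞} (hε : 0 < ε) : ∃ η > 0, η + η ≤ ε :=
  ⟨ε / 2, ENNReal.half_pos hε.ne', (ENNReal.add_halves ε).le⟩

theorem exists_pos_mul_le {ε : ℝ≥0∞} (c : ℝ) (hε : 0 < ε) : ∃ η > 0, ‖c‖ₑ * η ≤ ε := by
  obtain ⟨η, h1, h2⟩ := ENNReal.exists_pos_mul_lt (a := ‖c‖ₑ) (b := ε) (by simp) hε.ne'
  exact ⟨η, h1, by rw [mul_comm]; exact h2.le⟩

section Trace

variable {d : ℕ} {Ω : Set (E d)} {ν : E d → E d} {u u' : L2 Ω} {g g' : E d → ℂ}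

theorem HasTrace.add (hΩ : IsOpen Ω) (hu : MemH1 Ω u) (hu' : MemH1 Ω u') (h : HasTrace Ω u g)
    (h' : HasTrace Ω u' g') : HasTrace Ω (u + u') (g + g') := by
  rw [hasTrace_iff] at *
  refine ⟨h.1.add h'.1, fun ε hε => ?_⟩
  obtain ⟨η, hη, hle⟩ := exists_pos_add_le hε
  obtain ⟨v, hv, h1, h2⟩ := h.2 η hη
  obtain ⟨w, hw, h1', h2'⟩ := h'.2 η hη
  exact ⟨v + w, hv.add hw, (h1.add hΩ hv hw hu hu' h1').mono hle,
    (eLpNorm_add_sub_add_le hv.continuous.aestronglyMeasurable hw.continuous.aestronglyMeasurable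
      h.1.1 h'.1.1 .rfl h2 h2').trans hle⟩

theorem HasTrace.smul (hΩ : IsOpen Ω) (c : ℝ) (hu : MemH1 Ω u) (h : HasTrace Ω u g) :
    HasTrace Ω (c • u) (c • g) := by
  rw [hasTrace_iff] at *
  refine ⟨h.1.const_smul c, fun ε hε => ?_⟩
  obtain ⟨η, hη, hle⟩ := exists_pos_mul_le c hε
  obtain ⟨v, hv, h1, h2⟩ := h.2 η hη
  exact ⟨c • v, hv.const_smul c, (h1.smul hΩ c hv hu).mono hle,
    (eLpNorm_smul_sub_le c .rfl h2).trans hle⟩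

/-- The triangle inequality for `eLpNorm` requires measurability; this is where continuity of the
normal field enters. -/
theorem aestronglyMeasurable_normalDeriv (hν : ContinuousOn ν (frontier Ω)) {v : E d → ℂ}
    (hv : ContDiff ℝ ∞ v) :
    AEStronglyMeasurable (fun x => fderiv ℝ v x (ν x)) (surfaceMeasure Ω) :=
  ((hv.continuous_fderiv (by simp)).continuousOn.clm_apply hν).aestronglyMeasurable
    isClosed_frontier.measurableSet

theorem HasNormalTrace.add (hΩ : IsOpen Ω) (hν : ContinuousOn ν (frontier Ω)) (hu : MemH2 Ω u)
    (hu' : MemH2 Ω u') (h : HasNormalTrace Ω ν u g) (h' : HasNormalTrace Ω ν u' g') :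
    HasNormalTrace Ω ν (u + u') (g + g') := by
  rw [hasNormalTrace_iff] at *
  refine ⟨h.1.add h'.1, fun ε hε => ?_⟩
  obtain ⟨η, hη, hle⟩ := exists_pos_add_le hε
  obtain ⟨v, hv, h1, h2⟩ := h.2 η hη
  obtain ⟨w, hw, h1', h2'⟩ := h'.2 η hη
  refine ⟨v + w, hv.add hw, (h1.add hΩ hv hw hu hu' h1').mono hle, ?_⟩
  have hd : (fun x => fderiv ℝ (v + w) x (ν x)) =
      (fun x => fderiv ℝ v x (ν x)) + fun x => fderiv ℝ w x (ν x) := by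
    ext x
    rw [fderiv_add (hv.differentiable (by simp) x) (hw.differentiable (by simp) x)]
    rfl
  have := (eLpNorm_add_sub_add_le (aestronglyMeasurable_normalDeriv hν hv)
    (aestronglyMeasurable_normalDeriv hν hw) h.1.1 h'.1.1 .rfl h2 h2').trans hle
  rwa [← hd] at this

theorem HasNormalTrace.smul (hΩ : IsOpen Ω) (c : ℝ) (hu : MemH2 Ω u)
    (h : HasNormalTrace Ω ν u g) : HasNormalTrace Ω ν (c • u) (c • g) := by
  rw [hasNormalTrace_iff] at *
  refine ⟨h.1.const_smul c, fun ε hε => ?_⟩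
  obtain ⟨η, hη, hle⟩ := exists_pos_mul_le c hε
  obtain ⟨v, hv, h1, h2⟩ := h.2 η hη
  refine ⟨c • v, hv.const_smul c, (h1.smul hΩ c hv hu).mono hle, ?_⟩
  have hd : (fun x => fderiv ℝ (c • v) x (ν x)) = c • (fun x => fderiv ℝ v x (ν x)) := by
    ext x
    rw [fderiv_const_smul (hv.differentiable (by simp) x)]
    rfl
  have := (eLpNorm_smul_sub_le c .rfl h2).trans hle
  rwa [← hd] at this

/-- A smooth approximant of a nearby `w` with the same boundary data also approximates `u`; hence a
prescribed trace is a closed condition. `HasNormalTrace.of_approx` is the `H²` analogue. -/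
theorem HasTrace.of_approx (hg : MemLp g 2 (surfaceMeasure Ω))
    (h : ∀ ε > 0, ∃ w : L2 Ω, HasTrace Ω w g ∧ ‖w - u‖ₑ ≤ ε ∧
      ∀ i, ‖weakPartial Ω i w - weakPartial Ω i u‖ₑ ≤ ε) : HasTrace Ω u g := by
  rw [hasTrace_iff]
  refine ⟨hg, fun ε hε => ?_⟩
  obtain ⟨η, hη, hle⟩ := exists_pos_add_le hε
  obtain ⟨w, hw, h0, h1⟩ := h η hη
  obtain ⟨v, hv, h2, h3⟩ := (hasTrace_iff.1 hw).2 η hη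
  exact ⟨v, hv, (h2.of_norm_sub_le hv h0 h1).mono hle, h3.trans (le_self_add.trans hle)⟩

theorem HasNormalTrace.of_approx (hg : MemLp g 2 (surfaceMeasure Ω))
    (h : ∀ ε > 0, ∃ w : L2 Ω, HasNormalTrace Ω ν w g ∧ ‖w - u‖ₑ ≤ ε ∧
      (∀ i, ‖weakPartial Ω i w - weakPartial Ω i u‖ₑ ≤ ε) ∧
      ∀ i j, ‖weakPartial Ω j (weakPartial Ω i w) - weakPartial Ω j (weakPartial Ω i u)‖ₑ ≤ ε) :
    HasNormalTrace Ω ν u g := by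
  rw [hasNormalTrace_iff]
  refine ⟨hg, fun ε hε => ?_⟩
  obtain ⟨η, hη, hle⟩ := exists_pos_add_le hε
  obtain ⟨w, hw, h0, h1, h2⟩ := h η hη
  obtain ⟨v, hv, h3, h4⟩ := (hasNormalTrace_iff.1 hw).2 η hη
  exact ⟨v, hv, (h3.of_norm_sub_le hv h0 h1 h2).mono hle, h4.trans (le_self_add.trans hle)⟩

end Trace

/-! ### Linear structure and closedness of the admissible set -/

section Admissible

variable {d N : ℕ} {Ω : Set (E d)} {ν : E d → E d} {F G F' G' : E d → Fin N → ℂ}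
  {V V' : Fin N → L2 Ω}

theorem admissible_add (hΩ : IsOpen Ω) (hν : ContinuousOn ν (frontier Ω))
    (h : V ∈ admissible Ω ν F G) (h' : V' ∈ admissible Ω ν F' G') :
    V + V' ∈ admissible Ω ν (F + F') (G + G') := fun n =>
  ⟨(h n).1.add hΩ (h' n).1, (h n).2.1.add hΩ (h n).1.1 (h' n).1.1 (h' n).2.1,
    (h n).2.2.add hΩ hν (h n).1 (h' n).1 (h' n).2.2⟩

theorem admissible_smul (hΩ : IsOpen Ω) (c : ℝ) (h : V ∈ admissible Ω ν F G) :
    c • V ∈ admissible Ω ν (c • F) (c • G) := fun n =>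
  ⟨(h n).1.smul hΩ c, (h n).2.1.smul hΩ c (h n).1.1, (h n).2.2.smul hΩ c (h n).1⟩

theorem admissible_sub (hΩ : IsOpen Ω) (hν : ContinuousOn ν (frontier Ω))
    (h : V ∈ admissible Ω ν F G) (h' : V' ∈ admissible Ω ν F' G') :
    V - V' ∈ admissible Ω ν (F - F') (G - G') := by
  have := admissible_add hΩ hν h (admissible_smul hΩ (-1) h')
  simpa only [neg_one_smul, ← sub_eq_add_neg] using this

theorem convex_admissible (hΩ : IsOpen Ω) (hν : ContinuousOn ν (frontier Ω)) :
    Convex ℝ (admissible Ω ν F G) := by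
  intro V hV V' hV' s t _ _ hst
  have := admissible_add hΩ hν (admissible_smul hΩ s hV) (admissible_smul hΩ t hV')
  rwa [← add_smul, ← add_smul, hst, one_smul, one_smul] at this

/-- The graphs of the weak derivatives are closed, which identifies the limits `w1`, `w2` as
derivatives of `V`; the convergence is then Sobolev convergence and preserves the traces. This is
what makes the image of the admissible set under `jet` closed. -/
theorem admissible_of_tendsto (hΩ : IsOpen Ω) {W : ℕ → Fin N → L2 Ω}
    {w1 : Fin d → Fin N → L2 Ω} {w2 : Fin d → Fin d → Fin N → L2 Ω}
    (hW : ∀ m, W m ∈ admissible Ω ν F G)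
    (h0 : ∀ n, Tendsto (fun m => W m n) atTop (𝓝 (V n)))
    (h1 : ∀ n i, Tendsto (fun m => weakPartial Ω i (W m n)) atTop (𝓝 (w1 i n)))
    (h2 : ∀ n i j, Tendsto (fun m => weakPartial Ω j (weakPartial Ω i (W m n))) atTop
      (𝓝 (w2 i j n))) :
    V ∈ admissible Ω ν F G ∧ (∀ n i, weakPartial Ω i (V n) = w1 i n) ∧
      ∀ n i j, weakPartial Ω j (weakPartial Ω i (V n)) = w2 i j n := by
  have a1 : ∀ n i, HasWeakPartial Ω i (V n) (w1 i n) := fun n i =>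
    .of_tendsto (fun m => weakPartial_spec (hW m n).1.1 i) (h0 n) (h1 n i)
  have e1 : ∀ n i, weakPartial Ω i (V n) = w1 i n := fun n i => (a1 n i).weakPartial_eq hΩ
  have a2 : ∀ n i j, HasWeakPartial Ω j (weakPartial Ω i (V n)) (w2 i j n) := fun n i j => by
    rw [e1]
    exact .of_tendsto (fun m => weakPartial_spec ((hW m n).1.2 i) j) (h1 n i) (h2 n i j)
  have e2 : ∀ n i j, weakPartial Ω j (weakPartial Ω i (V n)) = w2 i j n := fun n i j =>
    (a2 n i j).weakPartial_eq hΩ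
  refine ⟨fun n => ⟨⟨fun i => ⟨_, a1 n i⟩, fun i j => ⟨_, a2 n i j⟩⟩, ?_, ?_⟩, e1, e2⟩
  · refine .of_approx (hW 0 n).2.1.1 fun ε hε => ?_
    have b0 := (h0 n).eventually (Metric.closedEBall_mem_nhds _ hε)
    have b1 := eventually_all.2 fun i => (h1 n i).eventually (Metric.closedEBall_mem_nhds _ hε)
    obtain ⟨m, c0, c1⟩ := (b0.and b1).exists
    refine ⟨W m n, (hW m n).2.1, ?_, fun i => ?_⟩
    · rw [← edist_eq_enorm_sub]; exact c0
    · rw [← edist_eq_enorm_sub, e1]; exact c1 i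
  · refine .of_approx (hW 0 n).2.2.1 fun ε hε => ?_
    have b0 := (h0 n).eventually (Metric.closedEBall_mem_nhds _ hε)
    have b1 := eventually_all.2 fun i => (h1 n i).eventually (Metric.closedEBall_mem_nhds _ hε)
    have b2 := eventually_all.2 fun i => eventually_all.2 fun j =>
      (h2 n i j).eventually (Metric.closedEBall_mem_nhds _ hε)
    obtain ⟨m, c0, c1, c2⟩ := (b0.and (b1.and b2)).exists
    refine ⟨W m n, (hW m n).2.2, ?_, fun i => ?_, fun i j => ?_⟩
    · rw [← edist_eq_enorm_sub]; exact c0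
    · rw [← edist_eq_enorm_sub, e1]; exact c1 i
    · rw [← edist_eq_enorm_sub, e2]; exact c2 i j

end Admissible

/-! ### Defining functions and normals -/

section Normal

variable {d : ℕ} {Ω U : Set (E d)} {ρ : E d → ℝ}

theorem inner_gradient {ρ : E d → ℝ} {x : E d} (hρ : DifferentiableAt ℝ ρ x) (v : E d) :
    inner ℝ (gradient ρ x) v = fderiv ℝ ρ x v := by
  rw [hρ.hasGradientAt.hasFDerivAt.fderiv]
  simp

theorem gradient_apply {ρ : E d → ℝ} {x : E d} (hρ : DifferentiableAt ℝ ρ x) (i : Fin d) :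
    gradient ρ x i = fderiv ℝ ρ x (e i) := by
  rw [← inner_gradient hρ, e, EuclideanSpace.inner_single_right]
  simp

/-- A negative value would put `p` in the open set `Ω`, a positive one would keep a neighbourhood of
`p` away from `Ω`. -/
theorem IsDefiningFunctionOn.eq_zero_of_mem_frontier (hΩ : IsOpen Ω)
    (h : IsDefiningFunctionOn Ω U ρ) {p : E d} (hp : p ∈ U) (hpf : p ∈ frontier Ω) : ρ p = 0 := by
  have h1 : p ∉ Ω := by
    rw [hΩ.frontier_eq] at hpf
    exact hpf.2
  refine le_antisymm ?_ (not_lt.1 fun hlt => h1 ((h.mem_iff p hp).2 hlt))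
  by_contra! hlt
  have hopen : {x | 0 < ρ x} ∈ 𝓝 p :=
    (isOpen_lt continuous_const h.smooth.continuous).mem_nhds hlt
  obtain ⟨y, ⟨hy1, hy2⟩, hy3⟩ := mem_closure_iff_nhds.1 (frontier_subset_closure hpf) _
    (inter_mem hopen (h.isOpen.mem_nhds hp))
  exact absurd ((h.mem_iff y hy2).1 hy3) (not_lt.2 (le_of_lt hy1))

theorem eventually_lt_of_fderiv_neg {ρ : E d → ℝ} {p v : E d} (hρ : DifferentiableAt ℝ ρ p)
    (h : fderiv ℝ ρ p v < 0) : ∀ᶠ t in 𝓝[>] (0 : ℝ), ρ (p + t • v) < ρ p := by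
  have hd : HasDerivAt (fun t : ℝ => ρ (p + t • v)) (fderiv ℝ ρ p v) 0 := by
    have h1 : HasDerivAt (fun t : ℝ => p + t • v) v 0 := by
      simpa using ((hasDerivAt_id (0 : ℝ)).smul_const v).const_add p
    have h2 : HasFDerivAt ρ (fderiv ℝ ρ p) (p + (0 : ℝ) • v) := by simpa using hρ.hasFDerivAt
    exact h2.comp_hasDerivAt 0 h1
  have hs := hd.tendsto_slope_zero_right
  filter_upwards [hs.eventually (gt_mem_nhds h), self_mem_nhdsWithin] with t ht ht0
  simp only [zero_add, zero_smul, add_zero, smul_eq_mul] at ht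
  by_contra! hle
  have := mul_nonneg (inv_pos.2 (mem_Ioi.1 ht0)).le (sub_nonneg.2 hle)
  linarith

/-- If the unit vectors `n` and `n'` differ, then `⟨n, n'⟩ < 1`, so along `n' - n` the function `ρ`
decreases and `ρ'` increases from their common value `0`. A short step in that direction would land
both inside and outside `Ω`. -/
theorem IsDefiningFunctionOn.normal_unique (hΩ : IsOpen Ω) {U' : Set (E d)} {ρ' : E d → ℝ}
    (h : IsDefiningFunctionOn Ω U ρ) (h' : IsDefiningFunctionOn Ω U' ρ') {p : E d} (hp : p ∈ U)
    (hp' : p ∈ U') (hpf : p ∈ frontier Ω) :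
    ‖gradient ρ p‖⁻¹ • gradient ρ p = ‖gradient ρ' p‖⁻¹ • gradient ρ' p := by
  by_contra hne
  set n := ‖gradient ρ p‖⁻¹ • gradient ρ p with hn
  set n' := ‖gradient ρ' p‖⁻¹ • gradient ρ' p with hn'
  have g0 := norm_pos_iff.2 (h.gradient_ne_zero p hp)
  have g0' := norm_pos_iff.2 (h'.gradient_ne_zero p hp')
  have hn1 : ‖n‖ = 1 := by rw [hn, norm_smul, norm_inv, norm_norm, inv_mul_cancel₀ g0.ne']
  have hn1' : ‖n'‖ = 1 := by rw [hn', norm_smul, norm_inv, norm_norm, inv_mul_cancel₀ g0'.ne']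
  have hlt : inner ℝ n n' < 1 := inner_lt_one_iff_real_of_norm_eq_one hn1 hn1' |>.2 hne
  have hd := h.smooth.differentiable (by simp) p
  have hd' := h'.smooth.differentiable (by simp) p
  have e1 : gradient ρ p = ‖gradient ρ p‖ • n := by
    rw [hn, smul_smul, mul_inv_cancel₀ g0.ne', one_smul]
  have e2 : gradient ρ' p = ‖gradient ρ' p‖ • n' := by
    rw [hn', smul_smul, mul_inv_cancel₀ g0'.ne', one_smul]
  have a1 : fderiv ℝ ρ p (n' - n) < 0 := by
    rw [← inner_gradient hd, e1, real_inner_smul_left, inner_sub_right,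
      real_inner_self_eq_norm_sq, hn1]
    exact mul_neg_of_pos_of_neg g0 (by linarith)
  have a2 : fderiv ℝ ρ' p (-(n' - n)) < 0 := by
    rw [← inner_gradient hd', e2, real_inner_smul_left, inner_neg_right, inner_sub_right,
      real_inner_self_eq_norm_sq, hn1', real_inner_comm]
    exact mul_neg_of_pos_of_neg g0' (by linarith)
  have hz := h.eq_zero_of_mem_frontier hΩ hp hpf
  have hz' := h'.eq_zero_of_mem_frontier hΩ hp' hpf
  have b1 := eventually_lt_of_fderiv_neg hd a1
  have hd2 : fderiv ℝ (fun x => -ρ' x) p (n' - n) < 0 := by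
    rw [fderiv_fun_neg]
    simpa using a2
  have b2 := eventually_lt_of_fderiv_neg hd'.neg hd2
  have hc : Tendsto (fun t : ℝ => p + t • (n' - n)) (𝓝[>] 0) (𝓝 p) := by
    have : Continuous fun t : ℝ => p + t • (n' - n) := by fun_prop
    simpa using (this.tendsto 0).mono_left nhdsWithin_le_nhds
  obtain ⟨t, c1, c2, c3, c4⟩ := (b1.and (b2.and ((hc.eventually (h.isOpen.mem_nhds hp)).and
    (hc.eventually (h'.isOpen.mem_nhds hp'))))).exists
  rw [hz] at c1
  have c2' : -ρ' (p + t • (n' - n)) < -ρ' p := c2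
  rw [hz'] at c2'
  have := (h'.mem_iff _ c4).1 ((h.mem_iff _ c3).2 c1)
  linarith

theorem normal_eq (hΩ : IsOpen Ω) {ν : E d → E d}
    (hν : ∀ p ∈ frontier Ω, IsOuterUnitNormal Ω p (ν p)) (h : IsDefiningFunctionOn Ω U ρ)
    {p : E d} (hp : p ∈ U) (hpf : p ∈ frontier Ω) : ν p = ‖gradient ρ p‖⁻¹ • gradient ρ p := by
  obtain ⟨U', ρ', hp', h', e'⟩ := hν p hpf
  rw [e']
  exact h'.normal_unique hΩ h hp' hp hpf

theorem continuous_gradient {ρ : E d → ℝ} (hρ : ContDiff ℝ ∞ ρ) : Continuous (gradient ρ) := by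
  unfold gradient
  exact (InnerProductSpace.toDual ℝ (E d)).symm.continuous.comp (hρ.continuous_fderiv (by simp))

/-- By uniqueness, `ν` agrees near each boundary point with the normalized gradient of one fixed
defining function. -/
theorem continuousOn_normal (hΩ : IsOpen Ω) (hΩs : HasSmoothBoundary Ω) {ν : E d → E d}
    (hν : ∀ p ∈ frontier Ω, IsOuterUnitNormal Ω p (ν p)) : ContinuousOn ν (frontier Ω) := by
  intro p hp
  obtain ⟨U, ρ, hpU, h⟩ := hΩs p hp
  have hg := continuous_gradient h.smooth
  have hc : ContinuousAt (fun q => ‖gradient ρ q‖⁻¹ • gradient ρ q) p :=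
    (hg.norm.continuousAt.inv₀ (norm_ne_zero_iff.2 (h.gradient_ne_zero p hpU))).smul
      hg.continuousAt
  refine hc.continuousWithinAt.congr_of_eventuallyEq ?_ (normal_eq hΩ hν h hpU hp)
  filter_upwards [self_mem_nhdsWithin, mem_nhdsWithin_of_mem_nhds (h.isOpen.mem_nhds hpU)] with q
    h1 h2
  exact normal_eq hΩ hν h h2 h1

end Normal

/-! ### Integration along lines -/

/-- Strict monotonicity of `g` makes `O ∩ I` one side of `t₀` within `I`, so `O` may be replaced by
a half-line and the fundamental theorem of calculus leaves only the value at `t₀`. -/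
theorem integral_indicator_deriv_of_eq_zero {I O : Set ℝ} {g : ℝ → ℝ} {h : ℝ → ℂ}
    (hI : Convex ℝ I) (hg : ContinuousOn g I)
    (hg' : (∀ t ∈ interior I, 0 < deriv g t) ∨ ∀ t ∈ interior I, deriv g t < 0)
    (hO : ∀ t ∈ I, t ∈ O ↔ g t < 0) (hh : ContDiff ℝ 1 h) (hc : HasCompactSupport h)
    (hs : tsupport h ⊆ I) {t₀ : ℝ} (ht₀ : t₀ ∈ I) (h0 : g t₀ = 0) :
    ‖∫ t, O.indicator (deriv h) t‖ = ‖h t₀‖ := by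
  have hz : ∀ t ∉ I, deriv h t = 0 := fun t ht =>
    image_eq_zero_of_notMem_tsupport fun h' => ht (hs (tsupport_deriv_subset h'))
  rcases hg' with hg' | hg'
  · have hm := strictMonoOn_of_deriv_pos hI hg hg'
    have : O.indicator (deriv h) = (Iio t₀).indicator (deriv h) := by
      ext t
      by_cases ht : t ∈ I
      · have : t ∈ O ↔ t ∈ Iio t₀ := by rw [hO t ht, ← h0, hm.lt_iff_lt ht ht₀, mem_Iio]
        by_cases h' : t ∈ O
        · rw [indicator_of_mem h', indicator_of_mem (this.1 h')]
        · rw [indicator_of_notMem h', indicator_of_notMem (this.not.1 h')]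
      · simp [indicator, hz t ht]
    rw [this, integral_indicator measurableSet_Iio, ← integral_Iic_eq_integral_Iio,
      hc.integral_Iic_deriv_eq hh]
  · have hm := strictAntiOn_of_deriv_neg hI hg hg'
    have : O.indicator (deriv h) = (Ioi t₀).indicator (deriv h) := by
      ext t
      by_cases ht : t ∈ I
      · have : t ∈ O ↔ t ∈ Ioi t₀ := by rw [hO t ht, ← h0, hm.lt_iff_gt ht ht₀, mem_Ioi]
        by_cases h' : t ∈ O
        · rw [indicator_of_mem h', indicator_of_mem (this.1 h')]
        · rw [indicator_of_notMem h', indicator_of_notMem (this.not.1 h')]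
      · simp [indicator, hz t ht]
    rw [this, integral_indicator measurableSet_Ioi, hc.integral_Ioi_deriv_eq hh, norm_neg]

theorem integral_deriv_eq_zero {h : ℝ → ℂ} (hh : ContDiff ℝ 1 h) (hc : HasCompactSupport h) :
    ∫ t, deriv h t = 0 :=
  integral_eq_zero_of_hasDerivAt_of_integrable
    (fun t => (hh.differentiable (by simp) t).hasDerivAt)
    ((hh.continuous_deriv (by simp)).integrable_of_hasCompactSupport hc.deriv)
    (hh.continuous.integrable_of_hasCompactSupport hc)

theorem integral_indicator_deriv_eq_zero {I O : Set ℝ} {h : ℝ → ℂ}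
    (hO : I ⊆ O ∨ ∀ t ∈ I, t ∉ O) (hh : ContDiff ℝ 1 h) (hc : HasCompactSupport h)
    (hs : tsupport h ⊆ I) : ∫ t, O.indicator (deriv h) t = 0 := by
  have hz : ∀ t ∉ I, deriv h t = 0 := fun t ht =>
    image_eq_zero_of_notMem_tsupport fun h' => ht (hs (tsupport_deriv_subset h'))
  rcases hO with hO | hO
  · have : O.indicator (deriv h) = deriv h := by
      ext t
      by_cases ht : t ∈ I
      · rw [indicator_of_mem (hO ht)]
      · simp [indicator, hz t ht]
    rw [this, integral_deriv_eq_zero hh hc]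
  · have : O.indicator (deriv h) = 0 := by
      ext t
      by_cases ht : t ∈ I
      · rw [indicator_of_notMem (hO t ht), Pi.zero_apply]
      · simp [indicator, hz t ht]
    simp [this]

/-! ### Slicing along a coordinate direction -/

section Slices

variable {n : ℕ} (j : Fin (n + 1))

/-- The point with `j`-th coordinate `t` and remaining coordinates `y`. -/
def slicePoint (t : ℝ) (y : Fin n → ℝ) : E (n + 1) := WithLp.toLp 2 (j.insertNth t y)

/-- The coordinates other than the `j`-th. -/
def dropCoord (x : E (n + 1)) : Fin n → ℝ := fun k => x (j.succAbove k)

theorem slicePoint_eq_add (t : ℝ) (y : Fin n → ℝ) :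
    slicePoint j t y = slicePoint j 0 y + t • e j := by
  ext k
  refine Fin.succAboveCases j ?_ (fun l => ?_) k
  · simp [slicePoint, e]
  · simp [slicePoint, e, Fin.succAbove_ne]

theorem slicePoint_dropCoord (x : E (n + 1)) : slicePoint j (x j) (dropCoord j x) = x := by
  ext k
  refine Fin.succAboveCases j ?_ (fun l => ?_) k
  · simp [slicePoint]
  · simp [slicePoint, dropCoord]

theorem dropCoord_slicePoint (t : ℝ) (y : Fin n → ℝ) : dropCoord j (slicePoint j t y) = y := by
  ext k
  simp [slicePoint, dropCoord]

theorem lipschitzWith_dropCoord : LipschitzWith 1 (dropCoord j) := by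
  refine LipschitzWith.of_dist_le_mul fun x y => ?_
  rw [NNReal.coe_one, one_mul, dist_pi_le_iff dist_nonneg]
  intro k
  rw [dropCoord, dropCoord, dist_eq_norm, dist_eq_norm, ← PiLp.sub_apply]
  exact PiLp.norm_apply_le _ _

theorem measurePreserving_slicePoint :
    MeasurePreserving (fun z : ℝ × (Fin n → ℝ) => slicePoint j z.1 z.2)
      ((volume : Measure ℝ).prod volume) volume := by
  have h1 := (volume_preserving_piFinSuccAbove (fun _ : Fin (n + 1) => ℝ) j).symm
  have h2 := (EuclideanSpace.volume_preserving_symm_measurableEquiv_toLp (Fin (n + 1))).symm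
  exact h2.comp h1

theorem measurableEmbedding_slicePoint :
    MeasurableEmbedding (fun z : ℝ × (Fin n → ℝ) => slicePoint j z.1 z.2) :=
  (MeasurableEquiv.toLp 2 (Fin (n + 1) → ℝ)).measurableEmbedding.comp
    (MeasurableEquiv.piFinSuccAbove (fun _ : Fin (n + 1) => ℝ) j).symm.measurableEmbedding

theorem integral_eq_integral_slicePoint {f : E (n + 1) → ℂ} (hf : Integrable f) :
    ∫ x, f x = ∫ y, ∫ t, f (slicePoint j t y) := by
  rw [← (measurePreserving_slicePoint j).integral_comp (measurableEmbedding_slicePoint j)]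
  refine integral_prod_symm _ ?_
  exact ((measurePreserving_slicePoint j).integrable_comp_emb
    (measurableEmbedding_slicePoint j)).2 hf

/-- Dropping a coordinate is 1-Lipschitz, hence does not increase Hausdorff measure. This inequality
replaces the area formula for a graph. -/
theorem volume_restrict_image_dropCoord_le {K : Set (E (n + 1))} :
    (volume : Measure (Fin n → ℝ)).restrict (dropCoord j '' K) ≤
      (((Measure.hausdorffMeasure (n : ℝ)) : Measure (E (n + 1))).restrict K).map
        (dropCoord j) := by
  have hm : Measurable (dropCoord j) := (lipschitzWith_dropCoord j).continuous.measurable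
  refine Measure.le_iff.2 fun s hs => ?_
  rw [Measure.map_apply hm hs, Measure.restrict_apply hs, Measure.restrict_apply (hm hs)]
  have hsub : s ∩ dropCoord j '' K ⊆ dropCoord j '' (dropCoord j ⁻¹' s ∩ K) := by
    rintro _ ⟨h1, x, hx, rfl⟩
    exact ⟨x, ⟨h1, hx⟩, rfl⟩
  refine (measure_mono hsub).trans ?_
  have := (lipschitzWith_dropCoord j).hausdorffMeasure_image_le (d := (n : ℝ))
    (Nat.cast_nonneg n) (dropCoord j ⁻¹' s ∩ K)
  -- For the sup metric of `Fin n → ℝ` the Hausdorff measure is Lebesgue measure, with constant one.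
  have hv : (Measure.hausdorffMeasure (n : ℝ) : Measure (Fin n → ℝ)) = volume := by
    have := hausdorffMeasure_pi_real (ι := Fin n)
    rwa [Fintype.card_fin] at this
  rw [hv] at this
  simpa using this

end Slices

/-! ### Boundary estimates for integrals of derivatives -/

theorem surfaceMeasure_succ {n : ℕ} (Ω : Set (E (n + 1))) : surfaceMeasure Ω =
    (Measure.hausdorffMeasure (n : ℝ) : Measure (E (n + 1))).restrict (frontier Ω) := by
  rw [surfaceMeasure]
  congr 2
  push_cast
  ring

section Line

variable {n : ℕ} (j : Fin (n + 1)) {Ω : Set (E (n + 1))} {h : E (n + 1) → ℂ} {ρ : E (n + 1) → ℝ}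

theorem hasDerivAt_slicePoint (y : Fin n → ℝ) (t : ℝ) :
    HasDerivAt (fun t => slicePoint j t y) (e j) t := by
  have : (fun t => slicePoint j t y) = fun t => slicePoint j 0 y + t • e j :=
    funext fun t => slicePoint_eq_add j t y
  rw [this]
  simpa using ((hasDerivAt_id t).smul_const (e j : E (n + 1))).const_add (slicePoint j 0 y)

theorem continuous_slicePoint (y : Fin n → ℝ) : Continuous fun t => slicePoint j t y :=
  continuous_iff_continuousAt.2 fun t => (hasDerivAt_slicePoint j y t).continuousAt

theorem contDiff_slicePoint (y : Fin n → ℝ) : ContDiff ℝ 1 fun t => slicePoint j t y := by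
  have : (fun t => slicePoint j t y) = fun t => slicePoint j 0 y + t • e j :=
    funext fun t => slicePoint_eq_add j t y
  rw [this]
  fun_prop

theorem isClosedEmbedding_slicePoint (y : Fin n → ℝ) :
    IsClosedEmbedding fun t => slicePoint j t y := by
  refine (Isometry.of_dist_eq fun s t => ?_).isClosedEmbedding
  rw [slicePoint_eq_add j s, slicePoint_eq_add j t, dist_add_left, dist_eq_norm, ← sub_smul,
    norm_smul, e, PiLp.norm_single, norm_one, mul_one, dist_eq_norm]

theorem deriv_comp_slicePoint (hh : ContDiff ℝ 1 h) (y : Fin n → ℝ) (t : ℝ) :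
    deriv (fun t => h (slicePoint j t y)) t = pd j h (slicePoint j t y) :=
  ((hh.differentiable (by simp) _).hasFDerivAt.comp_hasDerivAt t
    (hasDerivAt_slicePoint j y t)).deriv

/-- Since `∂_j ρ` has a constant sign on the ball, each line in direction `e j` crosses the boundary
there at most once. The integral over the part in `Ω` is, up to sign, the value of `h` at the
crossing, and zero if there is none. -/
theorem integral_slice {p : E (n + 1)} {r : ℝ} (hΩ : IsOpen Ω) (hρ : ContDiff ℝ 1 ρ)
    (hmem : ∀ x ∈ Metric.ball p r, (x ∈ Ω ↔ ρ x < 0))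
    (hpos : (∀ x ∈ Metric.ball p r, 0 < fderiv ℝ ρ x (e j)) ∨
      ∀ x ∈ Metric.ball p r, fderiv ℝ ρ x (e j) < 0)
    (hzero : ∀ x ∈ Metric.ball p r, x ∈ frontier Ω → ρ x = 0)
    (hh : ContDiff ℝ 1 h) (hs : tsupport h ⊆ Metric.ball p r) :
    (∀ x ∈ tsupport h ∩ frontier Ω,
      ‖∫ t, Ω.indicator (pd j h) (slicePoint j t (dropCoord j x))‖ = ‖h x‖) ∧
    ∀ y ∉ dropCoord j '' (tsupport h ∩ frontier Ω),
      ∫ t, Ω.indicator (pd j h) (slicePoint j t y) = 0 := by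
  have hc : HasCompactSupport h := HasCompactSupport.of_support_subset_isCompact
    (isCompact_closedBall p r) ((subset_tsupport h).trans
      (hs.trans Metric.ball_subset_closedBall))
  set L : (Fin n → ℝ) → ℝ → E (n + 1) := fun y t => slicePoint j t y with hL
  have hL1 : ∀ y, ContDiff ℝ 1 (h ∘ L y) := fun y => hh.comp (contDiff_slicePoint j y)
  have hL2 : ∀ y, HasCompactSupport (h ∘ L y) := fun y =>
    hc.comp_isClosedEmbedding (isClosedEmbedding_slicePoint j y)
  have hL3 : ∀ y, tsupport (h ∘ L y) ⊆ L y ⁻¹' tsupport h := fun y =>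
    tsupport_comp_subset_preimage h (continuous_slicePoint j y)
  have hind : ∀ y, (fun t => Ω.indicator (pd j h) (slicePoint j t y)) =
      (L y ⁻¹' Ω).indicator (deriv (h ∘ L y)) := by
    intro y
    ext t
    by_cases ht : slicePoint j t y ∈ Ω
    · rw [indicator_of_mem ht, indicator_of_mem (show t ∈ L y ⁻¹' Ω from ht),
        ← deriv_comp_slicePoint j hh]
      rfl
    · rw [indicator_of_notMem ht, indicator_of_notMem (show t ∉ L y ⁻¹' Ω from ht)]
  have hconv : ∀ y, Convex ℝ (L y ⁻¹' Metric.ball p r) := by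
    intro y s hs t ht a b ha hb hab
    have : L y (a • s + b • t) = a • L y s + b • L y t := by
      simp only [hL]
      rw [slicePoint_eq_add j s, slicePoint_eq_add j t, slicePoint_eq_add j (a • s + b • t),
        smul_add, smul_add, add_add_add_comm, ← add_smul, hab, one_smul, smul_smul, smul_smul,
        ← add_smul, smul_eq_mul, smul_eq_mul]
    rw [mem_preimage, this]
    exact convex_ball p r hs ht ha hb hab
  refine ⟨fun x hx => ?_, fun y hy => ?_⟩
  · set y := dropCoord j x with hy
    have hx' : L y (x j) = x := slicePoint_dropCoord j x
    rw [hind y, integral_indicator_deriv_of_eq_zero (O := L y ⁻¹' Ω) (g := ρ ∘ L y) (t₀ := x j) (hconv y)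
      (hρ.continuous.comp (continuous_slicePoint j y)).continuousOn ?_
      (fun t ht => hmem _ ht) (hL1 y) (hL2 y) ((hL3 y).trans (preimage_mono hs))
      (by rw [mem_preimage, hx']; exact hs hx.1)
      (by rw [Function.comp_apply, hx']; exact hzero x (hs hx.1) hx.2), Function.comp_apply, hx']
    have hd : ∀ t, deriv (ρ ∘ L y) t = fderiv ℝ ρ (L y t) (e j) := fun t =>
      ((hρ.differentiable (by simp) _).hasFDerivAt.comp_hasDerivAt t
        (hasDerivAt_slicePoint j y t)).deriv
    simp only [hd]
    exact hpos.imp (fun h' t ht => h' _ (interior_subset ht : t ∈ L y ⁻¹' Metric.ball p r))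
      (fun h' t ht => h' _ (interior_subset ht : t ∈ L y ⁻¹' Metric.ball p r))
  · rw [hind y]
    -- A crossing may exist even though `y` is outside the projected set, but then it lies off the
    -- support of `h` and its contribution vanishes.
    by_cases hfr : ∃ t ∈ L y ⁻¹' Metric.ball p r, L y t ∈ frontier Ω
    · obtain ⟨t₀, ht₀, hf₀⟩ := hfr
      have hz : h (L y t₀) = 0 := by
        by_contra hne
        exact hy ⟨L y t₀, ⟨subset_tsupport h hne, hf₀⟩, dropCoord_slicePoint j t₀ y⟩
      have hd : ∀ t, deriv (ρ ∘ L y) t = fderiv ℝ ρ (L y t) (e j) := fun t =>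
        ((hρ.differentiable (by simp) _).hasFDerivAt.comp_hasDerivAt t
          (hasDerivAt_slicePoint j y t)).deriv
      rw [← norm_eq_zero, integral_indicator_deriv_of_eq_zero (O := L y ⁻¹' Ω) (g := ρ ∘ L y) (t₀ := t₀) (hconv y)
        (hρ.continuous.comp (continuous_slicePoint j y)).continuousOn ?_
        (fun t ht => hmem _ ht) (hL1 y) (hL2 y) ((hL3 y).trans (preimage_mono hs)) ht₀
        (hzero _ ht₀ hf₀), Function.comp_apply, hz, norm_zero]
      simp only [hd]
      exact hpos.imp (fun h' t ht => h' _ (interior_subset ht : t ∈ L y ⁻¹' Metric.ball p r))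
        (fun h' t ht => h' _ (interior_subset ht : t ∈ L y ⁻¹' Metric.ball p r))
    -- Without a crossing, the connected part of the line in the ball lies entirely in `Ω` or
    -- entirely outside.
    · push Not at hfr
      refine integral_indicator_deriv_eq_zero (I := L y ⁻¹' Metric.ball p r) ?_ (hL1 y) (hL2 y)
        ((hL3 y).trans (preimage_mono hs))
      by_contra! hcon
      obtain ⟨hc1, t, ht, htO⟩ := hcon
      obtain ⟨s, hs, hsO⟩ := not_subset.1 hc1
      have hpre : IsPreconnected (L y '' (L y ⁻¹' Metric.ball p r)) :=
        (hconv y).isPreconnected.image _ (continuous_slicePoint j y).continuousOn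
      have hcl : ∀ t' ∈ L y ⁻¹' Metric.ball p r, L y t' ∉ Ω → L y t' ∈ (closure Ω)ᶜ :=
        fun t' ht' h' hcl => hfr t' ht' (by rw [hΩ.frontier_eq]; exact ⟨hcl, h'⟩)
      obtain ⟨z, _, hz1, hz2⟩ := hpre Ω (closure Ω)ᶜ hΩ isClosed_closure.isOpen_compl (by
          rintro _ ⟨t', ht', rfl⟩
          by_cases h' : L y t' ∈ Ω
          · exact Or.inl h'
          · exact Or.inr (hcl t' ht' h'))
        ⟨L y t, ⟨t, ht, rfl⟩, htO⟩ ⟨L y s, ⟨s, hs, rfl⟩, hcl s hs hsO⟩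
      exact hz2 (subset_closure hz1)

/-- Fubini reduces the left side to an integral over the projection of the boundary part of the
support, where the line integrals have the modulus of `h`. Cauchy–Schwarz on this bounded set gives
the factor `volume ^ (1/2)`, and the Lipschitz bound for the projection brings in the surface
measure. -/
theorem enorm_integral_pd_le {p : E (n + 1)} {r : ℝ} (hΩ : IsOpen Ω) (hρ : ContDiff ℝ 1 ρ)
    (hmem : ∀ x ∈ Metric.ball p r, (x ∈ Ω ↔ ρ x < 0))
    (hpos : (∀ x ∈ Metric.ball p r, 0 < fderiv ℝ ρ x (e j)) ∨
      ∀ x ∈ Metric.ball p r, fderiv ℝ ρ x (e j) < 0)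
    (hzero : ∀ x ∈ Metric.ball p r, x ∈ frontier Ω → ρ x = 0)
    (hh : ContDiff ℝ 1 h) (hs : tsupport h ⊆ Metric.ball p r) :
    ‖∫ x in Ω, pd j h x‖ₑ ≤ volume (dropCoord j '' Metric.closedBall p r) ^ (1 / 2 : ℝ) *
      eLpNorm h 2 (surfaceMeasure Ω) := by
  obtain ⟨h1, h2⟩ := integral_slice j hΩ hρ hmem hpos hzero hh hs
  have hc : HasCompactSupport h := HasCompactSupport.of_support_subset_isCompact
    (isCompact_closedBall p r) ((subset_tsupport h).trans
      (hs.trans Metric.ball_subset_closedBall))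
  set K := tsupport h ∩ frontier Ω with hK
  have hKc : IsCompact K := hc.isCompact.inter_right isClosed_frontier
  set F : (Fin n → ℝ) → ℂ := fun y => ∫ t, Ω.indicator (pd j h) (slicePoint j t y) with hF
  have hpdc : Continuous (pd j h) := (hh.continuous_fderiv (by simp)).clm_apply continuous_const
  have hpd : Integrable (pd j h) :=
    hpdc.integrable_of_hasCompactSupport (hc.fderiv_apply (𝕜 := ℝ) (e j))
  have hFm : StronglyMeasurable F := by
    refine StronglyMeasurable.integral_prod_right
      (f := fun y t => Ω.indicator (pd j h) (slicePoint j t y)) ?_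
    have : Measurable fun z : (Fin n → ℝ) × ℝ => slicePoint j z.2 z.1 :=
      (measurableEmbedding_slicePoint j).measurable.comp measurable_swap
    exact ((hpdc.measurable.indicator hΩ.measurableSet).comp this).stronglyMeasurable
  have hint : ∫ x in Ω, pd j h x = ∫ y, F y := by
    rw [← integral_indicator hΩ.measurableSet,
      integral_eq_integral_slicePoint j (hpd.indicator hΩ.measurableSet)]
  have hKm : MeasurableSet (dropCoord j '' K) :=
    (hKc.image (lipschitzWith_dropCoord j).continuous).measurableSet
  have hFK : ∫ y, F y = ∫ y in dropCoord j '' K, F y := by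
    rw [setIntegral_eq_integral_of_forall_compl_eq_zero h2]
  have hL2 : eLpNorm F 2 (volume.restrict (dropCoord j '' K)) ≤
      eLpNorm h 2 (surfaceMeasure Ω) := by
    simp only [eLpNorm_eq_lintegral_rpow_enorm_toReal (p := 2) two_ne_zero ENNReal.ofNat_ne_top]
    gcongr ?_ ^ _
    calc ∫⁻ y in dropCoord j '' K, ‖F y‖ₑ ^ (2 : ℝ≥0∞).toReal
        ≤ ∫⁻ y, ‖F y‖ₑ ^ (2 : ℝ≥0∞).toReal ∂(((Measure.hausdorffMeasure (n : ℝ)).restrict K).map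
          (dropCoord j)) := lintegral_mono' (volume_restrict_image_dropCoord_le j) le_rfl
      _ ≤ ∫⁻ x in K, ‖F (dropCoord j x)‖ₑ ^ (2 : ℝ≥0∞).toReal ∂(Measure.hausdorffMeasure (n : ℝ)) :=
          lintegral_map_le _ _
      _ = ∫⁻ x in K, ‖h x‖ₑ ^ (2 : ℝ≥0∞).toReal ∂(Measure.hausdorffMeasure (n : ℝ)) := by
          refine setLIntegral_congr_fun hKc.measurableSet fun x hx => ?_
          rw [← ofReal_norm, ← ofReal_norm, h1 x hx]
      _ ≤ ∫⁻ x, ‖h x‖ₑ ^ (2 : ℝ≥0∞).toReal ∂(surfaceMeasure Ω) := by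
          rw [surfaceMeasure_succ]
          exact lintegral_mono_set inter_subset_right
  calc ‖∫ x in Ω, pd j h x‖ₑ = ‖∫ y in dropCoord j '' K, F y‖ₑ := by rw [hint, hFK]
    _ ≤ ∫⁻ y in dropCoord j '' K, ‖F y‖ₑ := enorm_integral_le_lintegral_enorm _
    _ = eLpNorm F 1 (volume.restrict (dropCoord j '' K)) := eLpNorm_one_eq_lintegral_enorm.symm
    _ ≤ eLpNorm F 2 (volume.restrict (dropCoord j '' K)) *
        (volume.restrict (dropCoord j '' K)) univ ^
          (1 / (1 : ℝ≥0∞).toReal - 1 / (2 : ℝ≥0∞).toReal) :=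
        eLpNorm_le_eLpNorm_mul_rpow_measure_univ (by norm_num) hFm.aestronglyMeasurable
    _ = volume (dropCoord j '' K) ^ (1 / 2 : ℝ) *
        eLpNorm F 2 (volume.restrict (dropCoord j '' K)) := by
        rw [Measure.restrict_apply_univ, mul_comm]
        norm_num
    _ ≤ _ := by
        gcongr
        exact inter_subset_left.trans (hs.trans Metric.ball_subset_closedBall)

end Line

theorem pd_real_smul {d : ℕ} {ζ : E d → ℝ} {v : E d → ℂ} {x : E d} (hζ : DifferentiableAt ℝ ζ x)
    (hv : DifferentiableAt ℝ v x) (i : Fin d) :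
    pd i (fun y => ζ y • v y) x = ζ x • pd i v x + fderiv ℝ ζ x (e i) • v x := by
  rw [pd, fderiv_fun_smul hζ hv]
  rfl

theorem continuous_pd {d : ℕ} {v : E d → ℂ} (hv : ContDiff ℝ 1 v) (i : Fin d) :
    Continuous (pd i v) :=
  (hv.continuous_fderiv (by simp)).clm_apply continuous_const

theorem hasCompactSupport_pd {d : ℕ} {v : E d → ℂ} (hv : HasCompactSupport v) (i : Fin d) :
    HasCompactSupport (pd i v) :=
  hv.fderiv_apply (𝕜 := ℝ) (e i)

theorem integrable_pd {d : ℕ} {v : E d → ℂ} (hv : ContDiff ℝ 1 v) (hc : HasCompactSupport v)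
    (i : Fin d) : Integrable (pd i v) :=
  (continuous_pd hv i).integrable_of_hasCompactSupport (hasCompactSupport_pd hc i)

theorem tsupport_pd_subset {d : ℕ} (v : E d → ℂ) (i : Fin d) : tsupport (pd i v) ⊆ tsupport v :=
  tsupport_fderiv_apply_subset ℝ (e i)

theorem integral_pd_eq_zero {d : ℕ} {v : E d → ℂ} (hv : ContDiff ℝ 1 v) (hc : HasCompactSupport v)
    (i : Fin d) : ∫ x, pd i v x = 0 := by
  have h1 := integrable_pd hv hc i
  have h2 := integral_mul_fderiv_eq_neg_fderiv_mul_of_integrable (μ := volume)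
    (f := fun _ : E d => (1 : ℂ)) (g := v) (v := e i) (by simp) (by simp only [one_mul]; exact h1)
    (by simpa using hv.continuous.integrable_of_hasCompactSupport hc) (by fun_prop)
    (fun x _ => hv.differentiable (by simp) x)
  simpa [pd] using h2

theorem hasCompactSupport_of_tsupport_subset_ball {d : ℕ} {v : E d → ℂ} {p : E d} {r : ℝ}
    (h : tsupport v ⊆ Metric.ball p r) : HasCompactSupport v :=
  HasCompactSupport.of_support_subset_isCompact (isCompact_closedBall p r)
    ((subset_tsupport v).trans (h.trans Metric.ball_subset_closedBall))

/-- The divergence of a vector field tangential to the boundary has integral zero. -/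
theorem integral_div_tangential {d : ℕ} {Ω : Set (E d)} (hΩ : IsOpen Ω) {ρ : E d → ℝ} {p : E d}
    {r : ℝ} (hρ : ContDiff ℝ ∞ ρ) (hmem : ∀ x ∈ Metric.ball p r, (x ∈ Ω ↔ ρ x < 0))
    {Y : Fin d → E d → ℂ} (hY : ∀ i, ContDiff ℝ 1 (Y i))
    (hs : ∀ i, tsupport (Y i) ⊆ Metric.ball p r)
    (htan : ∀ x, ∑ i, fderiv ℝ ρ x (e i) • Y i x = 0) :
    ∫ x in Ω, ∑ i, pd i (Y i) x = 0 := by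
  have hc : ∀ i, HasCompactSupport (Y i) := fun i =>
    hasCompactSupport_of_tsupport_subset_ball (hs i)
  have hdiv : Integrable fun x => ∑ i, pd i (Y i) x :=
    integrable_finsetSum _ fun i _ => integrable_pd (hY i) (hc i) i
  -- The cutoffs `χ m (ρ x)` tend to the indicator of `Ω` in the ball. Their gradients are parallel
  -- to `∇ρ`, hence orthogonal to `Y`, so inserting them creates no extra term in the divergence.
  set χ : ℕ → ℝ → ℝ := fun m s => Real.smoothTransition (-(m * s)) with hχ
  have hχs : ∀ m, ContDiff ℝ ∞ (χ m) := fun m =>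
    Real.smoothTransition.contDiff.comp (contDiff_const.mul contDiff_id).neg
  have hζs : ∀ m, ContDiff ℝ ∞ (fun x => χ m (ρ x)) := fun m => (hχs m).comp hρ
  have hzero : ∀ m, ∫ x, χ m (ρ x) • ∑ i, pd i (Y i) x = 0 := by
    intro m
    have heq : ∀ x, χ m (ρ x) • ∑ i, pd i (Y i) x =
        ∑ i, pd i (fun y => χ m (ρ y) • Y i y) x := by
      intro x
      have h1 : ∀ i, pd i (fun y => χ m (ρ y) • Y i y) x =
          χ m (ρ x) • pd i (Y i) x + deriv (χ m) (ρ x) • (fderiv ℝ ρ x (e i) • Y i x) := by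
        intro i
        rw [pd_real_smul ((hζs m).differentiable (by simp) x) ((hY i).differentiable (by simp) x)]
        have hd : HasFDerivAt (fun x => χ m (ρ x)) (deriv (χ m) (ρ x) • fderiv ℝ ρ x) x :=
          ((hχs m).differentiable (by simp) (ρ x)).hasDerivAt.comp_hasFDerivAt x
            (hρ.differentiable (by simp) x).hasFDerivAt
        rw [hd.fderiv, smul_apply, smul_assoc]
      simp only [h1]
      rw [Finset.sum_add_distrib, ← Finset.smul_sum, ← Finset.smul_sum, htan, smul_zero, add_zero]
    simp only [heq]
    have hC1 : ∀ i, ContDiff ℝ 1 (fun y => χ m (ρ y) • Y i y) := fun i =>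
      ((hζs m).of_le (by simp)).smul (hY i)
    have hC2 : ∀ i, HasCompactSupport (fun y => χ m (ρ y) • Y i y) := fun i =>
      (hc i).mono fun x hx hx' => hx (by simp [hx'])
    rw [integral_finsetSum _ fun i _ => integrable_pd (hC1 i) (hC2 i) i]
    exact Finset.sum_eq_zero fun i _ => integral_pd_eq_zero (hC1 i) (hC2 i) i
  have hlim : Tendsto (fun m => ∫ x, χ m (ρ x) • ∑ i, pd i (Y i) x) atTop
      (𝓝 (∫ x, Ω.indicator (fun x => ∑ i, pd i (Y i) x) x)) := by
    refine tendsto_integral_of_dominated_convergence (fun x => ‖∑ i, pd i (Y i) x‖)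
      (fun m => (hζs m).continuous.aestronglyMeasurable.smul hdiv.1) hdiv.norm
      (fun m => .of_forall fun x => ?_) (.of_forall fun x => ?_)
    · rw [norm_smul, Real.norm_of_nonneg (Real.smoothTransition.nonneg _)]
      exact mul_le_of_le_one_left (norm_nonneg _) (Real.smoothTransition.le_one _)
    · by_cases hx : x ∈ Metric.ball p r
      · by_cases hxΩ : x ∈ Ω
        · rw [indicator_of_mem hxΩ]
          have hneg := (hmem x hx).1 hxΩ
          have : ∀ᶠ m : ℕ in atTop, χ m (ρ x) = 1 := by
            filter_upwards [eventually_ge_atTop ⌈1 / (-ρ x)⌉₊] with m hm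
            refine Real.smoothTransition.one_of_one_le ?_
            have := (Nat.ceil_le.1 hm)
            rw [div_le_iff₀ (by linarith)] at this
            linarith
          refine tendsto_const_nhds.congr' ?_
          filter_upwards [this] with m hm
          rw [hm, one_smul]
        · rw [indicator_of_notMem hxΩ]
          have hpos : 0 ≤ ρ x := not_lt.1 fun h => hxΩ ((hmem x hx).2 h)
          have : ∀ m : ℕ, χ m (ρ x) = 0 := fun m =>
            Real.smoothTransition.zero_of_nonpos (by have : 0 ≤ m * ρ x := by positivity
                                                     linarith)
          simp [this]
      · have h0 : ∑ i, pd i (Y i) x = 0 := Finset.sum_eq_zero fun i _ =>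
          image_eq_zero_of_notMem_tsupport fun h => hx (hs i (tsupport_pd_subset _ i h))
        rw [h0]
        simp [indicator, h0]
  simp only [hzero] at hlim
  rw [← integral_indicator hΩ.measurableSet]
  exact (tendsto_nhds_unique hlim tendsto_const_nhds)

/-- A local estimate of the integral of a divergence by the normal component of the field. -/
theorem enorm_integral_div_le_local {d : ℕ} (hd : 1 ≤ d) {Ω : Set (E d)} (hΩ : IsOpen Ω)
    (hΩs : HasSmoothBoundary Ω) {ν : E d → E d}
    (hν : ∀ p ∈ frontier Ω, IsOuterUnitNormal Ω p (ν p)) {p : E d} (hp : p ∈ frontier Ω) :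
    ∃ r > 0, ∃ C : ℝ≥0∞, C ≠ ⊤ ∧ ∀ X : Fin d → E d → ℂ, (∀ i, ContDiff ℝ ∞ (X i)) →
      (∀ i, tsupport (X i) ⊆ Metric.ball p r) →
      ‖∫ x in Ω, ∑ i, pd i (X i) x‖ₑ ≤
        C * eLpNorm (fun x => ∑ i, ν x i • X i x) 2 (surfaceMeasure Ω) := by
  obtain ⟨n, rfl⟩ : ∃ n, d = n + 1 := ⟨d - 1, by omega⟩
  obtain ⟨U, ρ, hpU, hρU⟩ := hΩs p hp
  have hρ := hρU.smooth
  have hdiff : Differentiable ℝ ρ := hρ.differentiable (by simp)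
  obtain ⟨j, hj⟩ : ∃ j, fderiv ℝ ρ p (e j) ≠ 0 := by
    by_contra! hcon
    refine hρU.gradient_ne_zero p hpU ?_
    ext i
    rw [gradient_apply (hdiff p), hcon i]
    rfl
  have hcj : Continuous fun x => fderiv ℝ ρ x (e j) :=
    (hρ.continuous_fderiv (by simp)).clm_apply continuous_const
  have hcg := continuous_gradient hρ
  -- The summand `1` makes `‖∇ρ‖ < M |∂_j ρ|` strict at `p`, so that it persists on a neighbourhood.
  set M : ℝ := ‖gradient ρ p‖ / |fderiv ℝ ρ p (e j)| + 1 with hM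
  have hM0 : 0 < M := by positivity
  have hev : ∀ᶠ x in 𝓝 p, x ∈ U ∧ ‖gradient ρ x‖ < M * |fderiv ℝ ρ x (e j)| ∧
      0 < fderiv ℝ ρ x (e j) * fderiv ℝ ρ p (e j) := by
    refine Filter.Eventually.and (hρU.isOpen.mem_nhds hpU) (Filter.Eventually.and ?_ ?_)
    · refine (isOpen_lt hcg.norm (continuous_const.mul hcj.abs)).mem_nhds ?_
      have : 0 < |fderiv ℝ ρ p (e j)| := abs_pos.2 hj
      change ‖gradient ρ p‖ < M * |fderiv ℝ ρ p (e j)|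
      rw [hM, add_mul, one_mul, div_mul_cancel₀ _ this.ne']
      linarith
    · refine (isOpen_lt continuous_const (hcj.mul continuous_const)).mem_nhds ?_
      exact mul_self_pos.2 hj
  obtain ⟨r, hr, hball⟩ := Metric.eventually_nhds_iff_ball.1 hev
  refine ⟨r, hr, volume (dropCoord j '' Metric.closedBall p r) ^ (1 / 2 : ℝ) * ENNReal.ofReal M, ?_,
    fun X hX hXs => ?_⟩
  · refine ENNReal.mul_ne_top (ENNReal.rpow_ne_top_of_nonneg (by norm_num) ?_) (by simp)
    exact ((isCompact_closedBall p r).image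
      (lipschitzWith_dropCoord j).continuous).measure_lt_top.ne
  have hmem : ∀ x ∈ Metric.ball p r, (x ∈ Ω ↔ ρ x < 0) := fun x hx =>
    hρU.mem_iff x (hball x hx).1
  have hne : ∀ x ∈ Metric.ball p r, fderiv ℝ ρ x (e j) ≠ 0 := fun x hx h0 => by
    have := (hball x hx).2.2
    rw [h0, zero_mul] at this
    exact lt_irrefl _ this
  have hpos : (∀ x ∈ Metric.ball p r, 0 < fderiv ℝ ρ x (e j)) ∨
      ∀ x ∈ Metric.ball p r, fderiv ℝ ρ x (e j) < 0 := by
    rcases lt_or_gt_of_ne hj with h' | h'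
    · exact Or.inr fun x hx => neg_of_mul_pos_left (hball x hx).2.2 h'.le
    · exact Or.inl fun x hx => pos_of_mul_pos_left (hball x hx).2.2 h'.le
  -- `h` is chosen so that `X - h e_j` is tangential. Its divergence integrates to zero over `Ω`,
  -- leaving only the integral of `∂_j h`.
  set h : E (n + 1) → ℂ := fun x => (fderiv ℝ ρ x (e j))⁻¹ • ∑ i, fderiv ℝ ρ x (e i) • X i x
    with hh
  have hsum : ContDiff ℝ ∞ fun x => ∑ i, fderiv ℝ ρ x (e i) • X i x :=
    ContDiff.sum fun i _ => ((hρ.fderiv_right (m := ∞) (by simp)).clm_apply contDiff_const).smul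
      (hX i)
  have hsup : tsupport h ⊆ Metric.ball p r := by
    have h1 : tsupport h ⊆ ⋃ i, tsupport (X i) := by
      refine closure_minimal (fun x hx => ?_) (isClosed_iUnion_of_finite fun i =>
        isClosed_tsupport _)
      by_contra hcon
      simp only [mem_iUnion, not_exists] at hcon
      refine hx ?_
      simp [hh, fun i => image_eq_zero_of_notMem_tsupport (hcon i)]
    exact h1.trans (iUnion_subset hXs)
  have hsm : ContDiff ℝ ∞ h := by
    refine contDiff_iff_contDiffAt.2 fun x => ?_
    by_cases hx : x ∈ tsupport h
    swap
    · exact contDiffAt_const.congr_of_eventuallyEq (notMem_tsupport_iff_eventuallyEq.1 hx)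
    have hinv : ContDiffAt ℝ ∞ (fun x => (fderiv ℝ ρ x (e j))⁻¹) x :=
      ((hρ.fderiv_right (m := ∞) (by simp)).clm_apply contDiff_const).contDiffAt.inv
        (hne x (hsup hx))
    exact hinv.smul hsum.contDiffAt
  have h1 : ContDiff ℝ 1 h := hsm.of_le (by simp)
  set Y : Fin (n + 1) → E (n + 1) → ℂ := fun i => if i = j then X j - h else X i with hY
  have hX1 : ∀ i, ContDiff ℝ 1 (X i) := fun i => (hX i).of_le (by simp)
  have hY1 : ∀ i, ContDiff ℝ 1 (Y i) := by
    intro i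
    by_cases hij : i = j
    · simp only [hY, hij, if_true]
      exact (hX1 j).sub h1
    · simpa only [hY, hij, if_false] using hX1 i
  have hYs : ∀ i, tsupport (Y i) ⊆ Metric.ball p r := by
    intro i
    by_cases hij : i = j
    · simp only [hY, hij, if_true]
      exact (tsupport_sub _ _).trans (union_subset (hXs j) hsup)
    · simpa only [hY, hij, if_false] using hXs i
  have hYsum : ∀ (L : Fin (n + 1) → ℂ → ℂ) (x : E (n + 1)),
      (∀ z w, L j (z - w) = L j z - L j w) →
      ∑ i, L i (Y i x) = ∑ i, L i (X i x) - L j (h x) := by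
    intro L x hL
    rw [Finset.sum_eq_add_sum_sdiff_singleton_of_mem (Finset.mem_univ j),
      Finset.sum_eq_add_sum_sdiff_singleton_of_mem (Finset.mem_univ j)]
    have : ∑ i ∈ Finset.univ \ {j}, L i (Y i x) = ∑ i ∈ Finset.univ \ {j}, L i (X i x) :=
      Finset.sum_congr rfl fun i hi => by
        have : i ≠ j := by simpa using hi
        simp [hY, this]
    rw [this]
    simp only [hY, if_true, Pi.sub_apply, hL]
    ring
  have hYdiv : ∀ x, ∑ i, pd i (Y i) x = ∑ i, pd i (X i) x - pd j h x := by
    intro x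
    rw [Finset.sum_eq_add_sum_sdiff_singleton_of_mem (Finset.mem_univ j),
      Finset.sum_eq_add_sum_sdiff_singleton_of_mem (Finset.mem_univ j)]
    have : ∑ i ∈ Finset.univ \ {j}, pd i (Y i) x = ∑ i ∈ Finset.univ \ {j}, pd i (X i) x :=
      Finset.sum_congr rfl fun i hi => by
        have : i ≠ j := by simpa using hi
        simp [hY, this]
    rw [this]
    have hs : pd j (Y j) x = pd j (X j) x - pd j h x := by
      simp only [hY, if_true, pd]
      rw [fderiv_sub ((hX1 j).differentiable (by simp) x) (h1.differentiable (by simp) x)]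
      rfl
    rw [hs]
    ring
  have htan := integral_div_tangential hΩ hρ hmem hY1 hYs fun x => by
    rw [hYsum (fun i z => fderiv ℝ ρ x (e i) • z) x fun z w => smul_sub _ _ _, sub_eq_zero]
    by_cases hx : x ∈ Metric.ball p r
    · simp only [hh]
      rw [smul_smul, mul_inv_cancel₀ (hne x hx), one_smul]
    · have h0 : h x = 0 := image_eq_zero_of_notMem_tsupport fun h' => hx (hsup h')
      rw [h0, smul_zero]
      exact Finset.sum_eq_zero fun i _ => by
        rw [image_eq_zero_of_notMem_tsupport fun h' => hx (hXs i h'), smul_zero]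
  have hcX : ∀ i, HasCompactSupport (X i) := fun i =>
    hasCompactSupport_of_tsupport_subset_ball (hXs i)
  have heq : ∫ x in Ω, ∑ i, pd i (X i) x = ∫ x in Ω, pd j h x := by
    simp only [hYdiv] at htan
    rw [integral_sub] at htan
    · exact sub_eq_zero.1 htan
    · exact (integrable_finsetSum _ fun i _ => integrable_pd (hX1 i) (hcX i) i).integrableOn
    · exact (integrable_pd h1 (hasCompactSupport_of_tsupport_subset_ball hsup) j).integrableOn
  rw [heq]
  refine (enorm_integral_pd_le j hΩ (hρ.of_le (by simp)) hmem hpos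
    (fun x hx hf => hρU.eq_zero_of_mem_frontier hΩ (hball x hx).1 hf) h1 hsup).trans ?_
  rw [mul_assoc]
  gcongr
  -- On the boundary within the ball `∇ρ = ‖∇ρ‖ ν`, so `|h| = (‖∇ρ‖ / |∂_j ρ|) |ν·X| ≤ M |ν·X|`.
  refine eLpNorm_le_mul_eLpNorm_of_ae_le_mul ?_ 2
  refine (ae_restrict_iff' isClosed_frontier.measurableSet).2 (.of_forall fun x hxf => ?_)
  by_cases hx : x ∈ Metric.ball p r
  · have hνx := normal_eq hΩ hν hρU (hball x hx).1 hxf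
    have hg0 : 0 < ‖gradient ρ x‖ := norm_pos_iff.2 (hρU.gradient_ne_zero x (hball x hx).1)
    have hsumν : ∑ i, ν x i • X i x = ‖gradient ρ x‖⁻¹ • ∑ i, fderiv ℝ ρ x (e i) • X i x := by
      rw [Finset.smul_sum]
      refine Finset.sum_congr rfl fun i _ => ?_
      rw [hνx, PiLp.smul_apply, gradient_apply (hdiff x), smul_assoc]
    rw [hsumν, hh, norm_smul, norm_smul, ← mul_assoc]
    gcongr
    rw [norm_inv, norm_inv, norm_norm, Real.norm_eq_abs, ← div_eq_mul_inv,
      inv_le_comm₀ (abs_pos.2 (hne x hx)) (by positivity), inv_div, div_le_iff₀ hM0, mul_comm]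
    exact (hball x hx).2.1.le
  · have h0 : h x = 0 := image_eq_zero_of_notMem_tsupport fun h' => hx (hsup h')
    rw [h0, norm_zero]
    positivity

theorem integral_div_eq_zero_of_ball_subset {d : ℕ} {Ω : Set (E d)} {X : Fin d → E d → ℂ} {p : E d} {r : ℝ}
    (hX : ∀ i, ContDiff ℝ ∞ (X i)) (hs : ∀ i, tsupport (X i) ⊆ Metric.ball p r)
    (hr : Metric.ball p r ⊆ Ω) : ∫ x in Ω, ∑ i, pd i (X i) x = 0 := by
  have h1 : ∀ i, ContDiff ℝ 1 (X i) := fun i => (hX i).of_le (by simp)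
  have hc : ∀ i, HasCompactSupport (X i) := fun i =>
    hasCompactSupport_of_tsupport_subset_ball (hs i)
  rw [setIntegral_eq_integral_of_forall_compl_eq_zero fun x hx =>
    Finset.sum_eq_zero fun i _ => image_eq_zero_of_notMem_tsupport fun h =>
      hx (hr (hs i (tsupport_pd_subset _ i h))),
    integral_finsetSum _ fun i _ => integrable_pd (h1 i) (hc i) i]
  exact Finset.sum_eq_zero fun i _ => integral_pd_eq_zero (h1 i) (hc i) i

/-- The integral of a divergence is controlled by the normal component on the boundary. -/
theorem enorm_integral_div_le {d : ℕ} (hd : 1 ≤ d) {Ω : Set (E d)} (hΩ : IsOpen Ω)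
    (hΩb : Bornology.IsBounded Ω) (hΩs : HasSmoothBoundary Ω) {ν : E d → E d}
    (hν : ∀ p ∈ frontier Ω, IsOuterUnitNormal Ω p (ν p)) :
    ∃ C : ℝ≥0∞, C ≠ ⊤ ∧ ∀ X : Fin d → E d → ℂ, (∀ i, ContDiff ℝ ∞ (X i)) →
      ‖∫ x in Ω, ∑ i, pd i (X i) x‖ₑ ≤
        C * eLpNorm (fun x => ∑ i, ν x i • X i x) 2 (surfaceMeasure Ω) := by
  have hloc : ∀ p ∈ closure Ω, ∃ r > 0, ∃ C : ℝ≥0∞, C ≠ ⊤ ∧ ∀ X : Fin d → E d → ℂ,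
      (∀ i, ContDiff ℝ ∞ (X i)) → (∀ i, tsupport (X i) ⊆ Metric.ball p r) →
      ‖∫ x in Ω, ∑ i, pd i (X i) x‖ₑ ≤
        C * eLpNorm (fun x => ∑ i, ν x i • X i x) 2 (surfaceMeasure Ω) := by
    intro p hp
    by_cases hpΩ : p ∈ Ω
    · obtain ⟨r, hr, hball⟩ := Metric.isOpen_iff.1 hΩ p hpΩ
      refine ⟨r, hr, 0, by simp, fun X hX hs => ?_⟩
      rw [integral_div_eq_zero_of_ball_subset hX hs hball]
      simp
    · exact enorm_integral_div_le_local hd hΩ hΩs hν (by rw [hΩ.frontier_eq]; exact ⟨hp, hpΩ⟩)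
  choose! r hr C hC hest using hloc
  obtain ⟨t, ht, hcov⟩ := hΩb.isCompact_closure.elim_nhds_subcover (fun p => Metric.ball p (r p))
    fun p hp => Metric.ball_mem_nhds p (hr p hp)
  -- The estimate is local: `X` is cut by a partition of unity, and the normal component of each
  -- piece is pointwise bounded by that of `X` because the cutoffs take values in `[0, 1]`.
  obtain ⟨f, hf⟩ := SmoothPartitionOfUnity.exists_isSubordinate (modelWithCornersSelf ℝ (E d))
    (s := closure Ω) isClosed_closure (fun p : t => Metric.ball p.1 (r p)) (fun _ => Metric.isOpen_ball)
    (by simpa [iUnion_subtype] using hcov)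
  refine ⟨∑ p : t, C p.1, (ENNReal.sum_lt_top.2 fun (p : t) _ => (hC p.1 (ht p.1 p.2)).lt_top).ne,
    fun X hX => ?_⟩
  have hfs : ∀ p, ContDiff ℝ ∞ (f p) := fun p => (f p).contMDiff.contDiff
  set Z : t → Fin d → E d → ℂ := fun p i x => f p x • X i x with hZ
  have hZs : ∀ p i, ContDiff ℝ ∞ (Z p i) := fun p i => (hfs p).smul (hX i)
  have hZt : ∀ p i, tsupport (Z p i) ⊆ Metric.ball p.1 (r p) := fun p i =>
    (closure_mono (Function.support_smul_subset_left (f p) (X i))).trans (hf p)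
  have hsum1 : ∀ x ∈ Ω, ∑ p, f p x = 1 := fun x hx => by
    rw [← finsum_eq_sum_of_fintype]
    exact f.sum_eq_one (subset_closure hx)
  have hdiv : ∀ x ∈ Ω, ∑ i, pd i (X i) x = ∑ p, ∑ i, pd i (Z p i) x := by
    intro x hx
    rw [Finset.sum_comm]
    refine Finset.sum_congr rfl fun i _ => ?_
    have h1 : X i =ᶠ[𝓝 x] fun y => ∑ p, Z p i y := by
      filter_upwards [hΩ.mem_nhds hx] with y hy
      simp only [hZ]
      rw [← Finset.sum_smul, hsum1 y hy, one_smul]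
    simp only [pd]
    rw [h1.fderiv_eq, fderiv_fun_sum fun p _ => (hZs p i).differentiable (by simp) x]
    simp
  have hint : ∫ x in Ω, ∑ i, pd i (X i) x = ∑ p, ∫ x in Ω, ∑ i, pd i (Z p i) x := by
    rw [setIntegral_congr_fun hΩ.measurableSet hdiv, integral_finsetSum]
    exact fun p _ => (integrable_finsetSum _ fun i _ => integrable_pd ((hZs p i).of_le (by simp))
      (hasCompactSupport_of_tsupport_subset_ball (hZt p i)) i).integrableOn
  rw [hint, Finset.sum_mul]
  refine (enorm_sum_le _ _).trans (Finset.sum_le_sum fun p _ => ?_)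
  refine (hest p.1 (ht p.1 p.2) (Z p) (hZs p) (hZt p)).trans ?_
  gcongr
  refine eLpNorm_mono fun x => ?_
  have : ∑ i, ν x i • Z p i x = f p x • ∑ i, ν x i • X i x := by
    rw [Finset.smul_sum]
    exact Finset.sum_congr rfl fun i _ => smul_comm _ _ _
  rw [this, norm_smul, Real.norm_of_nonneg (f.nonneg p x)]
  exact mul_le_of_le_one_left (norm_nonneg _) (f.le_one p x)

/-! ### Extension by zero -/

section ZeroExtension

variable {d : ℕ} {Ω : Set (E d)} {ν : E d → E d} {u : L2 Ω}

theorem memLp_restrict_of_continuous {F : Type*} [NormedAddCommGroup F]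
    (hΩb : Bornology.IsBounded Ω) {f : E d → F} (hf : Continuous f) (p : ℝ≥0∞) :
    MemLp f p (volume.restrict Ω) := by
  have hK := hΩb.isCompact_closure
  obtain ⟨M, hM⟩ := hK.exists_bound_of_continuousOn hf.continuousOn
  have : IsFiniteMeasure (volume.restrict (closure Ω)) := ⟨by simpa using hK.measure_lt_top⟩
  have h1 : MemLp f p (volume.restrict (closure Ω)) := by
    refine MemLp.of_bound ?_ M ?_
    · exact hf.continuousOn.aestronglyMeasurable_of_isCompact hK isClosed_closure.measurableSet
    · exact (ae_restrict_iff' isClosed_closure.measurableSet).2 (.of_forall hM)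
  exact h1.mono_measure (Measure.restrict_mono subset_closure le_rfl)

/-- By Hölder, the products converge in `L¹`. -/
theorem tendsto_integral_smul_of_eLpNorm {μ : Measure (E d)} {φ : E d → ℝ} (hφ : MemLp φ 2 μ)
    {f : ℕ → E d → ℂ} {g : E d → ℂ} (hf : ∀ n, MemLp (f n) 2 μ) (hg : MemLp g 2 μ)
    (h : Tendsto (fun n => eLpNorm (fun x => f n x - g x) 2 μ) atTop (𝓝 0)) :
    Tendsto (fun n => ∫ x, φ x • f n x ∂μ) atTop (𝓝 (∫ x, φ x • g x ∂μ)) := by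
  have hint : ∀ {k : E d → ℂ}, MemLp k 2 μ → Integrable (fun x => φ x • k x) μ := fun hk =>
    memLp_one_iff_integrable.1 (hk.smul hφ)
  refine tendsto_integral_of_L1' _ (hint hg).1 (.of_forall fun n => hint (hf n)) ?_
  have hle : ∀ n, eLpNorm ((fun x => φ x • f n x) - fun x => φ x • g x) 1 μ ≤
      eLpNorm φ 2 μ * eLpNorm (fun x => f n x - g x) 2 μ := by
    intro n
    have : ((fun x => φ x • f n x) - fun x => φ x • g x) = φ • fun x => f n x - g x := by
      ext x
      simp [mul_sub]
    rw [this]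
    exact eLpNorm_smul_le_mul_eLpNorm ((hf n).1.sub hg.1) hφ.1
  refine tendsto_of_tendsto_of_tendsto_of_le_of_le tendsto_const_nhds ?_ (fun _ => zero_le)
    hle
  simpa using ENNReal.Tendsto.const_mul h (Or.inr hφ.2.ne)

theorem norm_normal_eq_one (hν : ∀ p ∈ frontier Ω, IsOuterUnitNormal Ω p (ν p)) {p : E d}
    (hp : p ∈ frontier Ω) : ‖ν p‖ = 1 := by
  obtain ⟨U, ρ, hpU, h, he⟩ := hν p hp
  rw [he, norm_smul, norm_inv, norm_norm, inv_mul_cancel₀]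
  exact norm_ne_zero_iff.2 (h.gradient_ne_zero p hpU)

/-- The Laplacian of `u` as an element of `L²(Ω)`. -/
def weakLaplacian (Ω : Set (E d)) (u : L2 Ω) : L2 Ω := ∑ i, weakPartial Ω i (weakPartial Ω i u)

/-- A function with vanishing trace has the weak derivatives of its extension by zero. -/
theorem integral_pd_smul_eq_of_hasTrace_zero (hd : 1 ≤ d) (hΩ : IsOpen Ω)
    (hΩb : Bornology.IsBounded Ω) (hΩs : HasSmoothBoundary Ω)
    (hν : ∀ p ∈ frontier Ω, IsOuterUnitNormal Ω p (ν p)) (hu : HasTrace Ω u 0) {φ : E d → ℝ}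
    (hφ : ContDiff ℝ ∞ φ) (i : Fin d) :
    ∫ x in Ω, fderiv ℝ φ x (e i) • u x = - ∫ x in Ω, φ x • weakPartial Ω i u x := by
  obtain ⟨C, hC, hest⟩ := enorm_integral_div_le hd hΩ hΩb hΩs hν
  obtain ⟨-, v, hv, hvu, hv0⟩ := hu
  obtain ⟨M, hM⟩ := hΩb.isCompact_closure.exists_bound_of_continuousOn hφ.continuous.continuousOn
  have hφ' : ContDiff ℝ ∞ fun x => fderiv ℝ φ x (e i) :=
    (hφ.fderiv_right (m := ∞) (by simp)).clm_apply contDiff_const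
  have hm : ∀ {f : E d → ℂ}, ContDiff ℝ ∞ f → MemLp f 2 (volume.restrict Ω) := fun hf =>
    memLp_restrict_of_continuous hΩb hf.continuous 2
  have hm' : ∀ {f : E d → ℝ}, ContDiff ℝ ∞ f → MemLp f 2 (volume.restrict Ω) := fun hf =>
    memLp_restrict_of_continuous hΩb hf.continuous 2
  have l1 := tendsto_integral_smul_of_eLpNorm (hm' hφ') (fun n => hm (hv n)) (Lp.memLp u) hvu.1
  have l2 := tendsto_integral_smul_of_eLpNorm (hm' hφ) (fun n => hm (contDiff_pd (hv n) i))
    (Lp.memLp _) (hvu.2 i)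
  rw [eq_neg_iff_add_eq_zero]
  refine tendsto_nhds_unique (l1.add l2) ?_
  rw [tendsto_zero_iff_enorm_tendsto_zero]
  have hle : ∀ n, ‖(∫ x in Ω, fderiv ℝ φ x (e i) • v n x) + ∫ x in Ω, φ x • pd i (v n) x‖ₑ ≤
      C * (ENNReal.ofReal M * eLpNorm (fun x => v n x - (0 : E d → ℂ) x) 2 (surfaceMeasure Ω)) := by
    intro n
    -- The field `φ v_n e_i`: its divergence is the integrand, and its normal component is at most
    -- `M |v_n|`, which tends to zero in `L²(∂Ω)`. The test function `φ` need not vanish on the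
    -- boundary, which is the gain over the definition of the weak derivative.
    set X : Fin d → E d → ℂ := fun k x => if k = i then φ x • v n x else 0 with hX
    have hXs : ∀ k, ContDiff ℝ ∞ (X k) := by
      intro k
      by_cases hk : k = i
      · simp only [hX, hk, if_true]
        exact hφ.smul (hv n)
      · simpa only [hX, hk, if_false] using contDiff_const
    have hXd : ∀ x, ∑ k, pd k (X k) x = fderiv ℝ φ x (e i) • v n x + φ x • pd i (v n) x := by
      intro x
      rw [Finset.sum_eq_single i]
      · simp only [hX, if_true]
        rw [pd_real_smul (hφ.differentiable (by simp) x) ((hv n).differentiable (by simp) x),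
          add_comm]
      · intro k _ hk
        simp [hX, hk, pd]
      · simp
    have h1 := hest X hXs
    simp only [hXd] at h1
    rw [integral_add] at h1
    · refine h1.trans ?_
      gcongr
      refine eLpNorm_le_mul_eLpNorm_of_ae_le_mul ?_ 2
      refine (ae_restrict_iff' isClosed_frontier.measurableSet).2 (.of_forall fun x hx => ?_)
      rw [Finset.sum_eq_single i (fun k _ hk => by simp [hX, hk]) (by simp)]
      simp only [hX, if_true, Pi.zero_apply, sub_zero]
      rw [norm_smul, norm_smul, ← mul_assoc]
      gcongr
      have a1 := PiLp.norm_apply_le (ν x) i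
      rw [norm_normal_eq_one hν hx] at a1
      have a2 := hM x (frontier_subset_closure hx)
      calc ‖ν x i‖ * ‖φ x‖ ≤ 1 * M := by gcongr
        _ = M := one_mul M
    · exact memLp_one_iff_integrable.1 ((hm (hv n)).smul (hm' hφ'))
    · exact memLp_one_iff_integrable.1 ((hm (contDiff_pd (hv n) i)).smul (hm' hφ))
  refine tendsto_of_tendsto_of_tendsto_of_le_of_le tendsto_const_nhds ?_ (fun _ => zero_le)
    hle
  simpa using ENNReal.Tendsto.const_mul (ENNReal.Tendsto.const_mul (a := ENNReal.ofReal M) hv0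
    (Or.inr ENNReal.ofReal_ne_top)) (Or.inr hC)

/-- The boundary inequality is applied to `φ ∇v_n`, where `v_n` are the smooth approximants of `u`.
The normal component `φ ∂_ν v_n` tends to zero in `L²(∂Ω)`. -/
theorem integral_weakLaplacian_smul_eq (hd : 1 ≤ d) (hΩ : IsOpen Ω)
    (hΩb : Bornology.IsBounded Ω) (hΩs : HasSmoothBoundary Ω)
    (hν : ∀ p ∈ frontier Ω, IsOuterUnitNormal Ω p (ν p)) (hu : HasNormalTrace Ω ν u 0)
    {φ : E d → ℝ} (hφ : ContDiff ℝ ∞ φ) :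
    ∑ i, ∫ x in Ω, φ x • weakPartial Ω i (weakPartial Ω i u) x =
      - ∑ i, ∫ x in Ω, fderiv ℝ φ x (e i) • weakPartial Ω i u x := by
  obtain ⟨C, hC, hest⟩ := enorm_integral_div_le hd hΩ hΩb hΩs hν
  obtain ⟨-, v, hv, hvu, hv0⟩ := hu
  obtain ⟨M, hM⟩ := hΩb.isCompact_closure.exists_bound_of_continuousOn hφ.continuous.continuousOn
  have hφ' : ∀ i, ContDiff ℝ ∞ fun x => fderiv ℝ φ x (e i) := fun i =>
    (hφ.fderiv_right (m := ∞) (by simp)).clm_apply contDiff_const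
  have hm : ∀ {f : E d → ℂ}, ContDiff ℝ ∞ f → MemLp f 2 (volume.restrict Ω) := fun hf =>
    memLp_restrict_of_continuous hΩb hf.continuous 2
  have hm' : ∀ {f : E d → ℝ}, ContDiff ℝ ∞ f → MemLp f 2 (volume.restrict Ω) := fun hf =>
    memLp_restrict_of_continuous hΩb hf.continuous 2
  have l1 := tendsto_finsetSum Finset.univ fun i _ => tendsto_integral_smul_of_eLpNorm
    (hm' (hφ' i)) (fun n => hm (contDiff_pd (hv n) i)) (Lp.memLp _) (hvu.1.2 i)
  have l2 := tendsto_finsetSum Finset.univ fun i _ => tendsto_integral_smul_of_eLpNorm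
    (hm' hφ) (fun n => hm (contDiff_pd (contDiff_pd (hv n) i) i)) (Lp.memLp _) ((hvu.2 i).2 i)
  rw [eq_neg_iff_add_eq_zero, add_comm]
  refine tendsto_nhds_unique (l1.add l2) ?_
  rw [tendsto_zero_iff_enorm_tendsto_zero]
  have hle : ∀ n, ‖(∑ i, ∫ x in Ω, fderiv ℝ φ x (e i) • pd i (v n) x) +
      ∑ i, ∫ x in Ω, φ x • pd i (pd i (v n)) x‖ₑ ≤
      C * (ENNReal.ofReal M *
        eLpNorm (fun x => fderiv ℝ (v n) x (ν x) - (0 : E d → ℂ) x) 2 (surfaceMeasure Ω)) := by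
    intro n
    have h1 := hest (fun k x => φ x • pd k (v n) x) fun k => hφ.smul (contDiff_pd (hv n) k)
    have hXd : ∀ x, ∑ k, pd k (fun x => φ x • pd k (v n) x) x =
        ∑ i, (fderiv ℝ φ x (e i) • pd i (v n) x + φ x • pd i (pd i (v n)) x) := by
      intro x
      refine Finset.sum_congr rfl fun i _ => ?_
      rw [pd_real_smul (hφ.differentiable (by simp) x)
        ((contDiff_pd (hv n) i).differentiable (by simp) x), add_comm]
    have i1 : ∀ i, Integrable (fun x => fderiv ℝ φ x (e i) • pd i (v n) x) (volume.restrict Ω) :=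
      fun i => memLp_one_iff_integrable.1 ((hm (contDiff_pd (hv n) i)).smul (hm' (hφ' i)))
    have i2 : ∀ i, Integrable (fun x => φ x • pd i (pd i (v n)) x) (volume.restrict Ω) :=
      fun i => memLp_one_iff_integrable.1
        ((hm (contDiff_pd (contDiff_pd (hv n) i) i)).smul (hm' hφ))
    simp only [hXd] at h1
    rw [integral_finsetSum (f := fun i x => fderiv ℝ φ x (e i) • pd i (v n) x +
      φ x • pd i (pd i (v n)) x) _ fun i _ => (i1 i).add (i2 i)] at h1
    simp only [fun i => integral_add (i1 i) (i2 i), Finset.sum_add_distrib] at h1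
    refine h1.trans ?_
    gcongr
    refine eLpNorm_le_mul_eLpNorm_of_ae_le_mul ?_ 2
    refine (ae_restrict_iff' isClosed_frontier.measurableSet).2 (.of_forall fun x hx => ?_)
    have hsum : ∑ i, ν x i • (φ x • pd i (v n) x) = φ x • fderiv ℝ (v n) x (ν x) := by
      have : ν x = ∑ i, ν x i • (e i : E d) := by
        ext k
        simp [e, Finset.sum_apply, Pi.single_apply]
      conv_rhs => rw [this, map_sum, Finset.smul_sum]
      refine Finset.sum_congr rfl fun i _ => ?_
      rw [map_smul, smul_comm]
      rfl
    rw [hsum, norm_smul, Pi.zero_apply, sub_zero]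
    gcongr
    exact hM x (frontier_subset_closure hx)
  refine tendsto_of_tendsto_of_tendsto_of_le_of_le tendsto_const_nhds ?_ (fun _ => zero_le)
    hle
  simpa using ENNReal.Tendsto.const_mul (ENNReal.Tendsto.const_mul (a := ENNReal.ofReal M) hv0
    (Or.inr ENNReal.ofReal_ne_top)) (Or.inr hC)

theorem memLp_ofReal_restrict (hΩb : Bornology.IsBounded Ω) {φ : E d → ℝ} (hφ : Continuous φ) :
    MemLp (fun x => (φ x : ℂ)) 2 (volume.restrict Ω) :=
  memLp_restrict_of_continuous hΩb (Complex.continuous_ofReal.comp hφ) 2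

/-- A function with vanishing Cauchy data has the weak Laplacian of its extension by zero. -/
theorem integral_laplacian_smul_eq (hd : 1 ≤ d) (hΩ : IsOpen Ω)
    (hΩb : Bornology.IsBounded Ω) (hΩs : HasSmoothBoundary Ω)
    (hν : ∀ p ∈ frontier Ω, IsOuterUnitNormal Ω p (ν p)) (hu0 : HasTrace Ω u 0)
    (hu : HasNormalTrace Ω ν u 0) {φ : E d → ℝ} (hφ : ContDiff ℝ ∞ φ) :
    ∑ i, ∫ x in Ω, fderiv ℝ (fun y => fderiv ℝ φ y (e i)) x (e i) • u x =
      ∫ x in Ω, φ x • weakLaplacian Ω u x := by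
  have h1 : ∫ x in Ω, φ x • weakLaplacian Ω u x =
      ∑ i, ∫ x in Ω, φ x • weakPartial Ω i (weakPartial Ω i u) x := by
    simp only [← pairing_apply (memLp_ofReal_restrict hΩb hφ.continuous), weakLaplacian, map_sum]
  rw [h1, integral_weakLaplacian_smul_eq hd hΩ hΩb hΩs hν hu hφ, ← Finset.sum_neg_distrib]
  refine Finset.sum_congr rfl fun i _ => ?_
  exact integral_pd_smul_eq_of_hasTrace_zero hd hΩ hΩb hΩs hν hu0
    ((hφ.fderiv_right (m := ∞) (by simp)).clm_apply contDiff_const) i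

end ZeroExtension

/-! ### Mollification -/

section Mollification

variable {d : ℕ}

/-- Continuity of translations in `L²`, expressed through the continuous action of `DomAddAct` on
`Lp`. -/
theorem tendsto_eLpNorm_translate_sub {f : E d → ℂ} (hf : MemLp f 2) :
    Tendsto (fun s : E d => eLpNorm (fun x => f (s + x) - f x) 2) (𝓝 0) (𝓝 0) := by
  have : Fact ((2 : ℝ≥0∞) ≠ ⊤) := ⟨by simp⟩
  have hc : Continuous fun s : E d => (DomAddAct.mk s) +ᵥ hf.toLp := by
    have := DomAddAct.continuous_mk (M := E d)
    fun_prop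
  have h0 := ((hc.sub (continuous_const (y := hf.toLp))).enorm).tendsto 0
  have hz : (DomAddAct.mk (0 : E d) +ᵥ hf.toLp : Lp ℂ 2 (volume : Measure (E d))) = hf.toLp := by
    rw [DomAddAct.mk_vadd_toLp]
    congr 1
    ext x
    simp
  simp only [Pi.sub_apply, hz, sub_self, enorm_zero] at h0
  refine h0.congr fun s => ?_
  rw [DomAddAct.mk_vadd_toLp, ← MemLp.toLp_sub, Lp.enorm_toLp]
  rfl

/-- The convolution of `f` with the kernel `η`. -/
def mollify (η : E d → ℝ) (f : E d → ℂ) (x : E d) : ℂ := ∫ t, η (x - t) • f t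

theorem mollify_eq_convolution (η : E d → ℝ) (f : E d → ℂ) :
    mollify η f = convolution f η (ContinuousLinearMap.lsmul ℝ ℝ).flip volume := by
  ext x
  simp [mollify, convolution_def]

theorem contDiff_mollify {η : E d → ℝ} {f : E d → ℂ} (hη : ContDiff ℝ ∞ η)
    (hc : HasCompactSupport η) (hf : LocallyIntegrable f) : ContDiff ℝ ∞ (mollify η f) := by
  rw [mollify_eq_convolution]
  exact hc.contDiff_convolution_right _ hf hη

theorem pd_mollify {η : E d → ℝ} {f : E d → ℂ} (hη : ContDiff ℝ ∞ η)
    (hc : HasCompactSupport η) (hf : LocallyIntegrable f) (i : Fin d) :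
    pd i (mollify η f) = mollify (fun x => fderiv ℝ η x (e i)) f := by
  ext x
  have h1 : ContDiff ℝ 1 η := hη.of_le (by simp)
  rw [pd, mollify_eq_convolution, mollify_eq_convolution,
    (hc.hasFDerivAt_convolution_right _ hf h1 x).fderiv,
    convolution_precompR_apply _ hf (hc.fderiv ℝ) (h1.continuous_fderiv (by simp))]

theorem mollify_sub_eq {η : E d → ℝ} {f : E d → ℂ} (hη : Continuous η)
    (hc : HasCompactSupport η) (hf : LocallyIntegrable f) (h1 : ∫ x, η x = 1) (x : E d) :
    mollify η f x - f x = ∫ s, η s • (f (x - s) - f x) := by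
  have e1 : mollify η f x = ∫ s, η s • f (x - s) := by
    rw [mollify, ← integral_sub_left_eq_self _ volume x]
    simp
  have e2 : f x = ∫ s, η s • f x := by
    rw [integral_smul_const, h1, one_smul]
  have i1 : Integrable fun s => η s • f (x - s) := by
    have := hc.convolutionExists_right (ContinuousLinearMap.lsmul ℝ ℝ).flip hf hη x
    have := (integrable_comp_sub_left _ x).2 this.integrable
    simpa using this
  have i2 : Integrable fun s => η s • f x :=
    (hη.integrable_of_hasCompactSupport hc).smul_const _
  rw [e1]
  conv_lhs => rw [e2]
  rw [← integral_sub i1 i2]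
  simp only [smul_sub]

/-- The kernel is a probability density, so Cauchy–Schwarz bounds the squared error at each point by
the `η`-average of `|f(x - s) - f(x)|²`. Tonelli then leaves an average of squared translation
errors, each at most `ε ^ 2`. Genuine measurability of `f` serves the joint measurability in
Tonelli. -/
theorem eLpNorm_mollify_sub_le {η : E d → ℝ} {f : E d → ℂ} (hη : Continuous η)
    (hη0 : ∀ x, 0 ≤ η x) (h1 : ∫ x, η x = 1) {r : ℝ} (hs : Function.support η ⊆ Metric.ball 0 r)
    (hf : MemLp f 2) (hfm : Measurable f) {ε : ℝ≥0∞}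
    (hε : ∀ s ∈ Metric.ball (0 : E d) r, eLpNorm (fun x => f (x - s) - f x) 2 ≤ ε) :
    eLpNorm (fun x => mollify η f x - f x) 2 ≤ ε := by
  have hc : HasCompactSupport η := HasCompactSupport.of_support_subset_isCompact
    (isCompact_closedBall 0 r) (hs.trans Metric.ball_subset_closedBall)
  have hfl : LocallyIntegrable f := hf.locallyIntegrable (by norm_num)
  have hηm : Measurable fun s => ENNReal.ofReal (η s) := hη.measurable.ennreal_ofReal
  have hmass : ∫⁻ s, ENNReal.ofReal (η s) = 1 := by
    rw [← ofReal_integral_eq_lintegral_ofReal (hη.integrable_of_hasCompactSupport hc)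
      (.of_forall hη0), h1, ENNReal.ofReal_one]
  have hG : Measurable fun z : E d × E d => ‖f (z.1 - z.2) - f z.1‖ₑ ^ (2 : ℝ) := by
    have : Measurable fun z : E d × E d => f (z.1 - z.2) - f z.1 :=
      (hfm.comp (measurable_fst.sub measurable_snd)).sub (hfm.comp measurable_fst)
    exact this.enorm.pow_const _
  have hF : Measurable fun z : E d × E d =>
      ENNReal.ofReal (η z.2) * ‖f (z.1 - z.2) - f z.1‖ₑ ^ (2 : ℝ) :=
    (hηm.comp measurable_snd).mul hG
  have hpt : ∀ x, ‖mollify η f x - f x‖ₑ ^ (2 : ℝ) ≤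
      ∫⁻ s, ENNReal.ofReal (η s) * ‖f (x - s) - f x‖ₑ ^ (2 : ℝ) := by
    intro x
    rw [mollify_sub_eq hη hc hfl h1]
    set g : E d → ℂ := fun s => f (x - s) - f x with hg
    have hgm : Measurable g := (hfm.comp (measurable_const.sub measurable_id)).sub measurable_const
    -- The kernel is split as `√η · √η`; one factor will have mass one.
    have a1 : ‖∫ s, η s • g s‖ₑ ≤ ∫⁻ s, (ENNReal.ofReal (η s) ^ (1 / 2 : ℝ)) *
        (ENNReal.ofReal (η s) ^ (1 / 2 : ℝ) * ‖g s‖ₑ) := by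
      refine (enorm_integral_le_lintegral_enorm _).trans (lintegral_mono fun s => ?_)
      rw [← mul_assoc, ← ENNReal.rpow_add_of_nonneg _ _ (by norm_num) (by norm_num), enorm_smul,
        Real.enorm_of_nonneg (hη0 s)]
      norm_num
    have a2 := ENNReal.lintegral_mul_le_Lp_mul_Lq volume Real.HolderConjugate.two_two
      (hηm.pow_const (1 / 2 : ℝ)).aemeasurable
      ((hηm.pow_const (1 / 2 : ℝ)).mul hgm.enorm).aemeasurable
    simp only [Pi.mul_apply] at a2
    have a3 : ∀ s, (ENNReal.ofReal (η s) ^ (1 / 2 : ℝ)) ^ (2 : ℝ) = ENNReal.ofReal (η s) := by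
      intro s
      rw [← ENNReal.rpow_mul]
      norm_num
    simp only [ENNReal.mul_rpow_of_nonneg _ _ (zero_le_two (α := ℝ)), a3, hmass,
      ENNReal.one_rpow, one_mul] at a2
    calc ‖∫ s, η s • g s‖ₑ ^ (2 : ℝ) ≤
        ((∫⁻ s, ENNReal.ofReal (η s) * ‖g s‖ₑ ^ (2 : ℝ)) ^ (1 / 2 : ℝ)) ^ (2 : ℝ) := by
          gcongr
          exact a1.trans a2
      _ = ∫⁻ s, ENNReal.ofReal (η s) * ‖g s‖ₑ ^ (2 : ℝ) := by
          rw [← ENNReal.rpow_mul]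
          norm_num
  have hsq : ∀ s ∈ Metric.ball (0 : E d) r,
      ∫⁻ x, ‖f (x - s) - f x‖ₑ ^ (2 : ℝ) ≤ ε ^ (2 : ℝ) := by
    intro s hs
    have := hε s hs
    rw [eLpNorm_eq_lintegral_rpow_enorm_toReal two_ne_zero ENNReal.ofNat_ne_top] at this
    have := ENNReal.rpow_le_rpow this (zero_le_two (α := ℝ))
    rw [← ENNReal.rpow_mul] at this
    simpa using this
  have hmain : ∫⁻ x, ‖mollify η f x - f x‖ₑ ^ (2 : ℝ) ≤ ε ^ (2 : ℝ) := by
    calc ∫⁻ x, ‖mollify η f x - f x‖ₑ ^ (2 : ℝ)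
        ≤ ∫⁻ x, ∫⁻ s, ENNReal.ofReal (η s) * ‖f (x - s) - f x‖ₑ ^ (2 : ℝ) := lintegral_mono hpt
      _ = ∫⁻ s, ∫⁻ x, ENNReal.ofReal (η s) * ‖f (x - s) - f x‖ₑ ^ (2 : ℝ) :=
          lintegral_lintegral_swap
            (f := fun x s => ENNReal.ofReal (η s) * ‖f (x - s) - f x‖ₑ ^ (2 : ℝ)) hF.aemeasurable
      _ ≤ ∫⁻ s, ENNReal.ofReal (η s) * ε ^ (2 : ℝ) := by
          refine lintegral_mono fun s => ?_
          have hGs : Measurable fun x => ‖f (x - s) - f x‖ₑ ^ (2 : ℝ) :=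
            ((hfm.comp (measurable_id.sub measurable_const)).sub hfm).enorm.pow_const _
          rw [lintegral_const_mul _ hGs]
          by_cases hsb : s ∈ Metric.ball (0 : E d) r
          · gcongr
            exact hsq s hsb
          · have : η s = 0 := by
              by_contra hne
              exact hsb (hs hne)
            simp [this]
      _ = ε ^ (2 : ℝ) := by rw [lintegral_mul_const _ hηm, hmass, one_mul]
  rw [eLpNorm_eq_lintegral_rpow_enorm_toReal two_ne_zero ENNReal.ofNat_ne_top]
  have := ENNReal.rpow_le_rpow hmain (z := 1 / 2) (by norm_num)
  rw [← ENNReal.rpow_mul] at this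
  simpa using this

/-- A standard sequence of mollifiers. -/
theorem exists_mollifiers (d : ℕ) : ∃ η : ℕ → E d → ℝ, (∀ n, ContDiff ℝ ∞ (η n)) ∧
    (∀ n, Function.support (η n) ⊆ Metric.ball 0 1) ∧
    ∀ f : E d → ℂ, MemLp f 2 → Measurable f →
      Tendsto (fun n => eLpNorm (fun x => mollify (η n) f x - f x) 2) atTop (𝓝 0) := by
  set φ : ℕ → ContDiffBump (0 : E d) := fun n =>
    ⟨1 / (2 * ((n : ℝ) + 1)), 1 / ((n : ℝ) + 1), by positivity, by
      apply one_div_lt_one_div_of_lt <;> linarith [n.cast_nonneg (α := ℝ)]⟩ with hφ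
  have hr : ∀ n, (φ n).rOut = 1 / ((n : ℝ) + 1) := fun n => rfl
  refine ⟨fun n => (φ n).normed volume, fun n => (φ n).contDiff_normed, fun n => ?_,
    fun f hf hfm => ?_⟩
  · rw [ContDiffBump.support_normed_eq]
    refine Metric.ball_subset_ball ?_
    rw [hr, div_le_one (by positivity)]
    linarith [n.cast_nonneg (α := ℝ)]
  · rw [ENNReal.tendsto_nhds_zero]
    intro ε hε
    have h1 := ENNReal.tendsto_nhds_zero.1 (tendsto_eLpNorm_translate_sub hf) ε hε
    obtain ⟨r, hr0, hball⟩ := Metric.eventually_nhds_iff_ball.1 h1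
    filter_upwards [tendsto_one_div_add_atTop_nhds_zero_nat.eventually (gt_mem_nhds hr0)] with n hn
    refine eLpNorm_mollify_sub_le (φ n).continuous_normed (fun x => (φ n).nonneg_normed x)
      (φ n).integral_normed (ContDiffBump.support_normed_eq _).subset hf hfm fun s hs => ?_
    have := hball (-s) (by
      rw [mem_ball_zero_iff, norm_neg]
      rw [mem_ball_zero_iff] at hs
      exact hs.trans hn)
    simpa only [neg_add_eq_sub] using this

end Mollification

/-! ### A Carleman estimate -/

section Carleman

variable {d : ℕ}

/-- The classical partial derivative of a real function. -/
def rpd (i : Fin d) (v : E d → ℝ) (x : E d) : ℝ := fderiv ℝ v x (e i)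

theorem contDiff_rpd {v : E d → ℝ} (hv : ContDiff ℝ ∞ v) (i : Fin d) : ContDiff ℝ ∞ (rpd i v) :=
  (hv.fderiv_right (m := ∞) (by simp)).clm_apply contDiff_const

theorem rpd_mul {f g : E d → ℝ} (hf : ContDiff ℝ ∞ f) (hg : ContDiff ℝ ∞ g) (i : Fin d) :
    rpd i (fun x => f x * g x) = fun x => f x * rpd i g x + rpd i f x * g x := by
  ext x
  rw [rpd, fderiv_fun_mul (hf.differentiable (by simp) x) (hg.differentiable (by simp) x)]
  simp only [rpd, add_apply, smul_apply, smul_eq_mul]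
  ring

theorem rpd_add {f g : E d → ℝ} (hf : ContDiff ℝ ∞ f) (hg : ContDiff ℝ ∞ g) (i : Fin d) :
    rpd i (fun x => f x + g x) = fun x => rpd i f x + rpd i g x := by
  ext x
  rw [rpd, fderiv_fun_add (hf.differentiable (by simp) x) (hg.differentiable (by simp) x)]
  rfl

theorem rpd_comm {f : E d → ℝ} (hf : ContDiff ℝ ∞ f) (i j : Fin d) :
    rpd i (rpd j f) = rpd j (rpd i f) := by
  ext x
  have hs : IsSymmSndFDerivAt ℝ f x :=
    hf.contDiffAt.isSymmSndFDerivAt (by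
      simp only [minSmoothness_of_isRCLikeNormedField]
      exact WithTop.coe_le_coe.2 (le_top : (2 : ℕ∞) ≤ ⊤))
  have hd : Differentiable ℝ (fderiv ℝ f) :=
    (hf.fderiv_right (m := ∞) (by simp)).differentiable (by simp)
  have : ∀ k l : Fin d, rpd k (rpd l f) x = fderiv ℝ (fderiv ℝ f) x (e k) (e l) := by
    intro k l
    have := ((hd x).hasFDerivAt.clm_apply (hasFDerivAt_const (e l : E d) x)).fderiv
    change fderiv ℝ (fun y => fderiv ℝ f y (e l)) x (e k) = _
    rw [this]
    simp
  rw [this, this]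
  exact hs _ _

theorem rpd_eq_zero {v : E d → ℝ} {x : E d} (hx : x ∉ tsupport v) (i : Fin d) : rpd i v x = 0 :=
  image_eq_zero_of_notMem_tsupport fun h => hx (tsupport_fderiv_apply_subset ℝ (e i) h)

theorem rpd_rpd_eq_zero {v : E d → ℝ} {x : E d} (hx : x ∉ tsupport v) (i j : Fin d) :
    rpd j (rpd i v) x = 0 :=
  rpd_eq_zero (fun h => hx (tsupport_fderiv_apply_subset ℝ (e i) h)) j

theorem integrable_of_eq_zero {K : Set (E d)} (hK : IsCompact K) {f : E d → ℝ}
    (hf : Continuous f) (h0 : ∀ x ∉ K, f x = 0) : Integrable f :=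
  hf.integrable_of_hasCompactSupport (HasCompactSupport.intro hK h0)

theorem integral_mul_rpd {f g : E d → ℝ} (hf : ContDiff ℝ ∞ f) (hg : ContDiff ℝ ∞ g)
    (hc : HasCompactSupport g) (i : Fin d) :
    ∫ x, f x * rpd i g x = - ∫ x, rpd i f x * g x := by
  have z : ∀ x ∉ tsupport g, g x = 0 := fun x => image_eq_zero_of_notMem_tsupport
  refine integral_mul_fderiv_eq_neg_fderiv_mul_of_integrable ?_ ?_ ?_
    (fun x _ => hf.differentiable (by simp) x) (fun x _ => hg.differentiable (by simp) x)
  · exact integrable_of_eq_zero hc ((contDiff_rpd hf i).continuous.mul hg.continuous)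
      fun x hx => by simp [z x hx]
  · exact integrable_of_eq_zero hc (hf.continuous.mul (contDiff_rpd hg i).continuous)
      fun x hx => by
        have := rpd_eq_zero hx i
        simp only [rpd] at this
        simp [this]
  · exact integrable_of_eq_zero hc (hf.continuous.mul hg.continuous) fun x hx => by simp [z x hx]

/-- The affine function whose square is the Carleman weight. -/
def shift (k : Fin d) (R : ℝ) (x : E d) : ℝ := x k + R

theorem contDiff_shift (k : Fin d) (R : ℝ) : ContDiff ℝ ∞ (shift k R) :=
  ((EuclideanSpace.proj k : E d →L[ℝ] ℝ).contDiff).add contDiff_const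

theorem rpd_shift (k : Fin d) (R : ℝ) (i : Fin d) :
    rpd i (shift k R) = fun _ => if i = k then 1 else 0 := by
  ext x
  have : HasFDerivAt (shift k R) (EuclideanSpace.proj k : E d →L[ℝ] ℝ) x :=
    ((EuclideanSpace.proj k : E d →L[ℝ] ℝ).hasFDerivAt).add_const R
  rw [rpd, this.fderiv]
  simp [e, eq_comm]

variable {w : E d → ℝ} (hw : ContDiff ℝ ∞ w) (hc : HasCompactSupport w) (k : Fin d) (R : ℝ)

theorem integral_mul_rpd_rpd (hw : ContDiff ℝ ∞ w) (hc : HasCompactSupport w) (i : Fin d) :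
    ∫ x, w x * rpd i (rpd i w) x = - ∫ x, rpd i w x ^ 2 := by
  rw [integral_mul_rpd hw (contDiff_rpd hw i) (hc.fderiv_apply (𝕜 := ℝ) (e i))]
  simp only [sq]

/-- Integration by parts in `∂_k (w²)`, as the shift has `k`-th derivative one. -/
theorem integral_shift_mul_rpd_mul (hw : ContDiff ℝ ∞ w) (hc : HasCompactSupport w) (k : Fin d)
    (R : ℝ) : ∫ x, shift k R x * (rpd k w x * w x) = - (1 / 2) * ∫ x, w x ^ 2 := by
  have hs := contDiff_shift (d := d) k R
  have h := integral_mul_rpd hs (hw.mul hw) (hc.mul_left (f' := w)) k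
  rw [rpd_shift] at h
  simp only [if_true, one_mul] at h
  have h2 : (fun x => shift k R x * rpd k (fun y => w y * w y) x) =
      fun x => 2 * (shift k R x * (rpd k w x * w x)) := by
    ext x
    rw [rpd_mul hw hw]
    ring
  rw [h2, integral_const_mul] at h
  simp only [sq]
  linarith

/-- A Rellich identity: move one `∂_i` to the other factor, commute it with `∂_k`, and apply
`integral_shift_mul_rpd_mul` to `∂_i w`. The extra term for `i = k` comes from differentiating the
shift. -/
theorem integral_shift_mul_rpd_mul_rpd_rpd (hw : ContDiff ℝ ∞ w) (hc : HasCompactSupport w)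
    (k : Fin d) (R : ℝ) (i : Fin d) : ∫ x, shift k R x * rpd k w x * rpd i (rpd i w) x =
      (1 / 2) * (∫ x, rpd i w x ^ 2) - if i = k then ∫ x, rpd k w x ^ 2 else 0 := by
  have hs := contDiff_shift (d := d) k R
  have hwi := contDiff_rpd hw i
  have hwk := contDiff_rpd hw k
  have hci : HasCompactSupport (rpd i w) := hc.fderiv_apply (𝕜 := ℝ) (e i)
  have h := integral_mul_rpd (hs.mul hwk) hwi hci i
  rw [rpd_mul hs hwk, rpd_shift] at h
  have h3 := integral_shift_mul_rpd_mul hwi hci k R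
  rw [h]
  have e1 : (fun x => (shift k R x * rpd i (rpd k w) x + (if i = k then 1 else 0) * rpd k w x) *
      rpd i w x) = fun x => shift k R x * (rpd k (rpd i w) x * rpd i w x) +
        (if i = k then rpd k w x ^ 2 else 0) := by
    ext x
    rw [rpd_comm hw i k]
    split_ifs with hik
    · subst hik
      ring
    · ring
  rw [e1, integral_add, h3]
  · split_ifs
    · ring
    · simp
  · exact integrable_of_eq_zero hc (hs.continuous.mul ((contDiff_rpd hwi k).continuous.mul
      hwi.continuous)) fun x hx => by simp [rpd_eq_zero hx]
  · split_ifs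
    · exact integrable_of_eq_zero hc (hwk.continuous.pow 2) fun x hx => by simp [rpd_eq_zero hx]
    · exact integrable_zero _ _ _

theorem integral_shift_cube_mul (hw : ContDiff ℝ ∞ w) (hc : HasCompactSupport w) (k : Fin d)
    (R : ℝ) : ∫ x, shift k R x ^ 3 * (w x * rpd k w x) =
      - (3 / 2) * ∫ x, (shift k R x) ^ 2 * w x ^ 2 := by
  have hs := contDiff_shift (d := d) k R
  have hs2 := hs.mul hs
  have h := integral_mul_rpd (hs2.mul hs) (hw.mul hw) (hc.mul_left (f' := w)) k
  rw [rpd_mul hs2 hs, rpd_mul hs hs, rpd_shift, rpd_mul hw hw] at h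
  simp only [if_true] at h
  have e1 : (fun x => shift k R x * shift k R x * shift k R x * (w x * rpd k w x + rpd k w x * w x))
      = fun x => 2 * (shift k R x ^ 3 * (w x * rpd k w x)) := by
    ext x; ring
  have e2 : (fun x => (shift k R x * shift k R x * 1 + (shift k R x * 1 + 1 * shift k R x) *
      shift k R x) * (w x * w x)) = fun x => 3 * ((shift k R x) ^ 2 * w x ^ 2) := by
    ext x; ring
  rw [e1, e2, integral_const_mul, integral_const_mul] at h
  linarith

/-- The conjugated form of the Carleman estimate. -/
theorem carleman_conjugated (hw : ContDiff ℝ ∞ w) (hc : HasCompactSupport w) (k : Fin d)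
    {R l : ℝ} (hl : 1 ≤ l) (hR : ∀ x ∈ tsupport w, 1 ≤ shift k R x) :
    l * (∑ i, ∫ x, rpd i w x ^ 2) + l ^ 3 * (∫ x, shift k R x ^ 2 * w x ^ 2) ≤
      ∫ x, (∑ i, rpd i (rpd i w) x + l ^ 2 * shift k R x ^ 2 * w x -
        2 * l * shift k R x * rpd k w x - l * w x) ^ 2 := by
  have hs := (contDiff_shift (d := d) k R).continuous
  have hw0 := hw.continuous
  have hw1 := fun i => (contDiff_rpd hw i).continuous
  have hw2 := fun i => (contDiff_rpd (contDiff_rpd hw i) i).continuous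
  have hD : Continuous fun x => ∑ i, rpd i (rpd i w) x := continuous_finsetSum _ fun i _ => hw2 i
  have z0 : ∀ x ∉ tsupport w, w x = 0 := fun x => image_eq_zero_of_notMem_tsupport
  have z1 : ∀ x ∉ tsupport w, ∀ i, rpd i w x = 0 := fun x hx i => rpd_eq_zero hx i
  have z2 : ∀ x ∉ tsupport w, ∀ i, rpd i (rpd i w) x = 0 := fun x hx i => rpd_rpd_eq_zero hx i i
  have I : ∀ {f : E d → ℝ}, Continuous f → (∀ x ∉ tsupport w, f x = 0) → Integrable f :=
    fun hf h0 => integrable_of_eq_zero hc hf h0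
  -- `A` is the symmetric and `B` the antisymmetric part of the conjugated Laplacian applied to `w`.
  -- The right side of the claim is `∫ (A + B)²`, and its positivity comes from the cross term.
  set A : E d → ℝ := fun x => ∑ i, rpd i (rpd i w) x + l ^ 2 * shift k R x ^ 2 * w x with hA
  have hAc : Continuous A := by fun_prop
  have zA : ∀ x ∉ tsupport w, A x = 0 := fun x hx => by simp [hA, z0 x hx, z2 x hx]
  set B : E d → ℝ := fun x => - 2 * l * shift k R x * rpd k w x - l * w x with hB
  have hBc : Continuous B := by fun_prop
  have zB : ∀ x ∉ tsupport w, B x = 0 := fun x hx => by simp [hB, z0 x hx, z1 x hx]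
  set S := ∫ x, shift k R x ^ 2 * w x ^ 2 with hS
  set a := ∫ x, rpd k w x ^ 2 with ha
  set T := ∑ i, ∫ x, rpd i w x ^ 2 with hT
  have ha0 : 0 ≤ a := integral_nonneg fun x => by positivity
  have hAB : ∫ x, A x * B x = 2 * l * a + 2 * l ^ 3 * S := by
    have e1 : (fun x => A x * B x) = fun x =>
        (∑ i, ((-2 * l) * (shift k R x * rpd k w x * rpd i (rpd i w) x) +
          (- l) * (w x * rpd i (rpd i w) x))) +
        ((-2 * l ^ 3) * (shift k R x ^ 3 * (w x * rpd k w x)) +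
          (- l ^ 3) * (shift k R x ^ 2 * w x ^ 2)) := by
      ext x
      rw [Finset.sum_add_distrib, ← Finset.mul_sum, ← Finset.mul_sum, ← Finset.mul_sum,
        ← Finset.mul_sum]
      simp only [hA, hB]
      ring
    have i1 : ∀ i, Integrable fun x => (-2 * l) * (shift k R x * rpd k w x * rpd i (rpd i w) x) :=
      fun i => I (continuous_const.mul ((hs.mul (hw1 k)).mul (hw2 i)))
        fun x hx => by simp [z2 x hx]
    have i2 : ∀ i, Integrable fun x => (- l) * (w x * rpd i (rpd i w) x) :=
      fun i => I (continuous_const.mul (hw0.mul (hw2 i))) fun x hx => by simp [z2 x hx]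
    have i3 : Integrable fun x => (-2 * l ^ 3) * (shift k R x ^ 3 * (w x * rpd k w x)) :=
      I (continuous_const.mul ((hs.pow 3).mul (hw0.mul (hw1 k)))) fun x hx => by simp [z0 x hx]
    have i4 : Integrable fun x => (- l ^ 3) * (shift k R x ^ 2 * w x ^ 2) :=
      I (continuous_const.mul ((hs.pow 2).mul (hw0.pow 2))) fun x hx => by simp [z0 x hx]
    -- The zero order term `-l w` of `B` cancels the gradient integrals that the Rellich identity
    -- produces, so only the nonnegative term in direction `k` survives.
    have hsum : ∀ i, ∫ x, ((-2 * l) * (shift k R x * rpd k w x * rpd i (rpd i w) x) +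
        (- l) * (w x * rpd i (rpd i w) x)) = if i = k then 2 * l * a else 0 := by
      intro i
      rw [integral_add (i1 i) (i2 i), integral_const_mul, integral_const_mul,
        integral_shift_mul_rpd_mul_rpd_rpd hw hc, integral_mul_rpd_rpd hw hc]
      split_ifs
      · ring
      · ring
    have i5 : ∀ i, Integrable fun x => (-2 * l) * (shift k R x * rpd k w x * rpd i (rpd i w) x) +
        (- l) * (w x * rpd i (rpd i w) x) := fun i => (i1 i).add (i2 i)
    have i6 : Integrable fun x => (-2 * l ^ 3) * (shift k R x ^ 3 * (w x * rpd k w x)) +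
        (- l ^ 3) * (shift k R x ^ 2 * w x ^ 2) := i3.add i4
    rw [e1, integral_add (integrable_finsetSum _ fun i _ => i5 i) i6,
      integral_finsetSum _ fun i _ => i5 i, integral_add i3 i4, integral_const_mul,
      integral_const_mul, integral_shift_cube_mul hw hc]
    simp only [hsum, Finset.sum_ite_eq', Finset.mem_univ, if_true]
    ring
  have iA : Integrable fun x => A x ^ 2 := I (hAc.pow 2) fun x hx => by simp [zA x hx]
  have iAB : Integrable fun x => A x * B x := I (hAc.mul hBc) fun x hx => by simp [zA x hx]
  have iB : Integrable fun x => B x ^ 2 := I (hBc.pow 2) fun x hx => by simp [zB x hx]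
  have iS : Integrable fun x => shift k R x ^ 2 * w x ^ 2 :=
    I ((hs.pow 2).mul (hw0.pow 2)) fun x hx => by simp [z0 x hx]
  have hP : (∫ x, A x ^ 2) + 4 * l ^ 3 * S ≤
      ∫ x, (∑ i, rpd i (rpd i w) x + l ^ 2 * shift k R x ^ 2 * w x -
        2 * l * shift k R x * rpd k w x - l * w x) ^ 2 := by
    have e1 : (fun x => (∑ i, rpd i (rpd i w) x + l ^ 2 * shift k R x ^ 2 * w x -
        2 * l * shift k R x * rpd k w x - l * w x) ^ 2) =
        fun x => (A x ^ 2 + 2 * (A x * B x)) + B x ^ 2 := by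
      ext x
      simp only [hA, hB]
      ring
    have i1 : Integrable fun x => A x ^ 2 + 2 * (A x * B x) := iA.add (iAB.const_mul 2)
    rw [e1, integral_add i1 iB, integral_add iA (iAB.const_mul 2), integral_const_mul, hAB]
    have : 0 ≤ ∫ x, B x ^ 2 := integral_nonneg fun x => by positivity
    have : 0 ≤ l * a := by positivity
    linarith
  -- The cross term does not control the full gradient. It is recovered from `l T = -l ∫ w Δw` with
  -- `Δw = A - l² s² w`, where `s` is the shift: Young's inequality costs `(1/2) ∫ A²`, and `l² w² ≤
  -- l³ s² w²` on the support.
  have hgrad : l * T ≤ 1 / 2 * (∫ x, A x ^ 2) + 3 / 2 * l ^ 3 * S := by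
    have h1 : l * T = ∫ x, ∑ i, (- l) * (w x * rpd i (rpd i w) x) := by
      rw [integral_finsetSum, hT, Finset.mul_sum]
      · refine Finset.sum_congr rfl fun i _ => ?_
        rw [integral_const_mul, integral_mul_rpd_rpd hw hc]
        ring
      · exact fun i _ => I (continuous_const.mul (hw0.mul (hw2 i))) fun x hx => by simp [z2 x hx]
    have h2 : 1 / 2 * (∫ x, A x ^ 2) + 3 / 2 * l ^ 3 * S =
        ∫ x, (1 / 2 * A x ^ 2 + 3 / 2 * l ^ 3 * (shift k R x ^ 2 * w x ^ 2)) := by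
      rw [integral_add (iA.const_mul _) (iS.const_mul _), integral_const_mul, integral_const_mul]
    rw [h1, h2]
    refine integral_mono ?_ ((iA.const_mul _).add (iS.const_mul _)) fun x => ?_
    · exact integrable_finsetSum _ fun i _ =>
        I (continuous_const.mul (hw0.mul (hw2 i))) fun x hx => by simp [z2 x hx]
    · have e2 : ∑ i, (- l) * (w x * rpd i (rpd i w) x) =
          - l * (w x * (A x - l ^ 2 * shift k R x ^ 2 * w x)) := by
        rw [← Finset.mul_sum, ← Finset.mul_sum]
        simp only [hA]
        ring
      simp only [e2]
      by_cases hx : x ∈ tsupport w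
      · have hsx := hR x hx
        have h3 : 1 ≤ l * shift k R x ^ 2 := by nlinarith
        have h4 : (l * w x) ^ 2 ≤ (l * w x) ^ 2 * (l * shift k R x ^ 2) :=
          le_mul_of_one_le_right (sq_nonneg _) h3
        have h5 := sq_nonneg (A x + l * w x)
        nlinarith
      · simp [z0 x hx, zA x hx]
  have hS0 : 0 ≤ S := integral_nonneg fun x => by positivity
  have : 0 ≤ ∫ x, A x ^ 2 := integral_nonneg fun x => by positivity
  have : 0 ≤ l ^ 3 * S := by positivity
  linarith

/-- A Carleman estimate for the Laplacian with a quadratic weight. -/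
theorem carleman {v : E d → ℝ} (hv : ContDiff ℝ ∞ v) (hc : HasCompactSupport v) (k : Fin d)
    {R l : ℝ} (hl : 1 ≤ l) (hR : ∀ x ∈ tsupport v, 1 ≤ shift k R x) :
    l ^ 3 * (∫ x, Real.exp (l * shift k R x ^ 2) * v x ^ 2) +
      l * (∑ i, ∫ x, Real.exp (l * shift k R x ^ 2) * rpd i v x ^ 2) ≤
      3 * ∫ x, Real.exp (l * shift k R x ^ 2) * (∑ i, rpd i (rpd i v) x) ^ 2 := by
  have hs := contDiff_shift (d := d) k R
  -- The square root of the weight; the conjugated unknown is `w = X v`.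
  set X : E d → ℝ := fun x => Real.exp (l / 2 * (shift k R x * shift k R x)) with hX
  have hXs : ContDiff ℝ ∞ X := (contDiff_const.mul (hs.mul hs)).exp
  have hX2 : ∀ x, Real.exp (l * shift k R x ^ 2) = X x ^ 2 := by
    intro x
    simp only [hX]
    rw [← Real.exp_nat_mul]
    congr 1
    push_cast
    ring
  have hdX : ∀ i, rpd i X = fun x => X x * (if i = k then l * shift k R x else 0) := by
    intro i
    ext x
    have hd : HasFDerivAt (fun y => l / 2 * (shift k R y * shift k R y))
        ((l / 2) • fderiv ℝ (fun y => shift k R y * shift k R y) x) x :=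
      ((hs.mul hs).differentiable (by simp) x).hasFDerivAt.const_mul (l / 2)
    have h1 : fderiv ℝ (fun y => shift k R y * shift k R y) x (e i) =
        rpd i (fun y => shift k R y * shift k R y) x := rfl
    rw [rpd, hd.exp.fderiv]
    simp only [smul_apply, smul_eq_mul, h1]
    rw [rpd_mul hs hs, rpd_shift]
    simp only [hX]
    split_ifs <;> ring
  set w : E d → ℝ := fun x => X x * v x with hw
  have hws : ContDiff ℝ ∞ w := hXs.mul hv
  have hsub : tsupport w ⊆ tsupport v := closure_mono fun x hx hx' => hx (by simp [hw, hx'])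
  have hcw : HasCompactSupport w := hc.of_isClosed_subset (isClosed_tsupport _) hsub
  have hv1 : ∀ i, ContDiff ℝ ∞ (rpd i v) := fun i => contDiff_rpd hv i
  have hw1 : ∀ i x, rpd i w x = X x * (rpd i v x + (if i = k then l * shift k R x * v x else 0)) := by
    intro i x
    simp only [hw]
    rw [rpd_mul hXs hv, hdX]
    split_ifs <;> ring
  have hw2 : ∀ i x, rpd i (rpd i w) x = X x * (rpd i (rpd i v) x +
      (if i = k then l * v x + 2 * l * shift k R x * rpd k v x +
        l ^ 2 * shift k R x ^ 2 * v x else 0)) := by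
    intro i x
    have : rpd i w = fun x => X x * (rpd i v x + (if i = k then l * shift k R x * v x else 0)) :=
      funext (hw1 i)
    rw [this]
    split_ifs with hik
    · subst hik
      have hsv : ContDiff ℝ ∞ fun x => l * shift i R x * v x := (contDiff_const.mul hs).mul hv
      rw [rpd_mul hXs ((hv1 i).add hsv), rpd_add (hv1 i) hsv, rpd_mul (contDiff_const.mul hs) hv,
        rpd_mul contDiff_const hs, rpd_shift, hdX]
      have : rpd i (fun _ : E d => l) x = 0 := by simp [rpd]
      simp only [if_true, this]
      ring
    · simp only [add_zero]
      rw [rpd_mul hXs (hv1 i), hdX]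
      simp [hik]
  have hP : ∀ x, ∑ i, rpd i (rpd i w) x + l ^ 2 * shift k R x ^ 2 * w x -
        2 * l * shift k R x * rpd k w x - l * w x = X x * ∑ i, rpd i (rpd i v) x := by
    intro x
    simp only [hw2, hw1 k, if_true]
    rw [← Finset.mul_sum, Finset.sum_add_distrib, Finset.sum_ite_eq' Finset.univ k]
    simp only [Finset.mem_univ, if_true, hw]
    ring
  have key := carleman_conjugated hws hcw k hl fun x hx => hR x (hsub hx)
  simp only [hP, mul_pow] at key
  simp only [hX2]
  have z0 : ∀ x ∉ tsupport v, v x = 0 := fun x => image_eq_zero_of_notMem_tsupport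
  have z1 : ∀ x ∉ tsupport v, ∀ i, rpd i v x = 0 := fun x hx i => rpd_eq_zero hx i
  have zw0 : ∀ x ∉ tsupport v, w x = 0 := fun x hx => by simp [hw, z0 x hx]
  have zw1 : ∀ x ∉ tsupport v, ∀ i, rpd i w x = 0 := fun x hx i => rpd_eq_zero (fun h => hx (hsub h)) i
  have I : ∀ {f : E d → ℝ}, Continuous f → (∀ x ∉ tsupport v, f x = 0) → Integrable f :=
    fun hf h0 => integrable_of_eq_zero hc hf h0
  have hXc := hXs.continuous
  have hsc := hs.continuous
  have hwc := hws.continuous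
  have hw1c := fun i => (contDiff_rpd hws i).continuous
  have iS : Integrable fun x => shift k R x ^ 2 * w x ^ 2 :=
    I ((hsc.pow 2).mul (hwc.pow 2)) fun x hx => by simp [zw0 x hx]
  have b0 : ∫ x, X x ^ 2 * v x ^ 2 ≤ ∫ x, shift k R x ^ 2 * w x ^ 2 := by
    refine integral_mono ?_ iS fun x => ?_
    · exact I ((hXc.pow 2).mul (hv.continuous.pow 2)) fun x hx => by simp [z0 x hx]
    · simp only [hw, mul_pow]
      by_cases hx : x ∈ tsupport v
      · have := hR x hx
        exact le_mul_of_one_le_left (by positivity) (by nlinarith)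
      · simp [z0 x hx]
  have b1 : ∀ i, ∫ x, X x ^ 2 * rpd i v x ^ 2 ≤ 2 * (∫ x, rpd i w x ^ 2) +
      if i = k then 2 * l ^ 2 * ∫ x, shift k R x ^ 2 * w x ^ 2 else 0 := by
    intro i
    have i1 : Integrable fun x => 2 * rpd i w x ^ 2 :=
      I (continuous_const.mul ((hw1c i).pow 2)) fun x hx => by simp [zw1 x hx]
    have i2 : Integrable fun x => if i = k then 2 * l ^ 2 * (shift k R x ^ 2 * w x ^ 2) else 0 := by
      split_ifs
      · exact iS.const_mul _
      · exact integrable_zero _ _ _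
    have e1 : 2 * (∫ x, rpd i w x ^ 2) +
        (if i = k then 2 * l ^ 2 * ∫ x, shift k R x ^ 2 * w x ^ 2 else 0) =
        ∫ x, (2 * rpd i w x ^ 2 +
          if i = k then 2 * l ^ 2 * (shift k R x ^ 2 * w x ^ 2) else 0) := by
      rw [integral_add i1 i2, integral_const_mul]
      split_ifs
      · rw [integral_const_mul]
      · simp
    rw [e1]
    refine integral_mono ?_ (i1.add i2) fun x => ?_
    · exact I ((hXc.pow 2).mul ((hv1 i).continuous.pow 2)) fun x hx => by simp [z1 x hx]
    · have hwx : w x = X x * v x := rfl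
      simp only [hw1 i x, hwx]
      split_ifs
      -- With `α = X ∂_k v` and `β = l s w` this is `α² ≤ 2 (α + β)² + 2 β²`, whose defect is `(α +
      -- 2β)²`.
      · nlinarith [sq_nonneg (X x * rpd i v x + 2 * (X x * (l * shift k R x * v x)))]
      · nlinarith [sq_nonneg (X x * rpd i v x)]
  have b2 : ∑ i, ∫ x, X x ^ 2 * rpd i v x ^ 2 ≤ 2 * (∑ i, ∫ x, rpd i w x ^ 2) +
      2 * l ^ 2 * ∫ x, shift k R x ^ 2 * w x ^ 2 := by
    refine (Finset.sum_le_sum fun i _ => b1 i).trans ?_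
    rw [Finset.sum_add_distrib, ← Finset.mul_sum, Finset.sum_ite_eq' Finset.univ k]
    simp
  have hl0 : 0 < l := by linarith
  have c0 := mul_le_mul_of_nonneg_left b0 (by positivity : 0 ≤ l ^ 3)
  have c1 := mul_le_mul_of_nonneg_left b2 hl0.le
  have hT0 : 0 ≤ l * ∑ i, ∫ x, rpd i w x ^ 2 :=
    mul_nonneg hl0.le (Finset.sum_nonneg fun i _ => integral_nonneg fun x => by positivity)
  -- The left side is at most `2 l T + 3 l³ S`, with `T` the gradient integrals and `S` the weighted
  -- integral for `w`; this is where the factor `3` comes from.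
  nlinarith

end Carleman

/-! ### The Carleman estimate for Sobolev functions with zero Cauchy data -/

section CarlemanWeak

variable {d : ℕ}

theorem norm_sq_eq_integral {Ω : Set (E d)} (u : L2 Ω) : ‖u‖ ^ 2 = ∫ x in Ω, ‖u x‖ ^ 2 := by
  rw [← real_inner_self_eq_norm_sq, L2.inner_def]
  simp only [real_inner_self_eq_norm_sq]

theorem norm_toLp_sq_eq_integral {μ : Measure (E d)} {f : E d → ℂ} (hf : MemLp f 2 μ) :
    ‖hf.toLp‖ ^ 2 = ∫ x, ‖f x‖ ^ 2 ∂μ := by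
  rw [← real_inner_self_eq_norm_sq, L2.inner_def]
  refine integral_congr_ae ?_
  filter_upwards [hf.coeFn_toLp] with x hx
  rw [hx, real_inner_self_eq_norm_sq]

theorem tendsto_integral_norm_sq {μ : Measure (E d)} {f : ℕ → E d → ℂ} {g : E d → ℂ}
    (hf : ∀ n, MemLp (f n) 2 μ) (hg : MemLp g 2 μ)
    (h : Tendsto (fun n => eLpNorm (fun x => f n x - g x) 2 μ) atTop (𝓝 0)) :
    Tendsto (fun n => ∫ x, ‖f n x‖ ^ 2 ∂μ) atTop (𝓝 (∫ x, ‖g x‖ ^ 2 ∂μ)) := by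
  have h1 : Tendsto (fun n => (hf n).toLp) atTop (𝓝 hg.toLp) :=
    (Lp.tendsto_Lp_iff_tendsto_eLpNorm'' f hf g hg).2 h
  simpa only [norm_toLp_sq_eq_integral] using h1.norm.pow 2

/-- All functions vanish off the compact set `K`, where the weight is bounded, so multiplying by it
preserves `L²` convergence. -/
theorem tendsto_integral_weight_mul_norm_sq {K : Set (E d)} (hK : IsCompact K) {h : E d → ℝ}
    (hh : Continuous h) {f : ℕ → E d → ℂ} {g : E d → ℂ} (hf : ∀ n, MemLp (f n) 2)
    (hg : MemLp g 2) (hf0 : ∀ n, ∀ x ∉ K, f n x = 0) (hg0 : ∀ x ∉ K, g x = 0)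
    (hfg : Tendsto (fun n => eLpNorm (fun x => f n x - g x) 2) atTop (𝓝 0)) :
    Tendsto (fun n => ∫ x, h x ^ 2 * ‖f n x‖ ^ 2) atTop (𝓝 (∫ x, h x ^ 2 * ‖g x‖ ^ 2)) := by
  obtain ⟨M, hM⟩ := hK.exists_bound_of_continuousOn hh.continuousOn
  have hb : ∀ {k : E d → ℂ}, (∀ x ∉ K, k x = 0) → ∀ x, ‖h x • k x‖ ≤ M * ‖k x‖ := by
    intro k hk x
    by_cases hx : x ∈ K
    · rw [norm_smul]
      exact mul_le_mul_of_nonneg_right (hM x hx) (norm_nonneg _)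
    · simp [hk x hx]
  have hm : ∀ {k : E d → ℂ}, MemLp k 2 → (∀ x ∉ K, k x = 0) → MemLp (fun x => h x • k x) 2 :=
    fun hk hk0 => hk.of_le_mul (hh.aestronglyMeasurable.smul hk.1) (.of_forall (hb hk0))
  have h1 := tendsto_integral_norm_sq (fun n => hm (hf n) (hf0 n)) (hm hg hg0) (by
    have hle : ∀ n, eLpNorm (fun x => h x • f n x - h x • g x) 2 ≤
        ENNReal.ofReal M * eLpNorm (fun x => f n x - g x) 2 := fun n =>
      eLpNorm_le_mul_eLpNorm_of_ae_le_mul (.of_forall fun x => by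
        rw [← smul_sub]
        exact hb (k := fun x => f n x - g x) (fun x hx => by simp [hf0 n x hx, hg0 x hx]) x) 2
    refine tendsto_of_tendsto_of_tendsto_of_le_of_le tendsto_const_nhds ?_ (fun _ => zero_le) hle
    simpa using ENNReal.Tendsto.const_mul (a := ENNReal.ofReal M) hfg
      (Or.inr ENNReal.ofReal_ne_top))
  simpa only [norm_smul, mul_pow, Real.norm_eq_abs, sq_abs] using h1

theorem rpd_clm_comp {v : E d → ℂ} (hv : ContDiff ℝ ∞ v) (L : ℂ →L[ℝ] ℝ) (i : Fin d) :
    rpd i (fun x => L (v x)) = fun x => L (pd i v x) := by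
  ext x
  have := (L.hasFDerivAt.comp x (hv.differentiable (by simp) x).hasFDerivAt).fderiv
  rw [rpd]
  change fderiv ℝ (L ∘ v) x (e i) = _
  rw [this]
  rfl

/-- The operators and the weight are real, so the real estimate is added for real and imaginary
parts. -/
theorem carleman_complex {v : E d → ℂ} (hv : ContDiff ℝ ∞ v) (hc : HasCompactSupport v)
    (k : Fin d) {R l : ℝ} (hl : 1 ≤ l) (hR : ∀ x ∈ tsupport v, 1 ≤ shift k R x) :
    l ^ 3 * (∫ x, Real.exp (l * shift k R x ^ 2) * ‖v x‖ ^ 2) +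
      l * (∑ i, ∫ x, Real.exp (l * shift k R x ^ 2) * ‖pd i v x‖ ^ 2) ≤
      3 * ∫ x, Real.exp (l * shift k R x ^ 2) * ‖∑ i, pd i (pd i v) x‖ ^ 2 := by
  have key : ∀ L : ℂ →L[ℝ] ℝ, l ^ 3 * (∫ x, Real.exp (l * shift k R x ^ 2) * L (v x) ^ 2) +
      l * (∑ i, ∫ x, Real.exp (l * shift k R x ^ 2) * L (pd i v x) ^ 2) ≤
      3 * ∫ x, Real.exp (l * shift k R x ^ 2) * L (∑ i, pd i (pd i v) x) ^ 2 := by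
    intro L
    have hsub : tsupport (fun x => L (v x)) ⊆ tsupport v :=
      closure_mono fun x hx hx' => hx (by simp [hx'])
    have := carleman (L.contDiff.comp hv) (hc.of_isClosed_subset (isClosed_tsupport _) hsub) k hl
      fun x hx => hR x (hsub hx)
    simp only [Function.comp_def, rpd_clm_comp hv, rpd_clm_comp (contDiff_pd hv _),
      ← map_sum] at this
    exact this
  have hW : Continuous fun x => Real.exp (l * shift k R x ^ 2) :=
    Real.continuous_exp.comp (continuous_const.mul ((contDiff_shift k R).continuous.pow 2))
  have hsplit : ∀ {f : E d → ℂ}, Continuous f → HasCompactSupport f →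
      ∫ x, Real.exp (l * shift k R x ^ 2) * ‖f x‖ ^ 2 =
      (∫ x, Real.exp (l * shift k R x ^ 2) * Complex.reCLM (f x) ^ 2) +
      ∫ x, Real.exp (l * shift k R x ^ 2) * Complex.imCLM (f x) ^ 2 := by
    intro f hf hfc
    have hI : ∀ L : ℂ →L[ℝ] ℝ,
        Integrable fun x => Real.exp (l * shift k R x ^ 2) * L (f x) ^ 2 := fun L =>
      integrable_of_eq_zero hfc (hW.mul ((L.continuous.comp hf).pow 2)) fun x hx => by
        simp [image_eq_zero_of_notMem_tsupport hx]
    rw [← integral_add (hI _) (hI _)]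
    refine integral_congr_ae (.of_forall fun x => ?_)
    simp only [Complex.reCLM_apply, Complex.imCLM_apply]
    rw [← Complex.normSq_eq_norm_sq, Complex.normSq_apply]
    ring
  have hd : HasCompactSupport fun x => ∑ i, pd i (pd i v) x := by
    refine HasCompactSupport.intro hc fun x hx => Finset.sum_eq_zero fun i _ => ?_
    exact image_eq_zero_of_notMem_tsupport fun h =>
      hx (tsupport_pd_subset v i (tsupport_pd_subset _ i h))
  have hdc : Continuous fun x => ∑ i, pd i (pd i v) x :=
    continuous_finsetSum _ fun i _ => (contDiff_pd (contDiff_pd hv i) i).continuous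
  rw [hsplit hv.continuous hc, hsplit hdc hd]
  simp only [fun i => hsplit (contDiff_pd hv i).continuous (hasCompactSupport_pd hc i),
    Finset.sum_add_distrib]
  have h1 := key Complex.reCLM
  have h2 := key Complex.imCLM
  linarith

variable {Ω : Set (E d)} {ν : E d → E d} {u : L2 Ω}

theorem mollify_indicator (hΩ : IsOpen Ω) (η : E d → ℝ) (u : L2 Ω) (x : E d) :
    mollify η (Ω.indicator u) x = ∫ t in Ω, η (x - t) • u t := by
  rw [mollify, ← integral_indicator hΩ.measurableSet]
  congr 1
  ext t
  simp only [indicator]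
  split_ifs <;> simp

theorem memLp_indicator (hΩ : IsOpen Ω) (u : L2 Ω) : MemLp (Ω.indicator u) 2 :=
  (memLp_indicator_iff_restrict hΩ.measurableSet).2 (Lp.memLp u)

theorem fderiv_comp_const_sub {f : E d → ℝ} (hf : ContDiff ℝ ∞ f) (x t : E d) (i : Fin d) :
    fderiv ℝ (fun t => f (x - t)) t (e i) = - fderiv ℝ f (x - t) (e i) := by
  have h1 : HasFDerivAt (fun t : E d => x - t) (-ContinuousLinearMap.id ℝ (E d)) t :=
    (hasFDerivAt_id t).const_sub x
  have := ((hf.differentiable (by simp) (x - t)).hasFDerivAt.comp t h1).fderiv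
  change fderiv ℝ (f ∘ fun t => x - t) t (e i) = _
  rw [this]
  simp

/-- The Carleman estimate for functions with vanishing Cauchy data. -/
theorem carleman_weak (hd : 1 ≤ d) (hΩ : IsOpen Ω) {r : ℝ} (hr : Ω ⊆ Metric.closedBall 0 r)
    (hΩs : HasSmoothBoundary Ω) (hν : ∀ p ∈ frontier Ω, IsOuterUnitNormal Ω p (ν p))
    (hu0 : HasTrace Ω u 0) (hu : HasNormalTrace Ω ν u 0) (k : Fin d) {l : ℝ} (hl : 1 ≤ l) :
    l ^ 3 * (∫ x in Ω, Real.exp (l * shift k (r + 2) x ^ 2) * ‖u x‖ ^ 2) +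
      l * (∑ i, ∫ x in Ω, Real.exp (l * shift k (r + 2) x ^ 2) * ‖weakPartial Ω i u x‖ ^ 2) ≤
      3 * ∫ x in Ω, Real.exp (l * shift k (r + 2) x ^ 2) * ‖weakLaplacian Ω u x‖ ^ 2 := by
  have hΩb : Bornology.IsBounded Ω := Metric.isBounded_closedBall.subset hr
  obtain ⟨η, hη, hηs, hηl⟩ := exists_mollifiers d
  have hηc : ∀ n, HasCompactSupport (η n) := fun n =>
    HasCompactSupport.of_support_subset_isCompact (isCompact_closedBall 0 1)
      ((hηs n).trans Metric.ball_subset_closedBall)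
  have hη1 : ∀ n i, ContDiff ℝ ∞ fun x => fderiv ℝ (η n) x (e i) := fun n i =>
    ((hη n).fderiv_right (m := ∞) (by simp)).clm_apply contDiff_const
  have hf : ∀ w : L2 Ω, LocallyIntegrable (Ω.indicator w) := fun w =>
    (memLp_indicator hΩ w).locallyIntegrable (by norm_num)
  set v : ℕ → E d → ℂ := fun n => mollify (η n) (Ω.indicator u) with hv
  have hvs : ∀ n, ContDiff ℝ ∞ (v n) := fun n => contDiff_mollify (hη n) (hηc n) (hf u)
  have hφ : ∀ n x, ContDiff ℝ ∞ fun t => η n (x - t) := fun n x =>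
    (hη n).comp (contDiff_const.sub contDiff_id)
  -- Derivatives commute with mollification of the zero extension. The test function `η (x - ·)`
  -- need not be supported in `Ω`, so the zero trace of `u` is essential; for the Laplacian below,
  -- the zero normal trace is needed as well.
  have hv1 : ∀ n i, pd i (v n) = mollify (η n) (Ω.indicator (weakPartial Ω i u)) := by
    intro n i
    rw [hv]
    simp only
    rw [pd_mollify (hη n) (hηc n) (hf u)]
    ext x
    rw [mollify_indicator hΩ, mollify_indicator hΩ]
    have := integral_pd_smul_eq_of_hasTrace_zero hd hΩ hΩb hΩs hν hu0 (hφ n x) i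
    simp only [fderiv_comp_const_sub (hη n), neg_smul, integral_neg] at this
    exact neg_injective this
  have hv2 : ∀ n x, ∑ i, pd i (pd i (v n)) x =
      mollify (η n) (Ω.indicator (weakLaplacian Ω u)) x := by
    intro n x
    have h1 : ∀ i, pd i (pd i (v n)) =
        mollify (fun x => fderiv ℝ (fun y => fderiv ℝ (η n) y (e i)) x (e i)) (Ω.indicator u) := by
      intro i
      rw [hv]
      simp only
      rw [pd_mollify (hη n) (hηc n) (hf u),
        pd_mollify (hη1 n i) ((hηc n).fderiv_apply (𝕜 := ℝ) (e i)) (hf u)]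
    have := integral_laplacian_smul_eq hd hΩ hΩb hΩs hν hu0 hu (hφ n x)
    rw [mollify_indicator hΩ, ← this]
    refine Finset.sum_congr rfl fun i _ => ?_
    rw [h1, mollify_indicator hΩ]
    have h2 : ∀ t, fderiv ℝ (fun y => fderiv ℝ (fun t => η n (x - t)) y (e i)) t (e i) =
        fderiv ℝ (fun y => fderiv ℝ (η n) y (e i)) (x - t) (e i) := by
      intro t
      have : (fun y => fderiv ℝ (fun t => η n (x - t)) y (e i)) =
          fun y => - (fun z => fderiv ℝ (η n) z (e i)) (x - y) :=
        funext fun y => fderiv_comp_const_sub (hη n) x y i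
      rw [this, fderiv_fun_neg, neg_apply, fderiv_comp_const_sub (hη1 n i), neg_neg]
    simp only [h2]
  -- The kernels live in the unit ball, so all mollifications are supported in radius `r + 1`; the
  -- shift by `r + 2` then keeps the affine function at least `1` there.
  set K : Set (E d) := Metric.closedBall 0 (r + 1) with hK
  have hKc : IsCompact K := isCompact_closedBall _ _
  have hKz : ∀ n (w : L2 Ω), ∀ x ∉ K, mollify (η n) (Ω.indicator w) x = 0 := by
    intro n w x hx
    rw [mollify_indicator hΩ]
    refine setIntegral_eq_zero_of_forall_eq_zero fun t ht => ?_
    have : η n (x - t) = 0 := by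
      by_contra hne
      have h1 := hηs n hne
      have h2 := hr ht
      rw [mem_ball_zero_iff] at h1
      rw [mem_closedBall_zero_iff] at h2
      refine hx (mem_closedBall_zero_iff.2 ?_)
      have := norm_add_le (x - t) t
      rw [sub_add_cancel] at this
      linarith
    rw [this, zero_smul]
  have hKi : ∀ w : L2 Ω, ∀ x ∉ K, Ω.indicator w x = 0 := fun w x hx =>
    indicator_of_notMem (fun h => hx (Metric.closedBall_subset_closedBall (by linarith) (hr h))) _
  have hvK : ∀ n, tsupport (v n) ⊆ K := fun n =>
    closure_minimal (fun x hx => by_contra fun h => hx (hKz n u x h)) Metric.isClosed_closedBall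
  have hvc : ∀ n, HasCompactSupport (v n) := fun n =>
    hKc.of_isClosed_subset (isClosed_tsupport _) (hvK n)
  have hshift : ∀ x ∈ K, 1 ≤ shift k (r + 2) x := by
    intro x hx
    have h1 := (PiLp.norm_apply_le x k).trans (mem_closedBall_zero_iff.1 hx)
    have := (abs_le.1 h1).1
    simp only [shift]
    linarith
  set h : E d → ℝ := fun x => Real.exp (l / 2 * shift k (r + 2) x ^ 2) with hh
  have hhc : Continuous h :=
    Real.continuous_exp.comp (continuous_const.mul ((contDiff_shift k (r + 2)).continuous.pow 2))
  have hsq : ∀ x, Real.exp (l * shift k (r + 2) x ^ 2) = h x ^ 2 := by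
    intro x
    simp only [hh]
    rw [← Real.exp_nat_mul]
    congr 1
    push_cast
    ring
  have hmc : ∀ n (w : L2 Ω), MemLp (mollify (η n) (Ω.indicator w)) 2 := fun n w =>
    (contDiff_mollify (hη n) (hηc n) (hf w)).continuous.memLp_of_hasCompactSupport
      (HasCompactSupport.intro hKc (hKz n w))
  have hlim : ∀ w : L2 Ω, Tendsto (fun n => ∫ x, h x ^ 2 *
      ‖mollify (η n) (Ω.indicator w) x‖ ^ 2) atTop (𝓝 (∫ x in Ω, h x ^ 2 * ‖w x‖ ^ 2)) := by
    intro w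
    have h1 := tendsto_integral_weight_mul_norm_sq hKc hhc (fun n => hmc n w)
      (memLp_indicator hΩ w) (fun n => hKz n w) (hKi w)
      (hηl _ (memLp_indicator hΩ w) ((Lp.stronglyMeasurable w).measurable.indicator
        hΩ.measurableSet))
    have h2 : ∫ x, h x ^ 2 * ‖Ω.indicator w x‖ ^ 2 = ∫ x in Ω, h x ^ 2 * ‖w x‖ ^ 2 := by
      rw [← integral_indicator hΩ.measurableSet]
      congr 1
      ext x
      simp only [indicator]
      split_ifs <;> simp
    rwa [h2] at h1
  simp only [hsq]
  refine le_of_tendsto_of_tendsto' (((hlim u).const_mul (l ^ 3)).add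
    ((tendsto_finsetSum Finset.univ fun i _ => hlim (weakPartial Ω i u)).const_mul l))
    ((hlim (weakLaplacian Ω u)).const_mul 3) fun n => ?_
  have := carleman_complex (hvs n) (hvc n) k hl fun x hx => hshift x (hvK n hx)
  simp only [hv1 n, hsq] at this
  simp only [← hv1 n, hv2 n] at this
  simpa only [hv1 n] using this

end CarlemanWeak

/-! ### The coefficients -/

theorem contDiff_phi (a b : ℝ) (n : ℕ) : ContDiff ℝ ∞ (phi a b n) := by
  unfold phi
  fun_prop

theorem contDiff_psiOrth (a b : ℝ) (n : ℕ) : ContDiff ℝ ∞ (psiOrth a b n) := by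
  induction n using Nat.strong_induction_on with
  | _ n ih =>
    have : psiOrth a b n = fun θ => phi a b n θ - ∑ j : Fin n,
        ((∫ t in a..b, phi a b n t * psiOrth a b j t) / ∫ t in a..b, psiOrth a b j t ^ 2) *
          psiOrth a b j θ := by
      funext θ
      rw [psiOrth]
    rw [this]
    exact (contDiff_phi a b n).sub (ContDiff.sum fun j _ => contDiff_const.mul (ih j j.2))

theorem contDiff_Psi (a b : ℝ) (n : ℕ) : ContDiff ℝ ∞ (Psi a b n) := by
  unfold Psi
  exact (contDiff_psiOrth a b n).div_const _

theorem continuous_Psi (a b : ℝ) (n : ℕ) : Continuous (Psi a b n) := (contDiff_Psi a b n).continuous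

theorem continuous_deriv_Psi (a b : ℝ) (n : ℕ) : Continuous (deriv (Psi a b n)) :=
  (contDiff_Psi a b n).continuous_deriv (by simp)

section Coefficients

variable {d : ℕ} {Ω U : Set (E d)} {a b : ℝ}

/-- `q` is continuous on `Ω̄ × [a, b]` and has a continuous derivative in the angle. -/
def IsC1Angle (Ω : Set (E d)) (a b : ℝ) (q : E d → ℝ → ℂ) : Prop :=
  ContinuousOn (fun p : E d × ℝ => q p.1 p.2) (closure Ω ×ˢ Icc a b) ∧
  ∃ D : E d × ℝ → ℂ, ContinuousOn D (closure Ω ×ˢ Icc a b) ∧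
    ∀ x ∈ closure Ω, ∀ θ ∈ Ioo a b, HasDerivAt (q x) (D (x, θ)) θ

/-- `c` is a bounded measurable function on `Ω`. -/
def IsBoundedCoeff (Ω : Set (E d)) (c : E d → ℂ) : Prop :=
  AEStronglyMeasurable c (volume.restrict Ω) ∧ ∃ M, ∀ x ∈ Ω, ‖c x‖ ≤ M

theorem IsBoundedCoeff.add {c c' : E d → ℂ} (h : IsBoundedCoeff Ω c) (h' : IsBoundedCoeff Ω c') :
    IsBoundedCoeff Ω (fun x => c x + c' x) := by
  obtain ⟨h1, M, hM⟩ := h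
  obtain ⟨h1', M', hM'⟩ := h'
  exact ⟨h1.add h1', M + M', fun x hx => (norm_add_le _ _).trans (add_le_add (hM x hx) (hM' x hx))⟩

theorem IsBoundedCoeff.const_mul {c : E d → ℂ} (z : ℂ) (h : IsBoundedCoeff Ω c) :
    IsBoundedCoeff Ω (fun x => z * c x) := by
  obtain ⟨h1, M, hM⟩ := h
  refine ⟨h1.const_mul z, ‖z‖ * M, fun x hx => ?_⟩
  rw [norm_mul]
  exact mul_le_mul_of_nonneg_left (hM x hx) (norm_nonneg _)

theorem IsBoundedCoeff.sum {ι : Type*} (s : Finset ι) {c : ι → E d → ℂ}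
    (h : ∀ i, IsBoundedCoeff Ω (c i)) : IsBoundedCoeff Ω (fun x => ∑ i ∈ s, c i x) := by
  classical
  induction s using Finset.induction_on with
  | empty => exact ⟨by simpa using aestronglyMeasurable_const, 0, by simp⟩
  | insert i s hi ih => simpa only [Finset.sum_insert hi] using (h i).add ih

theorem IsBoundedCoeff.congr {c c' : E d → ℂ} (hΩ : IsOpen Ω) (h : IsBoundedCoeff Ω c)
    (hc : ∀ x ∈ Ω, c' x = c x) : IsBoundedCoeff Ω c' := by
  obtain ⟨h1, M, hM⟩ := h
  refine ⟨h1.congr ?_, M, fun x hx => by rw [hc x hx]; exact hM x hx⟩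
  exact (ae_restrict_iff' hΩ.measurableSet).2 (.of_forall fun x hx => (hc x hx).symm)

/-- Composing with `projIcc` extends the integrand continuously to all angles, so the parametric
integral is continuous on the compact closure of `Ω`. -/
theorem isBoundedCoeff_integral (hΩ : IsOpen Ω) (hΩb : Bornology.IsBounded Ω) (hab : a ≤ b)
    {G : E d × ℝ → ℂ} (hG : ContinuousOn G (closure Ω ×ˢ Icc a b)) :
    IsBoundedCoeff Ω (fun x => ∫ θ in a..b, G (x, θ)) := by
  have hF : Continuous fun p : closure Ω × ℝ => G (p.1, (projIcc a b hab p.2 : ℝ)) := by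
    refine hG.comp_continuous ?_ fun p => ⟨p.1.2, (projIcc a b hab p.2).2⟩
    exact (continuous_subtype_val.comp continuous_fst).prodMk
      (continuous_subtype_val.comp (continuous_projIcc.comp continuous_snd))
  have h1 : Continuous fun x : closure Ω => ∫ θ in a..b, G (x, (projIcc a b hab θ : ℝ)) :=
    intervalIntegral.continuous_parametric_intervalIntegral_of_continuous'
      (f := fun (x : closure Ω) θ => G (x, (projIcc a b hab θ : ℝ))) hF a b
  have h2 : ∀ x : E d, ∫ θ in a..b, G (x, (projIcc a b hab θ : ℝ)) = ∫ θ in a..b, G (x, θ) := by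
    intro x
    refine intervalIntegral.integral_congr fun θ hθ => ?_
    rw [uIcc_of_le hab] at hθ
    simp only [projIcc_of_mem hab hθ]
  have h3 : ContinuousOn (fun x => ∫ θ in a..b, G (x, θ)) (closure Ω) := by
    rw [continuousOn_iff_continuous_domRestrict]
    refine h1.congr fun x => h2 x
  obtain ⟨M, hM⟩ := hΩb.isCompact_closure.exists_bound_of_continuousOn h3
  exact ⟨(h3.mono subset_closure).aestronglyMeasurable hΩ.measurableSet,
    M, fun x hx => hM x (subset_closure hx)⟩

/-- The term `c` may be merely measurable because it does not depend on the angle: it drops out of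
the derivative and leaves the remaining integral as a factor. -/
theorem IsC1Angle.isBoundedCoeff (hΩ : IsOpen Ω) (hΩb : Bornology.IsBounded Ω) (hab : a ≤ b)
    {q : E d → ℝ → ℂ} (hq : IsC1Angle Ω a b q) {c : E d → ℂ} (hc : IsBoundedCoeff Ω c)
    {f g h : ℝ → ℝ} (hf : Continuous f) (hg : Continuous g) (hh : Continuous h) :
    IsBoundedCoeff Ω (fun x => ∫ θ in a..b, (deriv (fun t => q x t + c x) θ * (f θ : ℂ) +
      (q x θ + c x) * (g θ : ℂ)) * (h θ : ℂ)) := by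
  obtain ⟨hq0, D, hD, hder⟩ := hq
  have hfc : ContinuousOn (fun p : E d × ℝ => (f p.2 : ℂ)) (closure Ω ×ˢ Icc a b) :=
    (Complex.continuous_ofReal.comp (hf.comp continuous_snd)).continuousOn
  have hgc : ContinuousOn (fun p : E d × ℝ => (g p.2 : ℂ)) (closure Ω ×ˢ Icc a b) :=
    (Complex.continuous_ofReal.comp (hg.comp continuous_snd)).continuousOn
  have hhc : ContinuousOn (fun p : E d × ℝ => (h p.2 : ℂ)) (closure Ω ×ˢ Icc a b) :=
    (Complex.continuous_ofReal.comp (hh.comp continuous_snd)).continuousOn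
  have hG : ContinuousOn (fun p : E d × ℝ => (D p * (f p.2 : ℂ) + q p.1 p.2 * (g p.2 : ℂ)) *
      (h p.2 : ℂ)) (closure Ω ×ˢ Icc a b) := ((hD.mul hfc).add (hq0.mul hgc)).mul hhc
  have h1 := isBoundedCoeff_integral hΩ hΩb hab hG
  have h2 := hc.const_mul (∫ θ in a..b, ((g θ : ℂ) * (h θ : ℂ)))
  refine (h1.add h2).congr hΩ fun x hx => ?_
  have hx' := subset_closure hx
  have hslice : ContinuousOn (fun θ : ℝ => (D (x, θ) * (f θ : ℂ) + q x θ * (g θ : ℂ)) *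
      (h θ : ℂ)) (uIcc a b) := by
    rw [uIcc_of_le hab]
    exact hG.comp (continuousOn_const.prodMk continuousOn_id) fun θ hθ => ⟨hx', hθ⟩
  have hgh : Continuous fun θ : ℝ => (g θ : ℂ) * (h θ : ℂ) :=
    (Complex.continuous_ofReal.comp hg).mul (Complex.continuous_ofReal.comp hh)
  have e1 := intervalIntegral.integral_add (μ := volume) hslice.intervalIntegrable
    ((hgh.mul (continuous_const (y := c x))).intervalIntegrable a b)
  rw [← intervalIntegral.integral_mul_const]
  refine Eq.trans ?_ e1
  refine intervalIntegral.integral_congr_ae ?_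
  -- At the endpoints `deriv` is two-sided and may ignore the data on `[a, b]`; they form a null
  -- set. The left one is already excluded by the half-open interval of integration.
  have hb : ∀ᵐ θ : ℝ, θ ≠ b := by simp [ae_iff, measure_singleton]
  filter_upwards [hb] with θ hθb hθ
  rw [uIoc_of_le hab] at hθ
  have hθ' : θ ∈ Ioo a b := ⟨hθ.1, lt_of_le_of_ne hθ.2 hθb⟩
  rw [((hder x hx' θ hθ').add_const (c x)).deriv, Pi.mul_apply]
  ring

/-! ### Regularity of the incident wave -/

theorem uniqueDiffOn_prod_Icc (hU : IsOpen U) (hab : a < b) : UniqueDiffOn ℝ (U ×ˢ Icc a b) :=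
  hU.uniqueDiffOn.prod (uniqueDiffOn_Icc hab)

/-- The regularity is joint on `U × [a, b]`, where up to the end angles only derivatives within the
set are meaningful. In the open variable they agree with classical ones. -/
theorem pd_slice {F : E d × ℝ → ℂ} (hU : IsOpen U)
    (hF : DifferentiableOn ℝ F (U ×ˢ Icc a b)) {x : E d} (hx : x ∈ U) {θ : ℝ} (hθ : θ ∈ Icc a b)
    (i : Fin d) :
    pd i (fun y => F (y, θ)) x = fderivWithin ℝ F (U ×ˢ Icc a b) (x, θ) (e i, 0) := by
  have h1 := (hF (x, θ) ⟨hx, hθ⟩).hasFDerivWithinAt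
  have h2 : HasFDerivWithinAt (fun y : E d => (y, θ)) (ContinuousLinearMap.inl ℝ (E d) ℝ) U x :=
    (hasFDerivAt_prodMk_left x θ).hasFDerivWithinAt
  have hm : MapsTo (fun y : E d => (y, θ)) U (U ×ˢ Icc a b) := fun y hy => ⟨hy, hθ⟩
  have h3 := (h1.comp x h2 hm).hasFDerivAt (hU.mem_nhds hx)
  rw [pd]
  change fderiv ℝ (F ∘ fun y => (y, θ)) x (e i) = _
  rw [h3.fderiv]
  simp

theorem hasDerivAt_slice {F : E d × ℝ → ℂ} (hU : IsOpen U)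
    (hF : DifferentiableOn ℝ F (U ×ˢ Icc a b)) {x : E d} (hx : x ∈ U) {θ : ℝ} (hθ : θ ∈ Ioo a b) :
    HasDerivAt (fun t => F (x, t)) (fderivWithin ℝ F (U ×ˢ Icc a b) (x, θ) (0, 1)) θ := by
  have hn : U ×ˢ Icc a b ∈ 𝓝 (x, θ) :=
    prod_mem_nhds (hU.mem_nhds hx) (Icc_mem_nhds hθ.1 hθ.2)
  have h1 := (hF (x, θ) ⟨hx, Ioo_subset_Icc_self hθ⟩).hasFDerivWithinAt.hasFDerivAt hn
  have h2 : HasDerivAt (fun t : ℝ => (x, t)) ((0 : E d), (1 : ℝ)) θ :=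
    (hasDerivAt_const θ x).prodMk (hasDerivAt_id θ)
  exact h1.comp_hasDerivAt θ h2

theorem isC1Angle_div (hU : IsOpen U) (hΩU : closure Ω ⊆ U) (hab : a < b) {G F : E d × ℝ → ℂ}
    (hG : ContDiffOn ℝ 1 G (U ×ˢ Icc a b)) (hF : ContDiffOn ℝ 1 F (U ×ˢ Icc a b))
    (hF0 : ∀ x ∈ closure Ω, ∀ θ ∈ Icc a b, F (x, θ) ≠ 0) {q : E d → ℝ → ℂ}
    (hq : ∀ x ∈ closure Ω, ∀ θ ∈ Icc a b, q x θ = G (x, θ) / F (x, θ)) : IsC1Angle Ω a b q := by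
  have hu := uniqueDiffOn_prod_Icc (d := d) hU hab
  have hsub : closure Ω ×ˢ Icc a b ⊆ U ×ˢ Icc a b := prod_mono hΩU le_rfl
  have hGc := hG.continuousOn.mono hsub
  have hFc := hF.continuousOn.mono hsub
  have hG' : ContinuousOn (fun p => fderivWithin ℝ G (U ×ˢ Icc a b) p (0, 1))
      (closure Ω ×ˢ Icc a b) :=
    ((hG.continuousOn_fderivWithin hu le_rfl).clm_apply continuousOn_const).mono hsub
  have hF' : ContinuousOn (fun p => fderivWithin ℝ F (U ×ˢ Icc a b) p (0, 1))
      (closure Ω ×ˢ Icc a b) :=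
    ((hF.continuousOn_fderivWithin hu le_rfl).clm_apply continuousOn_const).mono hsub
  have hne : ∀ p ∈ closure Ω ×ˢ Icc a b, F p ≠ 0 := fun p hp => hF0 p.1 hp.1 p.2 hp.2
  refine ⟨(hGc.div hFc hne).congr fun p hp => hq p.1 hp.1 p.2 hp.2,
    fun p => (fderivWithin ℝ G (U ×ˢ Icc a b) p (0, 1) * F p -
      G p * fderivWithin ℝ F (U ×ˢ Icc a b) p (0, 1)) / F p ^ 2,
    ((hG'.mul hFc).sub (hGc.mul hF')).div (hFc.pow 2) fun p hp => pow_ne_zero 2 (hne p hp),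
    fun x hx θ hθ => ?_⟩
  have h1 := (hasDerivAt_slice hU (hG.differentiableOn one_ne_zero) (hΩU hx) hθ).div
    (hasDerivAt_slice hU (hF.differentiableOn one_ne_zero) (hΩU hx) hθ)
    (hF0 x hx θ (Ioo_subset_Icc_self hθ))
  refine h1.congr_of_eventuallyEq ?_
  filter_upwards [Ioo_mem_nhds hθ.1 hθ.2] with t ht
  exact hq x hx t (Ioo_subset_Icc_self ht)

theorem laplacian_eq_sum_pd {f : E d → ℂ} {x : E d} (hf : ContDiffAt ℝ 2 f x) :
    (Δ f) x = ∑ i, pd i (pd i f) x := by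
  rw [InnerProductSpace.laplacian_eq_iteratedFDeriv_orthonormalBasis f
    (EuclideanSpace.basisFun (Fin d) ℝ)]
  refine Finset.sum_congr rfl fun i _ => ?_
  rw [iteratedFDeriv_two_apply]
  have hd : DifferentiableAt ℝ (fderiv ℝ f) x :=
    (hf.fderiv_right (m := 1) (by norm_num)).differentiableAt (by norm_num)
  have := (hd.hasFDerivAt.clm_apply (hasFDerivAt_const (e i : E d) x)).fderiv
  change _ = fderiv ℝ (fun y => fderiv ℝ f y (e i)) x (e i)
  rw [this]
  simp [e]

theorem contDiffOn_fderivWithin_apply (hU : IsOpen U) (hab : a < b) {F : E d × ℝ → ℂ}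
    {m n : ℕ∞ω} (hF : ContDiffOn ℝ n F (U ×ˢ Icc a b)) (hmn : m + 1 ≤ n) (i : Fin d) :
    ContDiffOn ℝ m (fun p => fderivWithin ℝ F (U ×ˢ Icc a b) p (e i, 0)) (U ×ˢ Icc a b) :=
  (hF.fderivWithin (uniqueDiffOn_prod_Icc hU hab) hmn).clm_apply contDiffOn_const

section Wave

variable {u₀ : E d → ℝ → ℂ}

theorem pd_wave (hU : IsOpen U)
    (hu : ContDiffOn ℝ 3 (fun p : E d × ℝ => u₀ p.1 p.2) (U ×ˢ Icc a b)) {x : E d} (hx : x ∈ U)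
    {θ : ℝ} (hθ : θ ∈ Icc a b) (i : Fin d) : pd i (fun y => u₀ y θ) x =
      fderivWithin ℝ (fun p : E d × ℝ => u₀ p.1 p.2) (U ×ˢ Icc a b) (x, θ) (e i, 0) :=
  pd_slice (F := fun p : E d × ℝ => u₀ p.1 p.2) hU (hu.differentiableOn (by norm_num)) hx hθ i

theorem isC1Angle_drift (hU : IsOpen U) (hΩU : closure Ω ⊆ U) (hab : a < b)
    (hu : ContDiffOn ℝ 3 (fun p : E d × ℝ => u₀ p.1 p.2) (U ×ˢ Icc a b))
    (hu0 : ∀ x ∈ closure Ω, ∀ θ ∈ Icc a b, u₀ x θ ≠ 0) (i : Fin d) :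
    IsC1Angle Ω a b (drift u₀ i) :=
  isC1Angle_div hU hΩU hab (contDiffOn_fderivWithin_apply hU hab hu (by norm_num) i)
    (hu.of_le (by norm_num)) hu0 fun x hx θ hθ => by rw [drift, pd_wave hU hu (hΩU hx) hθ]

/-- Two of the three available derivatives are spent on the Laplacian, leaving one for the angle. -/
theorem isC1Angle_laplacian (hU : IsOpen U) (hΩU : closure Ω ⊆ U) (hab : a < b)
    (hu : ContDiffOn ℝ 3 (fun p : E d × ℝ => u₀ p.1 p.2) (U ×ˢ Icc a b))
    (hu0 : ∀ x ∈ closure Ω, ∀ θ ∈ Icc a b, u₀ x θ ≠ 0) :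
    IsC1Angle Ω a b (fun x θ => (Δ (fun y => u₀ y θ)) x / u₀ x θ) := by
  set g : Fin d → E d × ℝ → ℂ := fun i p =>
    fderivWithin ℝ (fun p : E d × ℝ => u₀ p.1 p.2) (U ×ˢ Icc a b) p (e i, 0) with hg
  have hg2 : ∀ i, ContDiffOn ℝ 2 (g i) (U ×ˢ Icc a b) := fun i =>
    contDiffOn_fderivWithin_apply hU hab hu (by norm_num) i
  refine isC1Angle_div hU hΩU hab (ContDiffOn.sum (s := Finset.univ) fun i _ =>
    contDiffOn_fderivWithin_apply hU hab (hg2 i) (by norm_num) i)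
    (hu.of_le (by norm_num)) hu0 fun x hx θ hθ => ?_
  have hxU := hΩU hx
  have hcd : ContDiffAt ℝ 2 (fun y => u₀ y θ) x := by
    have h1 : ContDiffOn ℝ 3 (fun y => u₀ y θ) U :=
      hu.comp (f := fun y : E d => (y, θ)) (contDiff_id.prodMk contDiff_const).contDiffOn
        fun y hy => ⟨hy, hθ⟩
    exact (h1.contDiffAt (hU.mem_nhds hxU)).of_le (by norm_num)
  rw [laplacian_eq_sum_pd hcd]
  congr 1
  refine Finset.sum_congr rfl fun i _ => ?_
  rw [← pd_slice hU ((hg2 i).differentiableOn (by norm_num)) hxU hθ i]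
  have : pd i (fun y => u₀ y θ) =ᶠ[𝓝 x] fun y => g i (y, θ) := by
    filter_upwards [hU.mem_nhds hxU] with y hy
    exact pd_wave hU hu hy hθ i
  rw [pd, pd, this.fderiv_eq]

theorem isBoundedCoeff_matA (hΩ : IsOpen Ω) (hΩb : Bornology.IsBounded Ω) (N : ℕ) (k : ℝ)
    {c₀ : E d → ℝ} (hc₀m : Measurable c₀) (hc₀1 : ∀ x, 1 ≤ c₀ x) (hc₀b : ∃ M, ∀ x ∈ Ω, c₀ x ≤ M)
    (hU : IsOpen U) (hΩU : closure Ω ⊆ U) (hab : a < b)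
    (hu : ContDiffOn ℝ 3 (fun p : E d × ℝ => u₀ p.1 p.2) (U ×ˢ Icc a b))
    (hu0 : ∀ x ∈ closure Ω, ∀ θ ∈ Icc a b, u₀ x θ ≠ 0) (m n : Fin N) :
    IsBoundedCoeff Ω (fun x => matA N a b k c₀ u₀ x m n) := by
  have hc : IsBoundedCoeff Ω (fun x => ((k ^ 2 * c₀ x : ℝ) : ℂ)) := by
    obtain ⟨M, hM⟩ := hc₀b
    refine ⟨(Complex.measurable_ofReal.comp (hc₀m.const_mul _)).aestronglyMeasurable, k ^ 2 * M,
      fun x hx => ?_⟩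
    rw [Complex.norm_real, Real.norm_of_nonneg (by have := hc₀1 x; positivity)]
    exact mul_le_mul_of_nonneg_left (hM x hx) (sq_nonneg k)
  exact (isC1Angle_laplacian hU hΩU hab hu hu0).isBoundedCoeff hΩ hΩb hab.le hc
    (continuous_Psi a b n) (continuous_deriv_Psi a b n) (continuous_Psi a b m)

theorem isBoundedCoeff_matB (hΩ : IsOpen Ω) (hΩb : Bornology.IsBounded Ω) (N : ℕ)
    (hU : IsOpen U) (hΩU : closure Ω ⊆ U) (hab : a < b)
    (hu : ContDiffOn ℝ 3 (fun p : E d × ℝ => u₀ p.1 p.2) (U ×ˢ Icc a b))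
    (hu0 : ∀ x ∈ closure Ω, ∀ θ ∈ Icc a b, u₀ x θ ≠ 0) (i : Fin d) (m n : Fin N) :
    IsBoundedCoeff Ω (fun x => matB N a b u₀ i x m n) := by
  -- The drift has no angle-independent part, so the common criterion is used with `c = 0`.
  have hc : IsBoundedCoeff Ω (fun _ => (0 : ℂ)) := ⟨aestronglyMeasurable_const, 0, by simp⟩
  have h1 := (isC1Angle_drift hU hΩU hab hu hu0 i).isBoundedCoeff hΩ hΩb hab.le hc
    (continuous_Psi a b n) (continuous_deriv_Psi a b n) (continuous_Psi a b m)
  refine (h1.const_mul 2).congr hΩ fun x _ => ?_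
  simp only [matB, add_zero]
  congr 1
  refine intervalIntegral.integral_congr fun θ _ => ?_
  ring

/-- The constant matrix is arbitrary, so the invertibility of `matS` plays no role. -/
theorem IsBoundedCoeff.matrix_mul {N : ℕ} {M : E d → Matrix (Fin N) (Fin N) ℂ}
    (S : Matrix (Fin N) (Fin N) ℂ) (h : ∀ m n, IsBoundedCoeff Ω (fun x => M x m n))
    (m n : Fin N) : IsBoundedCoeff Ω (fun x => (S * M x) m n) := by
  simp only [Matrix.mul_apply]
  exact .sum _ fun j => (h j n).const_mul _

end Wave

end Coefficients

/-! ### Multiplication by bounded coefficients and the elliptic operator -/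

section Operator

variable {d N : ℕ} {Ω : Set (E d)}

theorem exists_mulCoeff (hΩ : IsOpen Ω) {c : E d → ℂ} (hc : IsBoundedCoeff Ω c) :
    ∃ T : L2 Ω →L[ℂ] L2 Ω, ∀ u, T u =ᵐ[volume.restrict Ω] fun x => c x * u x := by
  obtain ⟨hm, M, hM⟩ := hc
  have hL : MemLp c ⊤ (volume.restrict Ω) := memLp_top_of_bound hm M
    ((ae_restrict_iff' hΩ.measurableSet).2 (.of_forall hM))
  refine ⟨(ContinuousLinearMap.mul ℂ ℂ).holderL (volume.restrict Ω) ⊤ 2 2 hL.toLp, fun u => ?_⟩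
  have h1 := ContinuousLinearMap.coeFn_holder (r := 2) (ContinuousLinearMap.mul ℂ ℂ) hL.toLp u
  refine h1.trans ?_
  filter_upwards [hL.coeFn_toLp] with x hx
  rw [hx]
  rfl

/-- Used to move the Carleman weight past the coefficients, so that the bounds on the lower order
terms do not depend on the weight parameter. -/
theorem mulCoeff_comm {c c' : E d → ℂ} {T T' : L2 Ω →L[ℂ] L2 Ω}
    (hT : ∀ u, T u =ᵐ[volume.restrict Ω] fun x => c x * u x)
    (hT' : ∀ u, T' u =ᵐ[volume.restrict Ω] fun x => c' x * u x) (u : L2 Ω) :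
    T (T' u) = T' (T u) := by
  refine Lp.ext ?_
  filter_upwards [hT (T' u), hT' (T u), hT u, hT' u] with x h1 h2 h3 h4
  rw [h1, h2, h3, h4]
  ring

theorem norm_mulCoeff_sq {w : E d → ℝ} {T : L2 Ω →L[ℂ] L2 Ω}
    (hT : ∀ u, T u =ᵐ[volume.restrict Ω] fun x => (Real.exp (w x) : ℂ) * u x) (u : L2 Ω) :
    ‖T u‖ ^ 2 = ∫ x in Ω, Real.exp (2 * w x) * ‖u x‖ ^ 2 := by
  rw [norm_sq_eq_integral]
  refine integral_congr_ae ?_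
  filter_upwards [hT u] with x hx
  rw [hx, norm_mul, mul_pow, Complex.norm_real, Real.norm_eq_abs, sq_abs,
    ← Real.exp_nat_mul]
  norm_num

/-- The elliptic operator `ΔW + P W + ∑ᵢ Qᵢ ∂ᵢ W`. -/
def ellipticOp (P : Fin N → Fin N → L2 Ω →L[ℂ] L2 Ω) (Q : Fin d → Fin N → Fin N → L2 Ω →L[ℂ] L2 Ω)
    (W : Fin N → L2 Ω) (n : Fin N) : L2 Ω :=
  weakLaplacian Ω (W n) + ∑ m, P n m (W m) + ∑ i, ∑ m, Q i n m (weakPartial Ω i (W m))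

variable {P : Fin N → Fin N → L2 Ω →L[ℂ] L2 Ω} {Q : Fin d → Fin N → Fin N → L2 Ω →L[ℂ] L2 Ω}
  {V W : Fin N → L2 Ω}

theorem ellipticOp_add (hΩ : IsOpen Ω) (hV : ∀ n, MemH2 Ω (V n)) (hW : ∀ n, MemH2 Ω (W n)) :
    ellipticOp P Q (V + W) = ellipticOp P Q V + ellipticOp P Q W := by
  funext n
  have h1 : ∀ i m, weakPartial Ω i (V m + W m) = weakPartial Ω i (V m) + weakPartial Ω i (W m) :=
    fun i m => weakPartial_add hΩ (hV m).1 (hW m).1 i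
  have h2 : ∀ i m, weakPartial Ω i (weakPartial Ω i (V m) + weakPartial Ω i (W m)) =
      weakPartial Ω i (weakPartial Ω i (V m)) + weakPartial Ω i (weakPartial Ω i (W m)) :=
    fun i m => weakPartial_add hΩ ((hV m).2 i) ((hW m).2 i) i
  simp only [ellipticOp, weakLaplacian, Pi.add_apply, h1, h2, map_add, Finset.sum_add_distrib]
  abel

theorem ellipticOp_smul (hΩ : IsOpen Ω) (c : ℝ) (hV : ∀ n, MemH2 Ω (V n)) :
    ellipticOp P Q (c • V) = c • ellipticOp P Q V := by
  funext n
  have h1 : ∀ i m, weakPartial Ω i (c • V m) = c • weakPartial Ω i (V m) :=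
    fun i m => weakPartial_smul hΩ c (hV m).1 i
  have h2 : ∀ i m, weakPartial Ω i (c • weakPartial Ω i (V m)) =
      c • weakPartial Ω i (weakPartial Ω i (V m)) :=
    fun i m => weakPartial_smul hΩ c ((hV m).2 i) i
  simp only [ellipticOp, weakLaplacian, Pi.smul_apply, h1, h2,
    ContinuousLinearMap.map_smul_of_tower, smul_add, Finset.smul_sum]

theorem ellipticOp_tendsto {W : ℕ → Fin N → L2 Ω}
    (h0 : ∀ n, Tendsto (fun m => W m n) atTop (𝓝 (V n)))
    (h1 : ∀ n i, Tendsto (fun m => weakPartial Ω i (W m n)) atTop (𝓝 (weakPartial Ω i (V n))))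
    (h2 : ∀ n i j, Tendsto (fun m => weakPartial Ω j (weakPartial Ω i (W m n))) atTop
      (𝓝 (weakPartial Ω j (weakPartial Ω i (V n))))) (n : Fin N) :
    Tendsto (fun m => ellipticOp P Q (W m) n) atTop (𝓝 (ellipticOp P Q V n)) := by
  refine ((tendsto_finsetSum _ fun i _ => h2 n i i).add (tendsto_finsetSum _ fun m _ =>
    ((P n m).continuous.tendsto _).comp (h0 m))).add (tendsto_finsetSum _ fun i _ =>
    tendsto_finsetSum _ fun m _ => ((Q i n m).continuous.tendsto _).comp (h1 m i))

theorem ellipticOp_apply {p : Fin N → Fin N → E d → ℂ} {q : Fin d → Fin N → Fin N → E d → ℂ}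
    (hP : ∀ n m u, P n m u =ᵐ[volume.restrict Ω] fun x => p n m x * u x)
    (hQ : ∀ i n m u, Q i n m u =ᵐ[volume.restrict Ω] fun x => q i n m x * u x)
    (W : Fin N → L2 Ω) (n : Fin N) :
    ellipticOp P Q W n =ᵐ[volume.restrict Ω] fun x =>
      (∑ i, weakPartial Ω i (weakPartial Ω i (W n)) x) + (∑ m, p n m x * W m x) +
        ∑ i, ∑ m, q i n m x * weakPartial Ω i (W m) x := by
  have e1 := Lp.coeFn_add (weakLaplacian Ω (W n) + ∑ m, P n m (W m))
    (∑ i, ∑ m, Q i n m (weakPartial Ω i (W m)))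
  have e2 := Lp.coeFn_add (weakLaplacian Ω (W n)) (∑ m, P n m (W m))
  have e3 := Lp.coeFn_finsetSum Finset.univ fun i => weakPartial Ω i (weakPartial Ω i (W n))
  have e4 := Lp.coeFn_finsetSum Finset.univ fun m => P n m (W m)
  have e5 := Lp.coeFn_finsetSum Finset.univ fun i => ∑ m, Q i n m (weakPartial Ω i (W m))
  have e6 : ∀ i, _ := fun i => Lp.coeFn_finsetSum Finset.univ
    fun m => Q i n m (weakPartial Ω i (W m))
  have e7 : ∀ m, _ := fun m => hP n m (W m)
  have e8 : ∀ i m, _ := fun i m => hQ i n m (weakPartial Ω i (W m))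
  rw [← weakLaplacian] at e3
  filter_upwards [e1, e2, e3, e4, e5, eventually_all.2 e6, eventually_all.2 e7,
    eventually_all.2 fun i => eventually_all.2 (e8 i)] with x h1 h2 h3 h4 h5 h6 h7 h8
  rw [ellipticOp, h1, Pi.add_apply, h2, Pi.add_apply, h3, h4, h5]
  simp only [Finset.sum_apply, h6, h7, h8]

/-! ### Elementary properties of the Sobolev norms -/

theorem norm_add_sq_le {F : Type*} [SeminormedAddCommGroup F] (u v : F) :
    ‖u + v‖ ^ 2 ≤ 2 * ‖u‖ ^ 2 + 2 * ‖v‖ ^ 2 := by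
  have h := norm_add_le u v
  have h0 := norm_nonneg (u + v)
  nlinarith [sq_nonneg (‖u‖ - ‖v‖)]

theorem normSqH1_nonneg (W : Fin N → L2 Ω) : 0 ≤ normSqH1 Ω W := by
  unfold normSqH1; positivity

theorem normSqH1_le_normSqH2 (W : Fin N → L2 Ω) : normSqH1 Ω W ≤ normSqH2 Ω W :=
  le_add_of_nonneg_right (by positivity)

theorem normSqH2_nonneg (W : Fin N → L2 Ω) : 0 ≤ normSqH2 Ω W :=
  (normSqH1_nonneg W).trans (normSqH1_le_normSqH2 W)

theorem normSqH1_add_le (hΩ : IsOpen Ω) (hV : ∀ n, MemH1 Ω (V n)) (hW : ∀ n, MemH1 Ω (W n)) :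
    normSqH1 Ω (V + W) ≤ 2 * normSqH1 Ω V + 2 * normSqH1 Ω W := by
  simp only [normSqH1, Finset.mul_sum, ← Finset.sum_add_distrib]
  refine Finset.sum_le_sum fun n _ => ?_
  have h1 : ∑ i, ‖weakPartial Ω i (V n + W n)‖ ^ 2 ≤
      2 * (∑ i, ‖weakPartial Ω i (V n)‖ ^ 2) + 2 * ∑ i, ‖weakPartial Ω i (W n)‖ ^ 2 := by
    simp only [Finset.mul_sum, ← Finset.sum_add_distrib]
    refine Finset.sum_le_sum fun i _ => ?_
    rw [weakPartial_add hΩ (hV n) (hW n)]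
    exact norm_add_sq_le _ _
  have h2 := norm_add_sq_le (V n) (W n)
  rw [Pi.add_apply]
  linarith

theorem normSqH2_add_le (hΩ : IsOpen Ω) (hV : ∀ n, MemH2 Ω (V n)) (hW : ∀ n, MemH2 Ω (W n)) :
    normSqH2 Ω (V + W) ≤ 2 * normSqH2 Ω V + 2 * normSqH2 Ω W := by
  have h1 := normSqH1_add_le hΩ (fun n => (hV n).1) fun n => (hW n).1
  have h2 : ∑ n, ∑ i, ∑ j, ‖weakPartial Ω j (weakPartial Ω i ((V + W) n))‖ ^ 2 ≤
      2 * (∑ n, ∑ i, ∑ j, ‖weakPartial Ω j (weakPartial Ω i (V n))‖ ^ 2) +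
        2 * ∑ n, ∑ i, ∑ j, ‖weakPartial Ω j (weakPartial Ω i (W n))‖ ^ 2 := by
    simp only [Finset.mul_sum, ← Finset.sum_add_distrib]
    refine Finset.sum_le_sum fun n _ => Finset.sum_le_sum fun i _ =>
      Finset.sum_le_sum fun j _ => ?_
    rw [Pi.add_apply, weakPartial_weakPartial_add hΩ (hV n) (hW n)]
    exact norm_add_sq_le _ _
  simp only [normSqH2]
  linarith

theorem norm_sq_le_normSqH1 (W : Fin N → L2 Ω) (n : Fin N) : ‖W n‖ ^ 2 ≤ normSqH1 Ω W :=
  (le_add_of_nonneg_right (by positivity)).trans (Finset.single_le_sum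
    (f := fun n => ‖W n‖ ^ 2 + ∑ i, ‖weakPartial Ω i (W n)‖ ^ 2)
    (fun n _ => by positivity) (Finset.mem_univ n))

theorem norm_weakPartial_sq_le_normSqH1 (W : Fin N → L2 Ω) (n : Fin N) (i : Fin d) :
    ‖weakPartial Ω i (W n)‖ ^ 2 ≤ normSqH1 Ω W :=
  (Finset.single_le_sum (f := fun i => ‖weakPartial Ω i (W n)‖ ^ 2)
    (fun i _ => by positivity) (Finset.mem_univ i)).trans <|
  (le_add_of_nonneg_left (by positivity)).trans (Finset.single_le_sum
    (f := fun n => ‖W n‖ ^ 2 + ∑ i, ‖weakPartial Ω i (W n)‖ ^ 2)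
    (fun n _ => by positivity) (Finset.mem_univ n))

theorem norm_weakPartial_weakPartial_sq_le_normSqH2 (W : Fin N → L2 Ω) (n : Fin N) (i j : Fin d) :
    ‖weakPartial Ω j (weakPartial Ω i (W n))‖ ^ 2 ≤ normSqH2 Ω W :=
  (Finset.single_le_sum (f := fun j => ‖weakPartial Ω j (weakPartial Ω i (W n))‖ ^ 2)
    (fun j _ => by positivity) (Finset.mem_univ j)).trans <|
  (Finset.single_le_sum (f := fun i => ∑ j, ‖weakPartial Ω j (weakPartial Ω i (W n))‖ ^ 2)
    (fun i _ => by positivity) (Finset.mem_univ i)).trans <|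
  (Finset.single_le_sum (f := fun n => ∑ i, ∑ j, ‖weakPartial Ω j (weakPartial Ω i (W n))‖ ^ 2)
    (fun n _ => by positivity) (Finset.mem_univ n)).trans
  (le_add_of_nonneg_left (normSqH1_nonneg W))

theorem exists_sum_norm_ellipticOp_sq_le (P : Fin N → Fin N → L2 Ω →L[ℂ] L2 Ω)
    (Q : Fin d → Fin N → Fin N → L2 Ω →L[ℂ] L2 Ω) :
    ∃ C, 0 ≤ C ∧ ∀ W : Fin N → L2 Ω, ∑ n, ‖ellipticOp P Q W n‖ ^ 2 ≤ C * normSqH2 Ω W := by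
  refine ⟨∑ n, (d + ∑ m, ‖P n m‖ + ∑ i, ∑ m, ‖Q i n m‖) ^ 2, by positivity, fun W => ?_⟩
  set s := Real.sqrt (normSqH2 Ω W) with hs
  have hs2 : s ^ 2 = normSqH2 Ω W := Real.sq_sqrt (normSqH2_nonneg W)
  have hle := normSqH1_le_normSqH2 W
  have h0 : ∀ n, ‖W n‖ ≤ s := fun n =>
    Real.le_sqrt_of_sq_le ((norm_sq_le_normSqH1 W n).trans hle)
  have h1 : ∀ n i, ‖weakPartial Ω i (W n)‖ ≤ s := fun n i =>
    Real.le_sqrt_of_sq_le ((norm_weakPartial_sq_le_normSqH1 W n i).trans hle)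
  have h2 : ∀ n i, ‖weakPartial Ω i (weakPartial Ω i (W n))‖ ≤ s := fun n i =>
    Real.le_sqrt_of_sq_le (norm_weakPartial_weakPartial_sq_le_normSqH2 W n i i)
  rw [Finset.sum_mul]
  refine Finset.sum_le_sum fun n _ => ?_
  rw [← hs2, ← mul_pow]
  refine pow_le_pow_left₀ (norm_nonneg _) ?_ 2
  have a1 : ‖weakLaplacian Ω (W n)‖ ≤ d * s := by
    refine (norm_sum_le_of_le _ fun i _ => h2 n i).trans ?_
    simp
  have a2 : ‖∑ m, P n m (W m)‖ ≤ (∑ m, ‖P n m‖) * s := by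
    rw [Finset.sum_mul]
    exact norm_sum_le_of_le _ fun m _ => (P n m).le_opNorm_of_le (h0 m)
  have a3 : ‖∑ i, ∑ m, Q i n m (weakPartial Ω i (W m))‖ ≤ (∑ i, ∑ m, ‖Q i n m‖) * s := by
    simp only [Finset.sum_mul]
    exact norm_sum_le_of_le _ fun i _ => norm_sum_le_of_le _ fun m _ =>
      (Q i n m).le_opNorm_of_le (h1 m i)
  rw [add_mul, add_mul]
  exact (norm_add_le _ _).trans (add_le_add ((norm_add_le _ _).trans (add_le_add a1 a2)) a3)

end Operator

/-! ### Stability of the elliptic operator for vanishing Cauchy data -/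

section Stability

variable {d N : ℕ} {Ω : Set (E d)} {ν : E d → E d}

theorem isBoundedCoeff_exp (hΩb : Bornology.IsBounded Ω) {w : E d → ℝ}
    (hw : Continuous w) : IsBoundedCoeff Ω (fun x => (Real.exp (w x) : ℂ)) := by
  have hc : Continuous fun x => (Real.exp (w x) : ℂ) :=
    Complex.continuous_ofReal.comp (Real.continuous_exp.comp hw)
  obtain ⟨M, hM⟩ := hΩb.isCompact_closure.exists_bound_of_continuousOn hc.continuousOn
  exact ⟨hc.aestronglyMeasurable, M, fun x hx => hM x (subset_closure hx)⟩

theorem norm_le_norm_mulCoeff {w : E d → ℝ} (hw : ∀ x, 0 ≤ w x) {T : L2 Ω →L[ℂ] L2 Ω}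
    (hT : ∀ u, T u =ᵐ[volume.restrict Ω] fun x => (Real.exp (w x) : ℂ) * u x) (u : L2 Ω) :
    ‖u‖ ≤ ‖T u‖ := by
  refine Lp.norm_le_norm_of_ae_le ?_
  filter_upwards [hT u] with x hx
  rw [hx, norm_mul, Complex.norm_real, Real.norm_eq_abs, abs_of_pos (Real.exp_pos _)]
  exact le_mul_of_one_le_left (norm_nonneg _) (Real.one_le_exp (hw x))

theorem sq_sum_add_sum_le (α : Fin N → ℝ) (β : Fin N → Fin d → ℝ) :
    (∑ m, (α m + ∑ i, β m i)) ^ 2 ≤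
      2 * N * (1 + d) * ∑ m, (α m ^ 2 + ∑ i, β m i ^ 2) := by
  have h1 := sq_sum_le_card_mul_sum_sq (s := Finset.univ) (f := fun m => α m + ∑ i, β m i)
  rw [Finset.card_univ, Fintype.card_fin] at h1
  refine h1.trans ?_
  have h2 : ∑ m, (α m + ∑ i, β m i) ^ 2 ≤ 2 * (1 + d) * ∑ m, (α m ^ 2 + ∑ i, β m i ^ 2) := by
    rw [Finset.mul_sum]
    refine Finset.sum_le_sum fun m _ => ?_
    have h3 := sq_sum_le_card_mul_sum_sq (s := Finset.univ) (f := fun i => β m i)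
    rw [Finset.card_univ, Fintype.card_fin] at h3
    have h4 : 0 ≤ ∑ i, β m i ^ 2 := by positivity
    have h5 : 0 ≤ (d : ℝ) * α m ^ 2 := by positivity
    nlinarith [sq_nonneg (α m - ∑ i, β m i)]
  calc (N : ℝ) * _ ≤ N * (2 * (1 + d) * ∑ m, (α m ^ 2 + ∑ i, β m i ^ 2)) :=
        mul_le_mul_of_nonneg_left h2 (Nat.cast_nonneg N)
    _ = _ := by ring

variable {P : Fin N → Fin N → L2 Ω →L[ℂ] L2 Ω} {Q : Fin d → Fin N → Fin N → L2 Ω →L[ℂ] L2 Ω}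
  {p : Fin N → Fin N → E d → ℂ} {q : Fin d → Fin N → Fin N → E d → ℂ}

/-- Solve for the Laplacian in the definition of `ellipticOp` and commute the weight `T` with the
coefficients: the constant `D` does not involve `T`, as the absorption requires. -/
theorem norm_mulCoeff_weakLaplacian_le
    (hP : ∀ n m u, P n m u =ᵐ[volume.restrict Ω] fun x => p n m x * u x)
    (hQ : ∀ i n m u, Q i n m u =ᵐ[volume.restrict Ω] fun x => q i n m x * u x)
    {D : ℝ} (hPD : ∀ n m, ‖P n m‖ ≤ D) (hQD : ∀ i n m, ‖Q i n m‖ ≤ D)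
    {c : E d → ℂ} {T : L2 Ω →L[ℂ] L2 Ω}
    (hT : ∀ u, T u =ᵐ[volume.restrict Ω] fun x => c x * u x) (V : Fin N → L2 Ω) (n : Fin N) :
    ‖T (weakLaplacian Ω (V n))‖ ≤ ‖T (ellipticOp P Q V n)‖ +
      D * ∑ m, (‖T (V m)‖ + ∑ i, ‖T (weakPartial Ω i (V m))‖) := by
  have e : T (weakLaplacian Ω (V n)) = T (ellipticOp P Q V n) -
      (∑ m, P n m (T (V m)) + ∑ i, ∑ m, Q i n m (T (weakPartial Ω i (V m)))) := by
    simp only [← mulCoeff_comm hT (hP n _), ← mulCoeff_comm hT (hQ _ n _), ← map_sum, ← map_add,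
      ← map_sub]
    congr 1
    rw [ellipticOp]
    abel
  have h1 : ‖∑ m, P n m (T (V m))‖ ≤ D * ∑ m, ‖T (V m)‖ := by
    rw [Finset.mul_sum]
    exact norm_sum_le_of_le _ fun m _ => (P n m).le_of_opNorm_le (hPD n m) _
  have h2 : ‖∑ i, ∑ m, Q i n m (T (weakPartial Ω i (V m)))‖ ≤
      D * ∑ m, ∑ i, ‖T (weakPartial Ω i (V m))‖ := by
    rw [Finset.sum_comm, Finset.mul_sum]
    simp only [Finset.mul_sum]
    exact norm_sum_le_of_le _ fun m _ => norm_sum_le_of_le _ fun i _ =>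
      (Q i n m).le_of_opNorm_le (hQD i n m) _
  rw [e, Finset.sum_add_distrib, mul_add]
  exact (norm_sub_le _ _).trans (add_le_add le_rfl ((norm_add_le _ _).trans (add_le_add h1 h2)))

/-- Apply the Carleman estimate to each component and sum. The lower order terms are bounded by the
weighted `H¹` quantity `X` with a constant independent of `l`, so a large `l` absorbs them. Finally
the weight is removed, as it is at least one and bounded on `Ω`. -/
theorem exists_normSqH1_le_ellipticOp (hd : 1 ≤ d) (hΩ : IsOpen Ω) (hΩb : Bornology.IsBounded Ω)
    (hΩs : HasSmoothBoundary Ω) (hν : ∀ p ∈ frontier Ω, IsOuterUnitNormal Ω p (ν p))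
    (hP : ∀ n m u, P n m u =ᵐ[volume.restrict Ω] fun x => p n m x * u x)
    (hQ : ∀ i n m u, Q i n m u =ᵐ[volume.restrict Ω] fun x => q i n m x * u x) :
    ∃ C, 0 ≤ C ∧ ∀ V ∈ admissible (N := N) Ω ν 0 0,
      normSqH1 Ω V ≤ C * ∑ n, ‖ellipticOp P Q V n‖ ^ 2 := by
  obtain ⟨r, hr⟩ := hΩb.subset_closedBall 0
  set D : ℝ := ∑ n, ∑ m, ‖P n m‖ + ∑ i, ∑ n, ∑ m, ‖Q i n m‖ with hD
  have hPD : ∀ n m, ‖P n m‖ ≤ D := fun n m =>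
    (Finset.single_le_sum (f := fun m => ‖P n m‖) (fun m _ => norm_nonneg _)
      (Finset.mem_univ m)).trans <|
    (Finset.single_le_sum (f := fun n => ∑ m, ‖P n m‖) (fun n _ => by positivity)
      (Finset.mem_univ n)).trans (le_add_of_nonneg_right (by positivity))
  have hQD : ∀ i n m, ‖Q i n m‖ ≤ D := fun i n m =>
    (Finset.single_le_sum (f := fun m => ‖Q i n m‖) (fun m _ => norm_nonneg _)
      (Finset.mem_univ m)).trans <|
    (Finset.single_le_sum (f := fun n => ∑ m, ‖Q i n m‖) (fun n _ => by positivity)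
      (Finset.mem_univ n)).trans <|
    (Finset.single_le_sum (f := fun i => ∑ n, ∑ m, ‖Q i n m‖) (fun i _ => by positivity)
      (Finset.mem_univ i)).trans (le_add_of_nonneg_left (by positivity))
  -- `K X` is twice the squared lower order bound. The `N` components contribute `3 K N X` in total,
  -- and `l` exceeds this coefficient by exactly one.
  set K : ℝ := 4 * D ^ 2 * N * (1 + d) with hK
  have hK0 : 0 ≤ K := by positivity
  set l : ℝ := 3 * K * N + 1 with hl
  have hl1 : 1 ≤ l := le_add_of_nonneg_left (by positivity)
  -- Half the Carleman exponent, since `T` enters through `‖T u‖²`. Any coordinate direction would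
  -- do; the first exists because `1 ≤ d`.
  set w : E d → ℝ := fun x => l * shift ⟨0, hd⟩ (r + 2) x ^ 2 / 2 with hw
  have hwc : Continuous w :=
    (continuous_const.mul ((contDiff_shift _ _).continuous.pow 2)).div_const 2
  have hw0 : ∀ x, 0 ≤ w x := fun x => by positivity
  obtain ⟨T, hT⟩ := exists_mulCoeff hΩ (isBoundedCoeff_exp hΩb hwc)
  have hTw : ∀ u : L2 Ω,
      ∫ x in Ω, Real.exp (l * shift ⟨0, hd⟩ (r + 2) x ^ 2) * ‖u x‖ ^ 2 = ‖T u‖ ^ 2 := by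
    intro u
    rw [norm_mulCoeff_sq hT]
    simp only [hw, mul_div_cancel₀ _ (two_ne_zero' ℝ)]
  refine ⟨6 * ‖T‖ ^ 2, by positivity, fun V hV => ?_⟩
  set X := ∑ n, (‖T (V n)‖ ^ 2 + ∑ i, ‖T (weakPartial Ω i (V n))‖ ^ 2) with hX
  have h1 : ∀ n, l * (‖T (V n)‖ ^ 2 + ∑ i, ‖T (weakPartial Ω i (V n))‖ ^ 2) ≤
      6 * ‖T (ellipticOp P Q V n)‖ ^ 2 + 3 * K * X := by
    intro n
    have a1 := carleman_weak hd hΩ hr hΩs hν (hV n).2.1 (hV n).2.2 ⟨0, hd⟩ hl1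
    simp only [hTw] at a1
    have a2 := norm_mulCoeff_weakLaplacian_le hP hQ hPD hQD hT V n
    have a3 := sq_sum_add_sum_le (fun m => ‖T (V m)‖) fun m i => ‖T (weakPartial Ω i (V m))‖
    rw [← hX] at a3
    set s := ∑ m, (‖T (V m)‖ + ∑ i, ‖T (weakPartial Ω i (V m))‖)
    have a4 := pow_le_pow_left₀ (norm_nonneg _) a2 2
    have a5 : D ^ 2 * s ^ 2 ≤ D ^ 2 * (2 * N * (1 + d) * X) :=
      mul_le_mul_of_nonneg_left a3 (sq_nonneg D)
    have a6 : 2 * (D ^ 2 * (2 * N * (1 + d) * X)) = K * X := by rw [hK]; ring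
    have a7 : l * ‖T (V n)‖ ^ 2 ≤ l ^ 3 * ‖T (V n)‖ ^ 2 :=
      mul_le_mul_of_nonneg_right (le_self_pow₀ hl1 (by norm_num)) (sq_nonneg _)
    nlinarith [sq_nonneg (‖T (ellipticOp P Q V n)‖ - D * s)]
  have h2 : l * X ≤ 6 * (∑ n, ‖T (ellipticOp P Q V n)‖ ^ 2) + N * (3 * K * X) := by
    rw [hX, Finset.mul_sum, Finset.mul_sum]
    refine (Finset.sum_le_sum fun n _ => h1 n).trans ?_
    rw [Finset.sum_add_distrib, Finset.sum_const, Finset.card_univ, Fintype.card_fin, nsmul_eq_mul]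
  have h3 : X ≤ 6 * ∑ n, ‖T (ellipticOp P Q V n)‖ ^ 2 := by
    rw [hl] at h2
    linarith
  have h4 : normSqH1 Ω V ≤ X := Finset.sum_le_sum fun n _ => add_le_add
    (pow_le_pow_left₀ (norm_nonneg _) (norm_le_norm_mulCoeff hw0 hT _) 2)
    (Finset.sum_le_sum fun i _ =>
      pow_le_pow_left₀ (norm_nonneg _) (norm_le_norm_mulCoeff hw0 hT _) 2)
  have h5 : ∑ n, ‖T (ellipticOp P Q V n)‖ ^ 2 ≤ ‖T‖ ^ 2 * ∑ n, ‖ellipticOp P Q V n‖ ^ 2 := by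
    rw [Finset.mul_sum]
    refine Finset.sum_le_sum fun n _ => ?_
    rw [← mul_pow]
    exact pow_le_pow_left₀ (norm_nonneg _) (T.le_opNorm _) 2
  linarith

end Stability

/-! ### Existence and uniqueness of the minimizer -/

section Minimizer

/-- The projection theorem for the origin and the closed convex set `T '' A`. Only the image needs
structure, which avoids making the Sobolev space a Hilbert space. -/
theorem existsUnique_isMinOn_norm_sq {X F : Type*} [NormedAddCommGroup F] [InnerProductSpace ℝ F]
    [CompleteSpace F] {A : Set X} {T : X → F} (hne : A.Nonempty) (hinj : InjOn T A)
    (hcl : IsClosed (T '' A)) (hconv : Convex ℝ (T '' A)) :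
    ∃! x, x ∈ A ∧ IsMinOn (fun y => ‖T y‖ ^ 2) A x := by
  obtain ⟨_, ⟨x, hx, rfl⟩, hmin⟩ :=
    exists_norm_eq_iInf_of_complete_convex (hne.image T) hcl.isComplete hconv 0
  have hle : ∀ y ∈ A, ‖T x‖ ≤ ‖T y‖ := by
    intro y hy
    simp only [zero_sub, norm_neg] at hmin
    rw [hmin]
    exact ciInf_le (f := fun w : T '' A => ‖(w : F)‖)
      ⟨0, by rintro _ ⟨w, rfl⟩; exact norm_nonneg _⟩ ⟨T y, mem_image_of_mem T hy⟩
  refine ⟨x, ⟨hx, isMinOn_iff.2 fun y hy => pow_le_pow_left₀ (norm_nonneg _) (hle y hy) 2⟩,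
    fun y ⟨hy, hymin⟩ => hinj hy hx ?_⟩
  have h1 : ‖T y‖ ^ 2 ≤ ‖T x‖ ^ 2 := isMinOn_iff.1 hymin x hx
  -- The midpoint of two minimal points is no shorter than they are, so the parallelogram law forces
  -- them to coincide.
  obtain ⟨z, hz, hzT⟩ := hconv (mem_image_of_mem T hx) (mem_image_of_mem T hy)
    (by norm_num : (0 : ℝ) ≤ 1 / 2) (by norm_num : (0 : ℝ) ≤ 1 / 2) (by norm_num)
  have h2 : ‖T x‖ ≤ 1 / 2 * ‖T x + T y‖ := by
    have := hle z hz
    rwa [hzT, ← smul_add, norm_smul, Real.norm_of_nonneg (by norm_num)] at this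
  have h3 := parallelogram_law_with_norm ℝ (T x) (T y)
  have h4 : ‖T x - T y‖ ^ 2 ≤ 0 := by nlinarith [norm_nonneg (T x)]
  have h5 : ‖T x - T y‖ = 0 := by nlinarith [norm_nonneg (T x - T y)]
  exact (sub_eq_zero.1 (norm_eq_zero.1 h5)).symm

variable {d N : ℕ} {Ω : Set (E d)} {ν : E d → E d} {F G : E d → Fin N → ℂ}

/-- The elliptic operator applied to `W` together with `s` times the derivatives of `W` of order
at most two. -/
def jet (P : Fin N → Fin N → L2 Ω →L[ℂ] L2 Ω) (Q : Fin d → Fin N → Fin N → L2 Ω →L[ℂ] L2 Ω) (s : ℝ)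
    (W : Fin N → L2 Ω) :
    PiLp 2 (fun _ : Fin N × ((Unit ⊕ Unit) ⊕ (Fin d ⊕ Fin d × Fin d)) => L2 Ω) :=
  WithLp.toLp 2 fun t => Sum.elim
    (Sum.elim (fun _ => ellipticOp P Q W t.1) fun _ => s • W t.1)
    (Sum.elim (fun i => s • weakPartial Ω i (W t.1))
      fun ij => s • weakPartial Ω ij.2 (weakPartial Ω ij.1 (W t.1))) t.2

variable {P : Fin N → Fin N → L2 Ω →L[ℂ] L2 Ω} {Q : Fin d → Fin N → Fin N → L2 Ω →L[ℂ] L2 Ω}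
  {s : ℝ} {V W : Fin N → L2 Ω}

theorem norm_jet_sq (W : Fin N → L2 Ω) :
    ‖jet P Q s W‖ ^ 2 = (∑ n, ‖ellipticOp P Q W n‖ ^ 2) + s ^ 2 * normSqH2 Ω W := by
  rw [PiLp.norm_sq_eq_of_L2]
  simp only [jet, Fintype.sum_prod_type, Fintype.sum_sum_type, Sum.elim_inl, Sum.elim_inr,
    Finset.univ_unique, Finset.sum_singleton, norm_smul, mul_pow, Real.norm_eq_abs, sq_abs,
    normSqH2, normSqH1, ← Finset.mul_sum, Finset.sum_add_distrib]
  ring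

theorem jet_add (hΩ : IsOpen Ω) (hV : ∀ n, MemH2 Ω (V n)) (hW : ∀ n, MemH2 Ω (W n)) :
    jet P Q s (V + W) = jet P Q s V + jet P Q s W := by
  refine PiLp.ext ?_
  rintro ⟨n, t⟩
  rcases t with (_ | _) | i | ij
  · exact congrFun (ellipticOp_add hΩ hV hW) n
  · exact smul_add s (V n) (W n)
  · simp only [jet, PiLp.add_apply, Sum.elim_inl, Sum.elim_inr, Pi.add_apply, ← smul_add,
      weakPartial_add hΩ (hV n).1 (hW n).1]
  · simp only [jet, PiLp.add_apply, Sum.elim_inr, Pi.add_apply, ← smul_add,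
      weakPartial_weakPartial_add hΩ (hV n) (hW n)]

theorem jet_smul (hΩ : IsOpen Ω) (c : ℝ) (hV : ∀ n, MemH2 Ω (V n)) :
    jet P Q s (c • V) = c • jet P Q s V := by
  refine PiLp.ext ?_
  rintro ⟨n, t⟩
  rcases t with (_ | _) | i | ij
  · exact congrFun (ellipticOp_smul hΩ c hV) n
  · exact smul_comm s c (V n)
  · simp only [jet, PiLp.smul_apply, Sum.elim_inl, Sum.elim_inr, Pi.smul_apply, smul_comm c s,
      weakPartial_smul hΩ c (hV n).1]
  · simp only [jet, PiLp.smul_apply, Sum.elim_inr, Pi.smul_apply, smul_comm c s,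
      weakPartial_weakPartial_smul hΩ c (hV n)]

theorem convex_jet_image (hΩ : IsOpen Ω) (hν : ContinuousOn ν (frontier Ω)) :
    Convex ℝ (jet P Q s '' admissible Ω ν F G) := by
  rintro _ ⟨V, hV, rfl⟩ _ ⟨W, hW, rfl⟩ α β hα hβ hαβ
  refine ⟨α • V + β • W, convex_admissible hΩ hν hV hW hα hβ hαβ, ?_⟩
  have h1 : ∀ n, MemH2 Ω ((α • V) n) := fun n => (hV n).1.smul hΩ α
  have h2 : ∀ n, MemH2 Ω ((β • W) n) := fun n => (hW n).1.smul hΩ β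
  rw [jet_add hΩ h1 h2, jet_smul hΩ α fun n => (hV n).1, jet_smul hΩ β fun n => (hW n).1]

/-- Since `s ≠ 0`, convergence of the jets gives `L²` convergence of all derivatives up to order
two. The limit is thus admissible, and continuity of the coefficient operators identifies the
elliptic component. -/
theorem isClosed_jet_image (hΩ : IsOpen Ω) (hs : s ≠ 0) :
    IsClosed (jet P Q s '' admissible Ω ν F G) := by
  refine IsSeqClosed.isClosed fun y z hy hz => ?_
  choose W hW hWy using hy
  obtain rfl : (fun m => jet P Q s (W m)) = y := funext hWy
  have hz' : ∀ t, Tendsto (fun m => jet P Q s (W m) t) atTop (𝓝 (z t)) := fun t =>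
    ((PiLp.continuous_apply 2 _ t).tendsto z).comp hz
  have hc : ∀ {u : ℕ → L2 Ω} {v : L2 Ω}, Tendsto (fun m => s • u m) atTop (𝓝 v) →
      Tendsto u atTop (𝓝 (s⁻¹ • v)) := by
    intro u v h
    simpa only [inv_smul_smul₀ hs] using h.const_smul s⁻¹
  have h0 : ∀ n, _ := fun n => hc (hz' (n, .inl (.inr ())))
  have h1 : ∀ n i, _ := fun n i => hc (hz' (n, .inr (.inl i)))
  have h2 : ∀ n i j, _ := fun n i j => hc (hz' (n, .inr (.inr (i, j))))
  obtain ⟨hV, e1, e2⟩ := admissible_of_tendsto hΩ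
    (V := fun n => s⁻¹ • z (n, .inl (.inr ()))) (w1 := fun i n => s⁻¹ • z (n, .inr (.inl i)))
    (w2 := fun i j n => s⁻¹ • z (n, .inr (.inr (i, j)))) hW h0 h1 h2
  refine ⟨_, hV, ?_⟩
  refine PiLp.ext ?_
  rintro ⟨n, t⟩
  rcases t with (_ | _) | i | ij
  · refine tendsto_nhds_unique (ellipticOp_tendsto (W := W) h0 (fun n i => ?_)
      (fun n i j => ?_) n) (hz' (n, .inl (.inl ())))
    · rw [e1]; exact h1 n i
    · rw [e2]; exact h2 n i j
  · exact smul_inv_smul₀ hs _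
  · change s • weakPartial Ω i _ = _
    rw [e1]
    exact smul_inv_smul₀ hs _
  · change s • weakPartial Ω ij.2 (weakPartial Ω ij.1 _) = _
    rw [e2]
    exact smul_inv_smul₀ hs _

theorem jet_injective (hs : s ≠ 0) : Function.Injective (jet P Q s) := by
  intro V W h
  funext n
  have := congrArg (fun z => z.ofLp (n, .inl (.inr ()))) h
  exact smul_right_injective _ hs this

theorem existsUnique_isMinOn_jet (hΩ : IsOpen Ω) (hν : ContinuousOn ν (frontier Ω)) (hs : s ≠ 0)
    (hne : (admissible Ω ν F G).Nonempty) :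
    ∃! W, W ∈ admissible Ω ν F G ∧
      IsMinOn (fun W => ‖jet P Q s W‖ ^ 2) (admissible Ω ν F G) W :=
  existsUnique_isMinOn_norm_sq hne (jet_injective hs).injOn (isClosed_jet_image hΩ hs)
    (convex_jet_image hΩ hν)

end Minimizer

/-! ### The quasi-reversibility functional -/

section Functional

variable {d N : ℕ} {Ω : Set (E d)} {ν : E d → E d} {F G Fδ Gδ : E d → Fin N → ℂ} {a b k : ℝ}
  {c₀ : E d → ℝ} {u₀ : E d → ℝ → ℂ}
  {P : Fin N → Fin N → L2 Ω →L[ℂ] L2 Ω} {Q : Fin d → Fin N → Fin N → L2 Ω →L[ℂ] L2 Ω}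

theorem residual_ae_eq
    (hP : ∀ n m u, P n m u =ᵐ[volume.restrict Ω] fun x =>
      ((matS N a b)⁻¹ * matA N a b k c₀ u₀ x) n m * u x)
    (hQ : ∀ i n m u, Q i n m u =ᵐ[volume.restrict Ω] fun x =>
      ((matS N a b)⁻¹ * matB N a b u₀ i x) n m * u x) (W : Fin N → L2 Ω) (n : Fin N) :
    (fun x => residual Ω a b k c₀ u₀ W x n) =ᵐ[volume.restrict Ω] ellipticOp P Q W n := by
  filter_upwards [ellipticOp_apply hP hQ W n] with x hx
  rw [hx]
  simp only [residual, Pi.add_apply, Finset.sum_apply, Matrix.mulVec, dotProduct]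

theorem J_eq
    (hP : ∀ n m u, P n m u =ᵐ[volume.restrict Ω] fun x =>
      ((matS N a b)⁻¹ * matA N a b k c₀ u₀ x) n m * u x)
    (hQ : ∀ i n m u, Q i n m u =ᵐ[volume.restrict Ω] fun x =>
      ((matS N a b)⁻¹ * matB N a b u₀ i x) n m * u x) (ε : ℝ) (W : Fin N → L2 Ω) :
    J Ω a b k c₀ u₀ ε W = (∑ n, ‖ellipticOp P Q W n‖ ^ 2) + ε * normSqH2 Ω W := by
  have h1 : ∫ x in Ω, ∑ n, ‖residual Ω a b k c₀ u₀ W x n‖ ^ 2 =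
      ∫ x in Ω, ∑ n, ‖ellipticOp P Q W n x‖ ^ 2 := by
    refine integral_congr_ae ?_
    filter_upwards [eventually_all.2 (residual_ae_eq hP hQ W)] with x hx
    simp only [hx]
  rw [J, h1, integral_finsetSum _ fun n _ =>
    (Lp.memLp (ellipticOp P Q W n)).integrable_norm_pow two_ne_zero]
  simp only [norm_sq_eq_integral]

theorem ellipticOp_eq_zero
    (hP : ∀ n m u, P n m u =ᵐ[volume.restrict Ω] fun x =>
      ((matS N a b)⁻¹ * matA N a b k c₀ u₀ x) n m * u x)
    (hQ : ∀ i n m u, Q i n m u =ᵐ[volume.restrict Ω] fun x =>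
      ((matS N a b)⁻¹ * matB N a b u₀ i x) n m * u x) {W : Fin N → L2 Ω}
    (hW : ∀ᵐ x ∂(volume.restrict Ω), residual Ω a b k c₀ u₀ W x = 0) :
    ellipticOp P Q W = 0 := by
  funext n
  refine (Lp.eq_zero_iff_ae_eq_zero).2 ?_
  filter_upwards [residual_ae_eq hP hQ W n, hW] with x h1 h2
  rw [← h1, h2]
  rfl

/-- The purely functional part of the error estimate: only the stability bound `C₁`, the boundedness
`C₂` of the operator on `H²`, and comparison with one competitor are used. -/
theorem normSqH1_sub_le_of_forall_le (hΩ : IsOpen Ω) (hν : ContinuousOn ν (frontier Ω)) {C₁ C₂ : ℝ}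
    (hC₁ : 0 ≤ C₁) (hC₂ : 0 ≤ C₂)
    (hstab : ∀ V ∈ admissible (N := N) Ω ν 0 0,
      normSqH1 Ω V ≤ C₁ * ∑ n, ‖ellipticOp P Q V n‖ ^ 2)
    (hbdd : ∀ W : Fin N → L2 Ω, ∑ n, ‖ellipticOp P Q W n‖ ^ 2 ≤ C₂ * normSqH2 Ω W)
    {δ ε : ℝ} (hε : 0 < ε) (hnoise : HasNoiseLevel Ω ν F G Fδ Gδ δ)
    {Wtrue Wmin : Fin N → L2 Ω} (htrue : Wtrue ∈ admissible Ω ν F G)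
    (hzero : ellipticOp P Q Wtrue = 0) (hmin : Wmin ∈ admissible Ω ν Fδ Gδ)
    (hle : ∀ W ∈ admissible Ω ν Fδ Gδ, (∑ n, ‖ellipticOp P Q Wmin n‖ ^ 2) + ε * normSqH2 Ω Wmin ≤
      (∑ n, ‖ellipticOp P Q W n‖ ^ 2) + ε * normSqH2 Ω W) :
    normSqH1 Ω (Wmin - Wtrue) ≤
      (8 * (C₁ + 1) * (C₂ + 1)) * (δ ^ 2 + ε * normSqH2 Ω Wtrue) := by
  obtain ⟨R, hR, hRδ⟩ := hnoise
  have hR2 : normSqH2 Ω R ≤ δ ^ 2 := by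
    rw [← Real.sq_sqrt (normSqH2_nonneg R)]
    exact pow_le_pow_left₀ (Real.sqrt_nonneg _) hRδ 2
  have hR0 := normSqH2_nonneg R
  have hT0 := normSqH2_nonneg Wtrue
  have hM0 := normSqH2_nonneg Wmin
  have memR : ∀ n, MemH2 Ω (R n) := fun n => (hR n).1
  have memT : ∀ n, MemH2 Ω (Wtrue n) := fun n => (htrue n).1
  have memM : ∀ n, MemH2 Ω (Wmin n) := fun n => (hmin n).1
  -- Adding the noise function corrects the boundary data of the true solution, which makes it a
  -- competitor.
  have hTR : Wtrue + R ∈ admissible Ω ν Fδ Gδ := by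
    have := admissible_add hΩ hν htrue hR
    rwa [add_sub_cancel, add_sub_cancel] at this
  have hJ := hle _ hTR
  rw [ellipticOp_add hΩ memT memR, hzero, zero_add] at hJ
  have hJ2 := normSqH2_add_le hΩ memT memR
  have hbR := hbdd R
  set M := ∑ n, ‖ellipticOp P Q Wmin n‖ ^ 2
  have hM : 0 ≤ M := by positivity
  have hC₂δ : C₂ * normSqH2 Ω R ≤ C₂ * δ ^ 2 := mul_le_mul_of_nonneg_left hR2 hC₂
  have hεT : 0 ≤ ε * normSqH2 Ω Wtrue := mul_nonneg hε.le hT0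
  have hεR : ε * normSqH2 Ω R ≤ ε * δ ^ 2 := mul_le_mul_of_nonneg_left hR2 hε.le
  have hεJ := mul_le_mul_of_nonneg_left hJ2 hε.le
  have hδ : 0 ≤ δ ^ 2 := sq_nonneg δ
  have hMJ : M + ε * normSqH2 Ω Wmin ≤
      C₂ * δ ^ 2 + 2 * ε * δ ^ 2 + 2 * (ε * normSqH2 Ω Wtrue) := by linarith
  set t := ε * normSqH2 Ω Wtrue
  have hC12 : 0 ≤ C₁ * C₂ := mul_nonneg hC₁ hC₂
  have memSm : ∀ {Y : Fin N → L2 Ω}, (∀ n, MemH2 Ω (Y n)) → ∀ n, MemH2 Ω (((-1 : ℝ) • Y) n) :=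
    fun h n => (h n).smul hΩ (-1)
  have negT : normSqH1 Ω ((-1 : ℝ) • Wtrue) = normSqH1 Ω Wtrue := by
    simp only [normSqH1, Pi.smul_apply, weakPartial_smul hΩ (-1) (memT _).1, norm_smul, norm_neg,
      norm_one, one_mul]
  -- The competitor costs a term `2 ε δ²`, harmless only for bounded `ε`. In this range, stability
  -- is applied to the difference with zero Cauchy data.
  rcases le_total ε 1 with h1 | h1
  · have hV : Wmin - (Wtrue + R) ∈ admissible Ω ν 0 0 := by
      have := admissible_sub hΩ hν hmin hTR
      rwa [sub_self, sub_self] at this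
    have memTR : ∀ n, MemH2 Ω ((Wtrue + R) n) := fun n => (hTR n).1
    have hRV : ellipticOp P Q (Wmin - (Wtrue + R)) = ellipticOp P Q Wmin - ellipticOp P Q R := by
      rw [sub_eq_add_neg, ← neg_one_smul ℝ, ellipticOp_add hΩ memM (memSm memTR),
        ellipticOp_smul hΩ _ memTR, ellipticOp_add hΩ memT memR, hzero, zero_add, neg_one_smul,
        ← sub_eq_add_neg]
    have hs := hstab _ hV
    rw [hRV] at hs
    have hs2 : ∑ n, ‖(ellipticOp P Q Wmin - ellipticOp P Q R) n‖ ^ 2 ≤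
        2 * M + 2 * ∑ n, ‖ellipticOp P Q R n‖ ^ 2 := by
      rw [Finset.mul_sum, Finset.mul_sum, ← Finset.sum_add_distrib]
      refine Finset.sum_le_sum fun n _ => ?_
      have := norm_add_sq_le (ellipticOp P Q Wmin n) (-ellipticOp P Q R n)
      rwa [norm_neg, ← sub_eq_add_neg] at this
    have hfin := normSqH1_add_le hΩ (V := Wmin - (Wtrue + R)) (W := R) (fun n => (hV n).1.1)
      fun n => (memR n).1
    rw [show Wmin - (Wtrue + R) + R = Wmin - Wtrue by abel] at hfin
    have hR1 := normSqH1_le_normSqH2 R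
    have hεδ : ε * δ ^ 2 ≤ δ ^ 2 := mul_le_of_le_one_left hδ h1
    have hεM : 0 ≤ ε * normSqH2 Ω Wmin := mul_nonneg hε.le hM0
    have hs3 : ∑ n, ‖(ellipticOp P Q Wmin - ellipticOp P Q R) n‖ ^ 2 ≤
        (4 * C₂ + 4) * δ ^ 2 + 4 * t := by linarith
    have hs4 := mul_le_mul_of_nonneg_left hs3 hC₁
    have hs5 : normSqH1 Ω (Wmin - Wtrue) ≤
        2 * (C₁ * ((4 * C₂ + 4) * δ ^ 2 + 4 * t)) + 2 * δ ^ 2 := by linarith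
    nlinarith [mul_nonneg hC₁ hδ, mul_nonneg hC₂ hδ, mul_nonneg hC12 hδ, mul_nonneg hC₁ hεT,
      mul_nonneg hC₂ hεT, mul_nonneg hC12 hεT]
  -- For `ε ≥ 1`, dividing the comparison by `ε` already bounds `Wmin` in `H²`, and the triangle
  -- inequality suffices without stability.
  · have hfin := normSqH1_add_le hΩ (V := Wmin) (W := (-1 : ℝ) • Wtrue) (fun n => (memM n).1)
      fun n => (memSm memT n).1
    rw [negT, neg_one_smul, ← sub_eq_add_neg] at hfin
    have hT1 := normSqH1_le_normSqH2 Wtrue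
    have hM1 := normSqH1_le_normSqH2 Wmin
    have hTt : normSqH2 Ω Wtrue ≤ t := le_mul_of_one_le_left hT0 h1
    have hCε : C₂ * δ ^ 2 ≤ ε * (C₂ * δ ^ 2) := le_mul_of_one_le_left (mul_nonneg hC₂ hδ) h1
    have hM2 : normSqH2 Ω Wmin ≤ C₂ * δ ^ 2 + 2 * δ ^ 2 + 2 * normSqH2 Ω Wtrue := by
      refine le_of_mul_le_mul_left ?_ hε
      have ht : t = ε * normSqH2 Ω Wtrue := rfl
      linarith
    have hs5 : normSqH1 Ω (Wmin - Wtrue) ≤ (2 * C₂ + 4) * δ ^ 2 + 6 * t := by linarith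
    nlinarith [mul_nonneg hC₁ hδ, mul_nonneg hC₂ hδ, mul_nonneg hC12 hδ, mul_nonneg hC₁ hεT,
      mul_nonneg hC₂ hεT, mul_nonneg hC12 hεT]

end Functional

end QuasiReversibility

end

/-! ### The main theorem -/

open QuasiReversibility in
theorem theorem4p1 {d : ℕ} (hd : 1 ≤ d) (N : ℕ)
    -- the domain and its outward unit normal
    (Ω : Set (E d)) (hΩo : IsOpen Ω) (hΩb : Bornology.IsBounded Ω) (hΩs : HasSmoothBoundary Ω)
    (ν : E d → E d) (hν : ∀ p ∈ frontier Ω, IsOuterUnitNormal Ω p (ν p))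
    -- the interval of angles, the wavenumber, the background medium and the incident wave
    (a b : ℝ) (hab : a < b) (k : ℝ) (hk : 0 < k)
    (c₀ : E d → ℝ) (hc₀m : Measurable c₀) (hc₀1 : ∀ x, 1 ≤ c₀ x) (hc₀b : ∃ M, ∀ x ∈ Ω, c₀ x ≤ M)
    (u₀ : E d → ℝ → ℂ)
    (hu₀ : ∃ U, IsOpen U ∧ closure Ω ⊆ U ∧
      ContDiffOn ℝ 3 (fun p : E d × ℝ => u₀ p.1 p.2) (U ×ˢ Icc a b))
    (hu₀0 : ∀ x ∈ closure Ω, ∀ θ ∈ Icc a b, u₀ x θ ≠ 0) :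
    (∀ (Fδ Gδ : E d → Fin N → ℂ) (ε : ℝ), 0 < ε → (admissible Ω ν Fδ Gδ).Nonempty →
      ∃! W : Fin N → L2 Ω, W ∈ admissible Ω ν Fδ Gδ ∧
        IsMinOn (J Ω a b k c₀ u₀ ε) (admissible Ω ν Fδ Gδ) W) ∧
    ∃ C : ℝ, 0 < C ∧
      ∀ (δ ε : ℝ) (F G Fδ Gδ : E d → Fin N → ℂ) (Wmin Wtrue : Fin N → L2 Ω), 0 < δ → 0 < ε →
        HasNoiseLevel Ω ν F G Fδ Gδ δ →
        (admissible Ω ν Fδ Gδ).Nonempty →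
        IsSolution Ω ν a b k c₀ u₀ F G Wtrue →
        Wmin ∈ admissible Ω ν Fδ Gδ →
        IsMinOn (J Ω a b k c₀ u₀ ε) (admissible Ω ν Fδ Gδ) Wmin →
        normSqH1 Ω (Wmin - Wtrue) ≤ C * (δ ^ 2 + ε * normSqH2 Ω Wtrue) := by
  obtain ⟨U, hU, hΩU, hu⟩ := hu₀
  have hνc := continuousOn_normal hΩo hΩs hν
  have hA := fun n m => exists_mulCoeff hΩo (IsBoundedCoeff.matrix_mul (matS N a b)⁻¹
    (isBoundedCoeff_matA hΩo hΩb N k hc₀m hc₀1 hc₀b hU hΩU hab hu hu₀0) n m)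
  have hB := fun i n m => exists_mulCoeff hΩo (IsBoundedCoeff.matrix_mul (matS N a b)⁻¹
    (isBoundedCoeff_matB hΩo hΩb N hU hΩU hab hu hu₀0 i) n m)
  choose P hP using hA
  choose Q hQ using hB
  refine ⟨fun Fδ Gδ ε hε hne => ?_, ?_⟩
  -- The scale `√ε` in the jet reproduces the factor `ε` of the penalty after squaring.
  · have hJ : J Ω a b k c₀ u₀ ε = fun W => ‖jet P Q (Real.sqrt ε) W‖ ^ 2 := by
      funext W
      rw [norm_jet_sq, Real.sq_sqrt hε.le, J_eq hP hQ]
    rw [hJ]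
    exact existsUnique_isMinOn_jet hΩo hνc (Real.sqrt_pos.2 hε).ne' hne
  · obtain ⟨C₁, hC₁, h1⟩ := exists_normSqH1_le_ellipticOp hd hΩo hΩb hΩs hν hP hQ
    obtain ⟨C₂, hC₂, h2⟩ := exists_sum_norm_ellipticOp_sq_le P Q
    refine ⟨8 * (C₁ + 1) * (C₂ + 1), by positivity,
      fun δ ε F G Fδ Gδ Wmin Wtrue _ hε hnoise _ htrue hmin hmin' => ?_⟩
    refine normSqH1_sub_le_of_forall_le hΩo hνc hC₁ hC₂ h1 h2 hε hnoise htrue.1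
      (ellipticOp_eq_zero hP hQ htrue.2) hmin fun W hW => ?_
    simpa only [J_eq hP hQ] using isMinOn_iff.1 hmin' W hW
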